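/- Fix a finite relational schema $\sigma$. A database $D$ over $\sigma$ consists of a finite domain and, for each $R\in\sigma$ of arity $r$, a finite set $R^D$ of $r$-tuples of domain elements; $\|D\|$ denotes its number of tuples. A full conjunctive query $q$ is a finite conjunction (set) of atoms $R(\bar x)$, $R\in\sigma$, all of whose variables are free; every variable of $q$ occurs in an atom. Its set of solutions $q(D)$ consists of the assignments of domain elements to the variables that make every atom of $q$ a fact of $D$. A set of atoms is acyclic if it has a join tree, that is, a tree whose nodes are the atoms such that for each variable the atoms containing it are connected in the tree. An endomorphism of $q$ is a map $\nu$ from the variables of $q$ to the variables of $q$ such that $R(\nu(\bar x))$ is an atom of $q$ for every atom $R(\bar x)$ of $q$; the query $I$ with atoms $R(\nu(\bar x))$, for $R(\bar x)$ an atom of $q$, is then called an image of $q$. The query $q$ is a mirror if it has an acyclic image $I$ such that the atoms of $q$ that are not in $I$ form a query isomorphic to $I$, by an isomorphism (a bijection of the variables carrying the atoms of one query exactly onto those of the other) that fixes every variable occurring in both. Proposition. Every mirror full conjunctive query $q$ can be enumerated with constant delay after linear preprocessing. Precisely, there are a program of a random access machine (integer registers and an integer-addressed memory, initially zero except for the input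 and its length; constants, addition, multiplication, comparisons and jumps, indirect loads and stores, output of a tuple of registers, each in one time unit) and a constant $c$, both depending only on $q$ (and $\sigma$), such that for every database $D$ with natural numbers as elements, and every listing of the relations of $D$ in the memory (for each relation the number of its tuples followed by its tuples, in any order), the program halts; it outputs every solution in $q(D)$ exactly once and nothing else; after an initial phase of at most $c\cdot(\|D\|+1)$ steps without output, from any moment on at most $c$ steps pass until the next output starts or the machine has halted; and all numbers and addresses used are at most $N^c$, where $N$ is $2$ plus the length of the input plus its largest entry. The memory used during the enumeration may be superlinear in the size of the input. -/

import Mathlib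

namespace MirrorCQ

/-! ### Schemas, databases, full conjunctive queries -/

/-- A finite relational schema: finitely many relation symbols, each with an arity. -/
structure Schema where
  numSymbols : ℕ
  arity : Fin numSymbols → ℕ

/-- A database over `S`: a finite domain (of elements named by natural numbers) and, for each
relation symbol `R` of arity `r`, a finite set of `r`-tuples of domain elements. -/
structure Database (S : Schema) where
  dom : Finset ℕ
  rel : (R : Fin S.numSymbols) → Finset (Fin (S.arity R) → ℕ)
  rel_mem_dom : ∀ R, ∀ t ∈ rel R, ∀ j, t j ∈ dom

/-- The size of a database: the number of its facts. -/
def Database.size {S : Schema} (D : Database S) : ℕ := ∑ R, (D.rel R).card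

/-- An atom `R(x̄)` over the variables `Fin n`. Variables may be repeated. -/
abbrev Atom (S : Schema) (n : ℕ) : Type := (R : Fin S.numSymbols) × (Fin (S.arity R) → Fin n)

/-- The set of variables occurring in an atom. -/
def Atom.vars {S : Schema} {n : ℕ} (a : Atom S n) : Set (Fin n) := Set.range a.2

/-- The atom `R(f(x̄))` obtained from `R(x̄)`. -/
def Atom.map {S : Schema} {n : ℕ} (f : Fin n → Fin n) (a : Atom S n) : Atom S n := ⟨a.1, f ∘ a.2⟩

/-- The set of variables occurring in a set of atoms. -/
def varsOf {S : Schema} {n : ℕ} (A : Finset (Atom S n)) : Set (Fin n) :=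
  {x | ∃ a ∈ A, x ∈ Atom.vars a}

/-- A full conjunctive query: a conjunction of atoms, all of whose variables are free. The
variables are named `0, …, numVars - 1`, and each of them occurs in some atom. -/
structure FullCQ (S : Schema) where
  numVars : ℕ
  atoms : Finset (Atom S numVars)
  covered : ∀ x, x ∈ varsOf atoms

/-- The solutions of `q` over `D`, as tuples indexed by the variables of `q`. -/
def FullCQ.solutions {S : Schema} (q : FullCQ S) (D : Database S) : Set (Fin q.numVars → ℕ) :=
  {v | (∀ x, v x ∈ D.dom) ∧ ∀ a ∈ q.atoms, v ∘ a.2 ∈ D.rel a.1}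

/-! ### Acyclicity, images, mirror queries -/

/-- `T` is a join tree for the set `A` of atoms: a tree with node set `A` such that, for each
variable `x`, the nodes whose atoms contain `x` are connected in `T`. (A tree is a connected
acyclic graph; the tree without nodes is allowed, for the empty set of atoms.) -/
def IsJoinTree {S : Schema} {n : ℕ} (A : Finset (Atom S n))
    (T : SimpleGraph {a : Atom S n // a ∈ A}) : Prop :=
  T.Preconnected ∧ T.IsAcyclic ∧
    ∀ x : Fin n, (T.induce {a | x ∈ Atom.vars a.1}).Preconnected

/-- A set of atoms is acyclic if it has a join tree. -/
def IsAcyclic {S : Schema} {n : ℕ} (A : Finset (Atom S n)) : Prop :=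
  ∃ T : SimpleGraph {a : Atom S n // a ∈ A}, IsJoinTree A T

/-- A mapping from the variables of `q` to the variables of `q` that preserves the atoms of `q`. -/
def FullCQ.IsEndomorphism {S : Schema} (q : FullCQ S) (ν : Fin q.numVars → Fin q.numVars) : Prop :=
  ∀ a ∈ q.atoms, Atom.map ν a ∈ q.atoms

/-- `I` is (the set of atoms of) an image of `q`: the subquery that is the image of `q` by some
endomorphism of `q`. -/
def FullCQ.IsImage {S : Schema} (q : FullCQ S) (I : Finset (Atom S q.numVars)) : Prop :=
  ∃ ν, q.IsEndomorphism ν ∧ I = q.atoms.image (Atom.map ν)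

/-- `f` is an isomorphism from the query with atoms `A` to the query with atoms `B`: a bijection
from the variables of `A` onto the variables of `B` that carries the atoms of `A` exactly onto
the atoms of `B`. -/
def IsIsomorphism {S : Schema} {n : ℕ} (f : Fin n → Fin n) (A B : Finset (Atom S n)) : Prop :=
  Set.BijOn f (varsOf A) (varsOf B) ∧ A.image (Atom.map f) = B

/-- `q` is a mirror: it has an acyclic image `I` such that the remaining atoms form a query
isomorphic to `I` by an isomorphism that is the identity on the shared variables. -/
def FullCQ.IsMirror {S : Schema} (q : FullCQ S) : Prop :=
  ∃ I, q.IsImage I ∧ IsAcyclic I ∧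
    ∃ f, IsIsomorphism f I (q.atoms \ I) ∧ ∀ x ∈ varsOf I ∩ varsOf (q.atoms \ I), f x = x

/-! ### Random access machines with uniform-cost addition and multiplication -/

/-- Instructions. Operands are names of registers, jump targets `l` are positions in the program.
* `const r k` : `reg r := k`
* `add r a b`, `mul r a b` : `reg r := reg a + reg b`, `reg r := reg a * reg b`
* `load r a` : `reg r := mem (reg a)`
* `store a r` : `mem (reg a) := reg r`
* `jmp l`, `jlt a b l`, `jeq a b l` : jump to `l`, always, if `reg a < reg b`, if `reg a = reg b`
* `emit rs` : output the tuple of the contents of the registers in the list `rs`. -/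
inductive Instr where
  | const (r k : ℕ)
  | add (r a b : ℕ)
  | mul (r a b : ℕ)
  | load (r a : ℕ)
  | store (a r : ℕ)
  | jmp (l : ℕ)
  | jlt (a b l : ℕ)
  | jeq (a b l : ℕ)
  | emit (rs : List ℕ)

abbrev Program : Type := List Instr

/-- A configuration: program counter, registers, memory. -/
structure Config where
  pc : ℕ
  reg : ℕ → ℕ
  mem : ℕ → ℕ

/-- The effect of one instruction. -/
def Instr.exec : Instr → Config → Config
  | .const r k, c => ⟨c.pc + 1, Function.update c.reg r k, c.mem⟩
  | .add r a b, c => ⟨c.pc + 1, Function.update c.reg r (c.reg a + c.reg b), c.mem⟩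
  | .mul r a b, c => ⟨c.pc + 1, Function.update c.reg r (c.reg a * c.reg b), c.mem⟩
  | .load r a, c => ⟨c.pc + 1, Function.update c.reg r (c.mem (c.reg a)), c.mem⟩
  | .store a r, c => ⟨c.pc + 1, c.reg, Function.update c.mem (c.reg a) (c.reg r)⟩
  | .jmp l, c => ⟨l, c.reg, c.mem⟩
  | .jlt a b l, c => ⟨if c.reg a < c.reg b then l else c.pc + 1, c.reg, c.mem⟩
  | .jeq a b l, c => ⟨if c.reg a = c.reg b then l else c.pc + 1, c.reg, c.mem⟩
  | .emit _, c => ⟨c.pc + 1, c.reg, c.mem⟩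

/-- The machine has halted when the program counter points outside the program. -/
def Halted (p : Program) (c : Config) : Prop := p[c.pc]? = none

/-- One computation step; it takes one unit of time. -/
def step (p : Program) (c : Config) : Config :=
  match p[c.pc]? with
  | some i => i.exec c
  | none => c

/-- The tuple that is output by the next step from `c`, if that step outputs one. -/
def emission (p : Program) (c : Config) : Option (List ℕ) :=
  match p[c.pc]? with
  | some (.emit rs) => some (rs.map c.reg)
  | _ => none

/-- The initial configuration on input word `w`: the word stands at the beginning of the memory,
register `0` holds its length, and everything else is `0`. -/
def initConfig (w : List ℕ) : Config :=
  ⟨0, Function.update (fun _ => 0) 0 w.length, fun i => w.getD i 0⟩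

/-- The configuration after `t` steps on input `w`. -/
def run (p : Program) (w : List ℕ) (t : ℕ) : Config := (step p)^[t] (initConfig w)

/-! ### Enumeration with constant delay after linear preprocessing -/

/-- `w` is an encoding of `D`: for each relation symbol in turn, the number of its tuples, followed
by its tuples, listed in any order without repetition. -/
def Database.IsEncoding {S : Schema} (D : Database S) (w : List ℕ) : Prop :=
  ∃ rows : (R : Fin S.numSymbols) → List (Fin (S.arity R) → ℕ),
    (∀ R, (rows R).Nodup ∧ ∀ t, t ∈ rows R ↔ t ∈ D.rel R) ∧
    w = (List.finRange S.numSymbols).flatMap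
      fun R => (rows R).length :: (rows R).flatMap List.ofFn

/-- On input `w`, the program `p` enumerates the set `A` of tuples with preprocessing time `pre`
and delay `delay`: it halts; up to its halting it outputs exactly the elements of `A`, each of them
once; and there is a time `t₀ ≤ pre`, the end of the preprocessing phase, such that nothing is
output before `t₀` and from any moment `t ≥ t₀` on it takes at most `delay` steps until the next
output starts or the machine has halted. Moreover, no register ever holds a number
above `bound`; as memory is accessed only through registers, this bounds the addresses and the
numbers written to memory as well. -/
def Enumerates (p : Program) (w : List ℕ) (A : Set (List ℕ)) (pre delay bound : ℕ) : Prop :=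
  (∃ T, Halted p (run p w T)) ∧
  (∀ s, s ∈ A ↔ ∃ t, emission p (run p w t) = some s) ∧
  (∀ t t' s, emission p (run p w t) = some s → emission p (run p w t') = some s → t = t') ∧
  (∃ t₀ ≤ pre, (∀ t < t₀, emission p (run p w t) = none) ∧
    ∀ t ≥ t₀, ∃ u, t ≤ u ∧ u ≤ t + delay ∧
      (emission p (run p w u) ≠ none ∨ Halted p (run p w u))) ∧
  (∀ t r, (run p w t).reg r ≤ bound)

/-- The length of `w` plus its largest entry (plus 2, so that powers of it are never trivial). -/
def magnitude (w : List ℕ) : ℕ := w.length + w.foldr max 0 + 2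

/-- `q` can be enumerated with constant delay after linear preprocessing: some program and some
constant `c`, both depending only on `q`, work for all databases `D`. The preprocessing time is
linear in the size of `D`, the delay is constant, and the machine works with numbers and addresses
that are polynomial in the length and the entries of the input. -/
def FullCQ.ConstantDelayEnumerable {S : Schema} (q : FullCQ S) : Prop :=
  ∃ (p : Program) (c : ℕ), ∀ (D : Database S) (w : List ℕ), D.IsEncoding w →
    Enumerates p w (List.ofFn '' q.solutions D) (c * (D.size + 1)) c (magnitude w ^ c)

end MirrorCQ

namespace MirrorCQ

/-! Let `f` be the isomorphism from `I` onto the remaining atoms and `Z` the list of the shared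
variables. Then `v ↦ (v, v ∘ f)` identifies the solutions of `q` with the pairs of solutions of `I`
that agree on `Z` (`FullCQ.IsMirror.exists_splitting`). It therefore suffices to enumerate the
acyclic `I` and to pair up its solutions on the fly. Whenever a solution `s` of `I` appears, it is
stored, the pair `(s, s)` is output, and then `(s, u)` and `(u, s)` for every earlier `u` with the
same values on `Z`; these `u` form a linked list whose head is found by one lookup. Each pair is
output when the later of its components appears, hence exactly once. Since `(s, s)` is always
available, no solution of `I` is met in silence, and constant delay for `I` gives constant delay for
the pairs (`visitor_visits`).

For `I` the argument is the classical one for acyclic queries. Stripping leaves from a join tree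
orders the atoms as ears (`exists_earList`). In this order, one pass over the relation of each ear
keeps the tuples that extend to the ears below it and links them by their values on the shared
variables (`buildOne_runs`). The passes are linear because memory is addressed by lists of numbers
and is initially zero, so that a test for a matching tuple is a single read. Afterwards, nested
loops from the last ear down to the first never reach a dead end: a live tuple has a live partner in
every ear below (`loopEar_visits`). The nesting depth depends only on the query, and by `exec_chain`
a loop that outputs something in every round at most doubles the delay of its body, up to a
constant.

The machine part is a small language whose big-step semantics `Exec` records each machine step.
`Exec.steps` compiles it; lists become addresses through `enc`. Since `.inc` is the only arithmetic
of the language, numbers grow by at most one per step (`Exec.bounded`). The running time is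
polynomial because the number of solutions is, and addresses have boundedly many components, so all
numbers stay polynomial (`enc_le`, `polynomial_bound`). -/

/-! ### A structured language over an associative memory -/

/-- Register names of the structured language. -/
inductive Reg where
  | zero | aux | pos | row | ctr | cur
  | cnt (R : ℕ)
  | bankA (x : ℕ)
  | bankB (x : ℕ)
  | ptr (i : ℕ)
  deriving DecidableEq

/-- The machine register that holds a named register. -/
def Reg.code : Reg → ℕ
  | .zero => 5
  | .aux => 6
  | .pos => 7
  | .row => 8
  | .ctr => 9
  | .cur => 10
  | .cnt R => 11 + 4 * R
  | .bankA x => 12 + 4 * x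
  | .bankB x => 13 + 4 * x
  | .ptr i => 14 + 4 * i

theorem Reg.code_injective : Function.Injective Reg.code := by
  intro a b h
  cases a <;> cases b <;> simp only [Reg.code] at h <;> first | rfl | omega | (congr 1; omega)

/-- Machine registers below 5 stay free for compiled code: register 0 keeps the input length, and 1
to 4 are scratch for address computations. -/
theorem Reg.le_code (r : Reg) : 5 ≤ r.code := by
  cases r <;> simp only [Reg.code] <;> omega

/-- A state: named registers, and a memory addressed by lists of numbers. -/
structure State where
  reg : Reg → ℕ
  heap : List ℕ → ℕ

def State.set (σ : State) (r : Reg) (v : ℕ) : State := ⟨Function.update σ.reg r v, σ.heap⟩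

def State.write (σ : State) (l : List ℕ) (v : ℕ) : State := ⟨σ.reg, Function.update σ.heap l v⟩

@[simp] theorem State.set_heap (σ : State) (r : Reg) (v : ℕ) : (σ.set r v).heap = σ.heap := rfl
@[simp] theorem State.write_reg (σ : State) (l : List ℕ) (v : ℕ) : (σ.write l v).reg = σ.reg := rfl
theorem State.set_reg (σ : State) (r r' : Reg) (v : ℕ) :
    (σ.set r v).reg r' = if r' = r then v else σ.reg r' := by
  simp [State.set, Function.update_apply]
theorem State.write_heap (σ : State) (l l' : List ℕ) (v : ℕ) :
    (σ.write l v).heap l' = if l' = l then v else σ.heap l' := by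
  simp [State.write, Function.update_apply]
@[simp] theorem State.set_reg_self (σ : State) (r : Reg) (v : ℕ) : (σ.set r v).reg r = v := by
  simp [State.set_reg]
theorem State.set_reg_of_ne (σ : State) {r r' : Reg} (v : ℕ) (h : r' ≠ r) :
    (σ.set r v).reg r' = σ.reg r' := by
  simp [State.set_reg, h]

/-- Components of a memory address. -/
inductive Operand where
  | lit (k : ℕ)
  | reg (r : Reg)

def Operand.val (σ : State) : Operand → ℕ
  | .lit k => k
  | .reg r => σ.reg r

@[simp] theorem Operand.val_lit (σ : State) (k : ℕ) : (Operand.lit k).val σ = k := rfl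
@[simp] theorem Operand.val_reg (σ : State) (r : Reg) : (Operand.reg r).val σ = σ.reg r := rfl

/-- An injective numbering of the lists of numbers. -/
def enc : List ℕ → ℕ
  | [] => 0
  | a :: l => (a + enc l) * (a + enc l) + enc l + 1

/-- With `e = enc l` and `s = a + e`, the code of `a :: l` is `s ^ 2 + e + 1` with `e ≤ s`, so it
lies between `s ^ 2 + 1` and `s ^ 2 + s + 1`. These intervals are disjoint for different `s`; hence
`s`, then `e`, then `a` can be read off. -/
theorem enc_injective : Function.Injective enc := by
  intro l
  induction l with
  | nil => intro l' h; cases l' with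
    | nil => rfl
    | cons b l' => simp [enc] at h
  | cons a l ih =>
    intro l' h
    cases l' with
    | nil => simp [enc] at h
    | cons b l' =>
      simp only [enc] at h
      have h1 : a + enc l = b + enc l' := by
        by_contra hne
        rcases Nat.lt_or_gt_of_ne hne with hlt | hlt
        · nlinarith
        · nlinarith
      rw [h1] at h
      have h2 : enc l = enc l' := by omega
      have h3 : a = b := by omega
      rw [h3, ih h2]

open Classical in
/-- The linear memory that holds the input word `w` followed by the cells of `heap`. -/
noncomputable def memOf (w : List ℕ) (heap : List ℕ → ℕ) (i : ℕ) : ℕ :=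
  if i < w.length then w.getD i 0
  else if h : ∃ l, w.length + enc l = i then heap h.choose else 0

theorem memOf_enc (w : List ℕ) (heap : List ℕ → ℕ) (l : List ℕ) :
    memOf w heap (w.length + enc l) = heap l := by
  have h : ∃ l', w.length + enc l' = w.length + enc l := ⟨l, rfl⟩
  have h2 : h.choose = l := enc_injective (by have := h.choose_spec; omega)
  simp only [memOf, dif_pos h, h2]
  simp

theorem memOf_of_drop {w : List ℕ} {i x : ℕ} {tl : List ℕ} (heap : List ℕ → ℕ)
    (h : w.drop i = x :: tl) : memOf w heap i = x := by
  have hi : i < w.length := by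
    by_contra hge
    rw [List.drop_eq_nil_of_le (by omega)] at h
    cases h
  have hx : w[i]? = some x := by
    have := congrArg (fun l => l[0]?) h
    simpa using this
  simp only [memOf, hi, if_true, List.getD_eq_getElem?_getD, hx, Option.getD_some]

/-- The initial memory already represents the empty heap. Tables of superlinear extent thus come
without initialisation time, and an unwritten cell reads as the null pointer 0. -/
theorem memOf_zero (w : List ℕ) : memOf w (fun _ => 0) = fun i => w.getD i 0 := by
  funext i
  by_cases h : i < w.length
  · simp [memOf, h]
  · simp [memOf, h]

theorem memOf_update (w : List ℕ) (heap : List ℕ → ℕ) (l : List ℕ) (v : ℕ) :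
    memOf w (Function.update heap l v)
      = Function.update (memOf w heap) (w.length + enc l) v := by
  funext i
  by_cases hi : i = w.length + enc l
  · rw [hi, memOf_enc, Function.update_self, Function.update_self]
  · rw [Function.update_of_ne hi]
    by_cases h1 : i < w.length
    · simp [memOf, h1]
    · by_cases h : ∃ l', w.length + enc l' = i
      · obtain ⟨l', rfl⟩ := h
        rw [memOf_enc, memOf_enc, Function.update_of_ne]
        rintro rfl
        exact hi rfl
      · simp [memOf, h1, h]

theorem memOf_le {w : List ℕ} {heap : List ℕ → ℕ} {m : ℕ} (hw : ∀ x ∈ w, x ≤ m)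
    (hh : ∀ l, heap l ≤ m) (i : ℕ) : memOf w heap i ≤ m := by
  unfold memOf
  split_ifs with h1 h2
  · rw [List.getD_eq_getElem _ _ h1]
    exact hw _ (List.getElem_mem h1)
  · exact hh _
  · exact Nat.zero_le _

/-! ### Commands and their semantics with step counts -/

/-- Basic operations. -/
inductive Op where
  | const (r : Reg) (k : ℕ)
  | inc (r a : Reg)
  | input (r a : Reg)
  | get (r : Reg) (l : List Operand)
  | put (l : List Operand) (r : Reg)

noncomputable def Op.eval (w : List ℕ) : Op → State → State
  | .const r k, σ => σ.set r k
  | .inc r a, σ => σ.set r (σ.reg a + 1)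
  | .input r a, σ => σ.set r (memOf w σ.heap (σ.reg a))
  | .get r l, σ => σ.set r (σ.heap (l.map (Operand.val σ)))
  | .put l r, σ => σ.write (l.map (Operand.val σ)) (σ.reg r)

/-- The number of machine instructions for an operation. -/
def Op.cost : Op → ℕ
  | .const _ _ => 1
  | .inc _ _ => 2
  | .input _ _ => 1
  -- Computing an address takes one instruction plus six per component; two more add the offset of
  -- the heap and access the cell.
  | .get _ l => 1 + 6 * l.length + 2
  | .put l _ => 1 + 6 * l.length + 2

inductive Cmd where
  | skip
  | op (o : Op)
  | emit (rs : List Reg)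
  | seq (c₁ c₂ : Cmd)
  | ifeq (a b : Reg) (c₁ c₂ : Cmd)
  | whileNe (a b : Reg) (c : Cmd)

/-- One entry for each machine step: the tuple output by that step, if any. -/
abbrev Trace : Type := List (Option (List ℕ))

/-- `Exec w C σ tr σ'`: with the input word `w`, the command `C` leads from `σ` to `σ'`, and the
compiled code takes the steps recorded in `tr`. -/
inductive Exec (w : List ℕ) : Cmd → State → Trace → State → Prop
  | skip (σ : State) : Exec w .skip σ [] σ
  | op (o : Op) (σ : State) : Exec w (.op o) σ (List.replicate o.cost none) (o.eval w σ)
  | emit (rs : List Reg) (σ : State) : Exec w (.emit rs) σ [some (rs.map σ.reg)] σ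
  | seq {c₁ c₂ : Cmd} {σ σ₁ σ₂ : State} {t₁ t₂ : Trace} (h₁ : Exec w c₁ σ t₁ σ₁)
      (h₂ : Exec w c₂ σ₁ t₂ σ₂) : Exec w (.seq c₁ c₂) σ (t₁ ++ t₂) σ₂
  | ifTrue {a b : Reg} {c₁ c₂ : Cmd} {σ σ' : State} {t : Trace} (h : σ.reg a = σ.reg b)
      (h₁ : Exec w c₁ σ t σ') : Exec w (.ifeq a b c₁ c₂) σ (none :: t) σ'
  -- The compiled else branch stands first and ends with a jump over the then branch, which accounts
  -- for the additional silent step.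
  | ifFalse {a b : Reg} {c₁ c₂ : Cmd} {σ σ' : State} {t : Trace} (h : σ.reg a ≠ σ.reg b)
      (h₁ : Exec w c₂ σ t σ') : Exec w (.ifeq a b c₁ c₂) σ (none :: (t ++ [none])) σ'
  | whileDone {a b : Reg} {c : Cmd} {σ : State} (h : σ.reg a = σ.reg b) :
      Exec w (.whileNe a b c) σ [none] σ
  | whileStep {a b : Reg} {c : Cmd} {σ σ₁ σ₂ : State} {t t' : Trace} (h : σ.reg a ≠ σ.reg b)
      (h₁ : Exec w c σ t σ₁) (h₂ : Exec w (.whileNe a b c) σ₁ t' σ₂) :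
      Exec w (.whileNe a b c) σ (none :: (t ++ none :: t')) σ₂

/-! ### Code without loops and output -/

def Cmd.Plain : Cmd → Prop
  | .skip => True
  | .op _ => True
  | .emit _ => False
  | .seq c₁ c₂ => c₁.Plain ∧ c₂.Plain
  | .ifeq _ _ c₁ c₂ => c₁.Plain ∧ c₂.Plain
  | .whileNe _ _ _ => False

/-- Meaningful for `Plain` commands only, where it is an upper bound: both branches of a conditional
are charged. -/
def Cmd.cost : Cmd → ℕ
  | .skip => 0
  | .op o => o.cost
  | .emit _ => 1
  | .seq c₁ c₂ => c₁.cost + c₂.cost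
  | .ifeq _ _ c₁ c₂ => c₁.cost + c₂.cost + 2
  | .whileNe _ _ _ => 0

noncomputable def Cmd.eval (w : List ℕ) : Cmd → State → State
  | .skip, σ => σ
  | .op o, σ => o.eval w σ
  | .emit _, σ => σ
  | .seq c₁ c₂, σ => c₂.eval w (c₁.eval w σ)
  | .ifeq a b c₁ c₂, σ => if σ.reg a = σ.reg b then c₁.eval w σ else c₂.eval w σ
  | .whileNe _ _ _, σ => σ

/-- `C` leads from `σ` to `σ'` without output in at most `k` steps. -/
def Runs (w : List ℕ) (C : Cmd) (k : ℕ) (σ σ' : State) : Prop :=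
  ∃ i ≤ k, Exec w C σ (List.replicate i none) σ'

theorem Runs.mono {w : List ℕ} {C : Cmd} {k k' : ℕ} {σ σ' : State} (h : Runs w C k σ σ')
    (hk : k ≤ k') : Runs w C k' σ σ' := by
  obtain ⟨i, hi, h⟩ := h
  exact ⟨i, hi.trans hk, h⟩

theorem Runs.seq {w : List ℕ} {C₁ C₂ : Cmd} {k₁ k₂ : ℕ} {σ σ₁ σ₂ : State}
    (h₁ : Runs w C₁ k₁ σ σ₁) (h₂ : Runs w C₂ k₂ σ₁ σ₂) :
    Runs w (.seq C₁ C₂) (k₁ + k₂) σ σ₂ := by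
  obtain ⟨i, hi, h₁⟩ := h₁
  obtain ⟨j, hj, h₂⟩ := h₂
  refine ⟨i + j, by omega, ?_⟩
  rw [List.replicate_add]
  exact h₁.seq h₂

theorem Cmd.Plain.runs {w : List ℕ} {C : Cmd} (hC : C.Plain) (σ : State) :
    Runs w C C.cost σ (C.eval w σ) := by
  induction C generalizing σ with
  | skip => exact ⟨0, le_rfl, .skip σ⟩
  | op o => exact ⟨o.cost, le_rfl, .op o σ⟩
  | emit rs => exact hC.elim
  | seq c₁ c₂ ih₁ ih₂ => exact (ih₁ hC.1 σ).seq (ih₂ hC.2 _)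
  | ifeq a b c₁ c₂ ih₁ ih₂ =>
    by_cases h : σ.reg a = σ.reg b
    · obtain ⟨i, hi, h₁⟩ := ih₁ hC.1 σ
      refine ⟨i + 1, by simp only [Cmd.cost]; omega, ?_⟩
      simp only [Cmd.eval, if_pos h]
      exact .ifTrue h h₁
    · obtain ⟨i, hi, h₁⟩ := ih₂ hC.2 σ
      refine ⟨i + 1 + 1, by simp only [Cmd.cost]; omega, ?_⟩
      simp only [Cmd.eval, if_neg h]
      rw [List.replicate_succ, List.replicate_succ']
      exact .ifFalse h h₁
  | whileNe a b c => exact hC.elim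

def Cmd.block (l : List Op) : Cmd := l.foldr (fun o c => .seq (.op o) c) .skip

theorem Cmd.block_plain (l : List Op) : (Cmd.block l).Plain := by
  induction l with
  | nil => trivial
  | cons o l ih => exact ⟨trivial, ih⟩

@[simp] theorem Cmd.eval_block_nil (w : List ℕ) (σ : State) : (Cmd.block []).eval w σ = σ := rfl
@[simp] theorem Cmd.eval_block_cons (w : List ℕ) (o : Op) (l : List Op) (σ : State) :
    (Cmd.block (o :: l)).eval w σ = (Cmd.block l).eval w (o.eval w σ) := rfl

/-- A loop whose counter runs up to a limit. -/
theorem Runs.count {w : List ℕ} {C : Cmd} {a b : Reg} {k N : ℕ} {J : ℕ → State → Prop}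
    (hJ : ∀ j σ, J j σ → σ.reg a = j ∧ σ.reg b = N)
    (hC : ∀ j σ, j < N → J j σ → ∃ σ', Runs w C k σ σ' ∧ J (j + 1) σ')
    {σ : State} (h : J 0 σ) : ∃ σ', Runs w (.whileNe a b C) (N * (k + 2) + 1) σ σ' ∧ J N σ' := by
  have main : ∀ i j σ, i + j = N → J j σ →
      ∃ σ', Runs w (.whileNe a b C) (i * (k + 2) + 1) σ σ' ∧ J N σ' := by
    intro i
    induction i with
    | zero =>
      intro j σ hj h
      obtain ⟨h1, h2⟩ := hJ j σ h
      have : j = N := by omega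
      subst this
      exact ⟨σ, ⟨1, by omega, .whileDone (by rw [h1, h2])⟩, h⟩
    | succ i ih =>
      intro j σ hj h
      obtain ⟨h1, h2⟩ := hJ j σ h
      obtain ⟨σ₁, ⟨x, hx, e₁⟩, hσ₁⟩ := hC j σ (by omega) h
      obtain ⟨σ₂, ⟨y, hy, e₂⟩, hσ₂⟩ := ih (j + 1) σ₁ (by omega) hσ₁
      refine ⟨σ₂, ⟨(x + (y + 1)) + 1, by rw [Nat.succ_mul]; omega, ?_⟩, hσ₂⟩
      rw [List.replicate_succ, List.replicate_add, List.replicate_succ]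
      exact .whileStep (by omega) e₁ e₂
  exact main N 0 σ (by omega) h

/-! ### Gaps between outputs -/

/-- The number of silent steps at the beginning of a trace. -/
def lead : Trace → ℕ
  | [] => 0
  | none :: t => lead t + 1
  | some _ :: _ => 0

/-- At most `d` successive steps of the trace are silent. -/
def Gap (d : ℕ) : Trace → Prop
  | [] => True
  | e :: t => lead (e :: t) ≤ d ∧ Gap d t

/-- The outputs of a trace. -/
def outputs (t : Trace) : List (List ℕ) := t.filterMap id

@[simp] theorem outputs_append (s t : Trace) : outputs (s ++ t) = outputs s ++ outputs t := by
  simp [outputs]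
@[simp] theorem outputs_nil : outputs [] = [] := rfl
@[simp] theorem outputs_none (t : Trace) : outputs (none :: t) = outputs t := rfl
@[simp] theorem outputs_some (o : List ℕ) (t : Trace) : outputs (some o :: t) = o :: outputs t := rfl
@[simp] theorem outputs_replicate (k : ℕ) : outputs (List.replicate k none) = [] := by
  induction k with
  | zero => rfl
  | succ k ih => simpa [List.replicate_succ] using ih

theorem lead_append_le (s t : Trace) : lead (s ++ t) ≤ lead s + lead t := by
  induction s with
  | nil => simp [lead]
  | cons e s ih =>
    cases e with
    | none => simp only [List.cons_append, lead]; omega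
    | some o => simp [lead]

theorem lead_append_of_outputs {s : Trace} (h : outputs s ≠ []) (t : Trace) :
    lead (s ++ t) = lead s := by
  induction s with
  | nil => simp at h
  | cons e s ih =>
    cases e with
    | none => simp only [List.cons_append, lead]; rw [ih (by simpa using h)]
    | some o => simp [lead]

@[simp] theorem lead_replicate (k : ℕ) : lead (List.replicate k none) = k := by
  induction k with
  | zero => rfl
  | succ k ih => simp [List.replicate_succ, lead, ih]

theorem Gap.lead_le {d : ℕ} {t : Trace} (h : Gap d t) : lead t ≤ d := by
  cases t with
  | nil => simp [lead]
  | cons e t => exact h.1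

theorem Gap.mono {d d' : ℕ} {t : Trace} (h : Gap d t) (hd : d ≤ d') : Gap d' t := by
  induction t with
  | nil => trivial
  | cons e t ih => exact ⟨h.1.trans hd, ih h.2⟩

/-- A silence across the seam consists of the end of `s` and the beginning of `t`. Only the lead of
`t` adds to `d`, not its whole gap, which keeps the delay bounded under repeated concatenation. -/
theorem Gap.append {d b g : ℕ} {s t : Trace} (hs : Gap d s) (hb : lead t ≤ b) (ht : Gap g t)
    (h : d + b ≤ g) : Gap g (s ++ t) := by
  induction s with
  | nil => exact ht
  | cons e s ih =>
    have h1 := lead_append_le (e :: s) t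
    have h2 := hs.1
    exact ⟨h1.trans (by omega), ih hs.2⟩

theorem Gap.append_add {d g : ℕ} {s t : Trace} (hs : Gap d s) (ht : Gap g t) :
    Gap (d + g) (s ++ t) :=
  hs.append ht.lead_le (ht.mono (by omega)) le_rfl

theorem gap_replicate {k d : ℕ} (h : k ≤ d) : Gap d (List.replicate k none) := by
  induction k with
  | zero => trivial
  | succ k ih =>
    rw [List.replicate_succ]
    exact ⟨by rw [← List.replicate_succ, lead_replicate]; exact h, ih (by omega)⟩

/-- Each output is followed by at most `d` silent steps, and at most `d` precede the first. The
total time is thereby bounded by the number of outputs, from which bounds on register contents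
follow. -/
theorem Gap.length_le {d : ℕ} {t : Trace} (h : Gap d t) :
    t.length ≤ (d + 1) * ((outputs t).length + 1) := by
  suffices H : t.length + d ≤ lead t + (d + 1) * (outputs t).length + d by
    have := h.lead_le
    rw [Nat.mul_succ]; omega
  induction t with
  | nil => simp [lead]
  | cons e t ih =>
    have ih := ih h.2
    cases e with
    | none => simp only [List.length_cons, lead, outputs_none]; omega
    | some o =>
      have := h.2.lead_le
      simp only [List.length_cons, lead, outputs_some, Nat.mul_succ]; omega

theorem Gap.exists_output {d : ℕ} {t : Trace} (h : Gap d t) {i : ℕ} (hi : i ≤ t.length) :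
    ∃ u, i ≤ u ∧ u ≤ i + d ∧ ((∃ o, t[u]? = some (some o)) ∨ t.length ≤ u) := by
  induction t generalizing i with
  | nil => exact ⟨i, le_rfl, by omega, .inr (by simp)⟩
  | cons e t ih =>
    cases i with
    | succ i =>
      obtain ⟨u, h1, h2, h3⟩ := ih h.2 (i := i) (by simpa using hi)
      exact ⟨u + 1, by omega, by omega, by simpa using h3⟩
    | zero =>
      have key : ∀ t : Trace, (∃ o, t[lead t]? = some (some o)) ∨ t.length ≤ lead t := by
        intro t
        induction t with
        | nil => simp
        | cons e t ih =>
          cases e with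
          | none => simpa [lead] using ih
          | some o => simp [lead]
      exact ⟨lead (e :: t), by omega, by simpa using h.1, key _⟩

/-! ### Compilation -/

/-- Code that replaces the number `e` in register `2` by `(a + e) ^ 2 + e + 1`, for the value `a` of
the operand. -/
def Operand.code : Operand → List Instr
  | .lit k => [.const 4 k, .add 3 4 2, .mul 3 3 3, .add 3 3 2, .const 1 1, .add 2 3 1]
  -- The idle `.const 4 0` makes both kinds of operands take six instructions.
  | .reg r => [.const 4 0, .add 3 r.code 2, .mul 3 3 3, .add 3 3 2, .const 1 1, .add 2 3 1]

/-- Code that computes the number of a list in register `2`. -/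
def addrCode : List Operand → List Instr
  | [] => [.const 2 0]
  | o :: l => addrCode l ++ o.code

def Op.code : Op → List Instr
  | .const r k => [.const r.code k]
  | .inc r a => [.const 1 1, .add r.code a.code 1]
  | .input r a => [.load r.code a.code]
  | .get r l => addrCode l ++ [.add 2 2 0, .load r.code 2]
  | .put l r => addrCode l ++ [.add 2 2 0, .store 2 r.code]

def Cmd.size : Cmd → ℕ
  | .skip => 0
  | .op o => o.cost
  | .emit _ => 1
  | .seq c₁ c₂ => c₁.size + c₂.size
  | .ifeq _ _ c₁ c₂ => c₂.size + 2 + c₁.size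
  | .whileNe _ _ c => c.size + 2

/-- The machine code of a command, to be placed at position `s` of the program. -/
def Cmd.code (s : ℕ) : Cmd → List Instr
  | .skip => []
  | .op o => o.code
  | .emit rs => [.emit (rs.map Reg.code)]
  | .seq c₁ c₂ => c₁.code s ++ c₂.code (s + c₁.size)
  | .ifeq a b c₁ c₂ =>
      .jeq a.code b.code (s + (c₂.size + 2)) ::
        (c₂.code (s + 1) ++ .jmp (s + (c₂.size + 2 + c₁.size)) :: c₁.code (s + (c₂.size + 2)))
  | .whileNe a b c => .jeq a.code b.code (s + (c.size + 2)) :: (c.code (s + 1) ++ [.jmp s])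

/-! ### Length and placement of compiled code -/

theorem Operand.length_code (o : Operand) : o.code.length = 6 := by cases o <;> rfl

theorem length_addrCode (l : List Operand) : (addrCode l).length = 1 + 6 * l.length := by
  induction l with
  | nil => rfl
  | cons o l ih => simp only [addrCode, List.length_append, ih, o.length_code, List.length_cons]; ring

theorem Op.length_code (o : Op) : o.code.length = o.cost := by
  cases o <;> simp [Op.code, Op.cost, length_addrCode]

theorem Cmd.length_code (C : Cmd) (s : ℕ) : (C.code s).length = C.size := by
  induction C generalizing s with
  | skip => rfl
  | op o => exact o.length_code
  | emit rs => rfl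
  | seq c₁ c₂ ih₁ ih₂ => simp [Cmd.code, Cmd.size, ih₁, ih₂]
  | ifeq a b c₁ c₂ ih₁ ih₂ => simp [Cmd.code, Cmd.size, ih₁, ih₂]; ring
  | whileNe a b c ih => simp [Cmd.code, Cmd.size, ih]

/-- The piece of code `l` stands at position `s` of the program `p`. -/
def CodeAt (p : Program) (s : ℕ) (l : List Instr) : Prop := l <+: p.drop s

theorem CodeAt.head {p : Program} {s : ℕ} {i : Instr} {l : List Instr} (h : CodeAt p s (i :: l)) :
    p[s]? = some i := by
  obtain ⟨t, ht⟩ := h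
  have := congrArg (fun l => l[0]?) ht
  simpa using this.symm

theorem CodeAt.tail {p : Program} {s : ℕ} {i : Instr} {l : List Instr} (h : CodeAt p s (i :: l)) :
    CodeAt p (s + 1) l := by
  obtain ⟨t, ht⟩ := h
  refine ⟨t, ?_⟩
  rw [← List.drop_drop, ← ht]
  rfl

theorem CodeAt.left {p : Program} {s : ℕ} {l l' : List Instr} (h : CodeAt p s (l ++ l')) :
    CodeAt p s l := (List.prefix_append l l').trans h

theorem CodeAt.right {p : Program} {s k : ℕ} {l l' : List Instr} (h : CodeAt p s (l ++ l'))
    (hk : l.length = k) : CodeAt p (s + k) l' := by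
  obtain ⟨t, ht⟩ := h
  refine ⟨t, ?_⟩
  rw [← List.drop_drop, ← ht, ← hk]
  simp

/-! ### Machine runs and the states they represent -/

/-- `p` leads from `c` to `c'` through the steps recorded in a trace, and no register exceeds `B`
after any of them. -/
inductive Steps (p : Program) (B : ℕ) : Config → Trace → Config → Prop
  | nil (c : Config) : Steps p B c [] c
  | cons {c c' : Config} {t : Trace} (hB : ∀ r, (step p c).reg r ≤ B)
      (h : Steps p B (step p c) t c') : Steps p B c (emission p c :: t) c'

theorem Steps.append {p : Program} {B : ℕ} {c c₁ c₂ : Config} {t₁ t₂ : Trace}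
    (h₁ : Steps p B c t₁ c₁) (h₂ : Steps p B c₁ t₂ c₂) : Steps p B c (t₁ ++ t₂) c₂ := by
  induction h₁ with
  | nil => exact h₂
  | cons hB _ ih => exact .cons hB (ih h₂)

theorem Steps.single {p : Program} {B : ℕ} {c : Config} {i : Instr} (hi : p[c.pc]? = some i)
    (hB : ∀ r, (i.exec c).reg r ≤ B) : Steps p B c [emission p c] (i.exec c) := by
  have h : step p c = i.exec c := by simp [step, hi]
  rw [← h] at hB ⊢
  exact .cons hB (.nil _)

theorem Steps.silent {p : Program} {B : ℕ} {c : Config} {i : Instr} (hi : p[c.pc]? = some i)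
    (he : ∀ rs, i ≠ .emit rs) (hB : ∀ r, (i.exec c).reg r ≤ B) : Steps p B c [none] (i.exec c) := by
  have h : emission p c = none := by
    unfold emission
    rw [hi]
    cases i with
    | emit rs => exact (he rs rfl).elim
    | _ => rfl
  rw [← h]
  exact .single hi hB

theorem Steps.iterate {p : Program} {B : ℕ} {c c' : Config} {t : Trace} (h : Steps p B c t c') :
    (step p)^[t.length] c = c' ∧
      ∀ i < t.length, t[i]? = some (emission p ((step p)^[i] c)) ∧
        ∀ r, ((step p)^[i + 1] c).reg r ≤ B := by
  induction h with
  | nil => simp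
  | cons hB _ ih =>
    refine ⟨ih.1, fun i hi => ?_⟩
    cases i with
    | zero => exact ⟨rfl, hB⟩
    | succ i => exact ih.2 i (by simpa using hi)

/-- The configuration `c` at program position `s` represents the state `σ`. -/
structure Represents (w : List ℕ) (B s : ℕ) (σ : State) (c : Config) : Prop where
  pc : c.pc = s
  len : c.reg 0 = w.length
  reg : ∀ r : Reg, c.reg r.code = σ.reg r
  mem : c.mem = memOf w σ.heap
  le : ∀ r, c.reg r ≤ B

theorem Represents.scratch {w : List ℕ} {B s : ℕ} {σ : State} {c : Config}
    (h : Represents w B s σ c) {r v : ℕ} (h0 : r ≠ 0) (h5 : r < 5) (hv : v ≤ B) :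
    Represents w B (s + 1) σ ⟨c.pc + 1, Function.update c.reg r v, c.mem⟩ where
  pc := by rw [h.pc]
  len := by simp only; rw [Function.update_of_ne h0.symm, h.len]
  reg r' := by
    simp only
    rw [Function.update_of_ne (by have := r'.le_code; omega), h.reg]
  mem := h.mem
  le r' := by
    simp only [Function.update_apply]
    split_ifs
    · exact hv
    · exact h.le r'

theorem Represents.set {w : List ℕ} {B s : ℕ} {σ : State} {c : Config}
    (h : Represents w B s σ c) (r : Reg) {v : ℕ} (hv : v ≤ B) :
    Represents w B (s + 1) (σ.set r v) ⟨c.pc + 1, Function.update c.reg r.code v, c.mem⟩ where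
  pc := by rw [h.pc]
  len := by simp only; rw [Function.update_of_ne (by have := r.le_code; omega), h.len]
  reg r' := by
    simp only [Function.update_apply, State.set_reg, Reg.code_injective.eq_iff, h.reg]
  mem := h.mem
  le r' := by
    simp only [Function.update_apply]
    split_ifs
    · exact hv
    · exact h.le r'

theorem Represents.jump {w : List ℕ} {B s : ℕ} {σ : State} {c : Config}
    (h : Represents w B s σ c) (l : ℕ) : Represents w B l σ ⟨l, c.reg, c.mem⟩ :=
  ⟨rfl, h.len, h.reg, h.mem, h.le⟩

theorem Represents.scratch_step {w : List ℕ} {p : Program} {B s : ℕ} {σ : State} {c : Config}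
    {i : Instr} (h : Represents w B s σ c) (hp : p[s]? = some i) {r v : ℕ}
    (hi : i.exec c = ⟨c.pc + 1, Function.update c.reg r v, c.mem⟩) (he : ∀ rs, i ≠ .emit rs)
    (h0 : r ≠ 0) (h5 : r < 5) (hv : v ≤ B) :
    ∃ c', Steps p B c [none] c' ∧ Represents w B (s + 1) σ c' ∧
      c'.reg = Function.update c.reg r v := by
  have hr := h.scratch h0 h5 hv
  rw [← hi] at hr
  exact ⟨_, .silent (by rw [h.pc]; exact hp) he hr.le, hr, by rw [hi]⟩

theorem Operand.steps {w : List ℕ} {p : Program} {B s e : ℕ} {σ : State} {c : Config} (o : Operand)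
    (h : Represents w B s σ c) (hp : CodeAt p s o.code) (he : c.reg 2 = e)
    (hB : (o.val σ + e) * (o.val σ + e) + e + 1 ≤ B) :
    ∃ c', Steps p B c (List.replicate 6 none) c' ∧ Represents w B (s + 6) σ c' ∧
      c'.reg 2 = (o.val σ + e) * (o.val σ + e) + e + 1 := by
  -- As a natural number is at most its square, every intermediate value is at most the final one,
  -- and `hB` bounds them all.
  have hx : o.val σ + e ≤ (o.val σ + e) * (o.val σ + e) := Nat.le_mul_self _
  -- Both kinds of operands are treated at once: `x` is the constant put into register 4, and `y`
  -- the register from which the operand is then read.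
  obtain ⟨x, y, hl, hxB, hy⟩ : ∃ x y, o.code = [.const 4 x, .add 3 y 2, .mul 3 3 3, .add 3 3 2,
      .const 1 1, .add 2 3 1] ∧
      x ≤ B ∧ ∀ g : ℕ → ℕ, (∀ r : Reg, g r.code = σ.reg r) → g 4 = x → g y = o.val σ := by
    cases o with
    | lit k => exact ⟨k, 4, rfl, by rw [val_lit] at hB hx; omega, fun g _ h => h⟩
    | reg r => exact ⟨0, r.code, rfl, by omega, fun g h _ => h r⟩
  rw [hl] at hp
  generalize o.val σ = v at *
  obtain ⟨c₁, s₁, r₁, e₁⟩ := h.scratch_step (r := 4) (v := x) hp.head rfl (by simp) (by omega)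
    (by omega) hxB
  obtain ⟨c₂, s₂, r₂, e₂⟩ := r₁.scratch_step (r := 3) (v := v + e) hp.tail.head
    (by simp only [Instr.exec]; rw [hy c₁.reg r₁.reg (by simp [e₁])]; simp [e₁, he])
    (by simp) (by omega) (by omega) (by omega)
  obtain ⟨c₃, s₃, r₃, e₃⟩ := r₂.scratch_step (r := 3) (v := (v + e) * (v + e)) hp.tail.tail.head
    (by simp [Instr.exec, e₂]) (by simp) (by omega) (by omega) (by omega)
  obtain ⟨c₄, s₄, r₄, e₄⟩ := r₃.scratch_step (r := 3) (v := (v + e) * (v + e) + e)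
    hp.tail.tail.tail.head (by simp [Instr.exec, e₃, e₂, e₁, he]) (by simp) (by omega) (by omega)
    (by omega)
  obtain ⟨c₅, s₅, r₅, e₅⟩ := r₄.scratch_step (r := 1) (v := 1)
    hp.tail.tail.tail.tail.head rfl (by simp) (by omega) (by omega) (by omega)
  obtain ⟨c₆, s₆, r₆, e₆⟩ := r₅.scratch_step (r := 2) (v := (v + e) * (v + e) + e + 1)
    hp.tail.tail.tail.tail.tail.head (by simp [Instr.exec, e₅, e₄]) (by simp) (by omega) (by omega)
    hB
  exact ⟨c₆, s₁.append (s₂.append (s₃.append (s₄.append (s₅.append s₆)))), r₆, by simp [e₆]⟩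

theorem enc_le_enc_cons (a : ℕ) (l : List ℕ) : enc l ≤ enc (a :: l) := by
  simp only [enc]; omega

theorem addrCode_steps {w : List ℕ} {p : Program} {B s : ℕ} {σ : State} {c : Config}
    (l : List Operand) (h : Represents w B s σ c) (hp : CodeAt p s (addrCode l))
    (hB : enc (l.map (Operand.val σ)) ≤ B) :
    ∃ c', Steps p B c (List.replicate (1 + 6 * l.length) none) c' ∧
      Represents w B (s + (1 + 6 * l.length)) σ c' ∧ c'.reg 2 = enc (l.map (Operand.val σ)) := by
  induction l with
  | nil =>
    have r1 := h.scratch (r := 2) (v := 0) (by omega) (by omega) (by omega)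
    exact ⟨_, .silent (i := .const 2 0) (by rw [h.pc]; exact hp.head) (by simp) r1.le, r1, by simp [Instr.exec, enc]⟩
  | cons o l ih =>
    obtain ⟨c₁, s₁, r₁, e₁⟩ := ih hp.left ((enc_le_enc_cons _ _).trans hB)
    obtain ⟨c₂, s₂, r₂, e₂⟩ := o.steps r₁ (hp.right (length_addrCode l)) e₁ hB
    refine ⟨c₂, ?_, ?_, e₂⟩
    · rw [List.length_cons, show 1 + 6 * (l.length + 1) = 1 + 6 * l.length + 6 by ring,
        List.replicate_add]
      exact s₁.append s₂
    · rw [List.length_cons, show s + (1 + 6 * (l.length + 1)) = s + (1 + 6 * l.length) + 6 by ring]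
      exact r₂

/-! ### Bounds on numbers -/

def Operand.Fits (m : ℕ) : Operand → Prop
  | .lit k => k ≤ m
  | .reg _ => True

/-- All constants are at most `m`, and all addresses have at most `k` components. -/
def Op.Fits (k m : ℕ) : Op → Prop
  | .const _ x => x ≤ m
  | .inc _ _ => True
  | .input _ _ => True
  | .get _ l => l.length ≤ k ∧ ∀ o ∈ l, o.Fits m
  | .put l _ => l.length ≤ k ∧ ∀ o ∈ l, o.Fits m

def Cmd.Fits (k m : ℕ) : Cmd → Prop
  | .skip => True
  | .op o => o.Fits k m
  | .emit _ => True
  | .seq c₁ c₂ => c₁.Fits k m ∧ c₂.Fits k m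
  | .ifeq _ _ c₁ c₂ => c₁.Fits k m ∧ c₂.Fits k m
  | .whileNe _ _ c => c.Fits k m

theorem Operand.Fits.mono {m m' : ℕ} {o : Operand} (h : o.Fits m) (hm : m ≤ m') : o.Fits m' := by
  cases o with
  | lit k => exact le_trans (α := ℕ) h hm
  | reg r => trivial

theorem Op.Fits.mono {k k' m m' : ℕ} {o : Op} (h : o.Fits k m) (hk : k ≤ k') (hm : m ≤ m') :
    o.Fits k' m' := by
  cases o with
  | const r x => exact le_trans (α := ℕ) h hm
  | inc r a => trivial
  | input r a => trivial
  | get r l => exact ⟨h.1.trans hk, fun o ho => (h.2 o ho).mono hm⟩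
  | put l r => exact ⟨h.1.trans hk, fun o ho => (h.2 o ho).mono hm⟩

theorem Cmd.Fits.mono {k k' m m' : ℕ} {C : Cmd} (h : C.Fits k m) (hk : k ≤ k') (hm : m ≤ m') :
    C.Fits k' m' := by
  induction C with
  | skip => trivial
  | op o => exact Op.Fits.mono h hk hm
  | emit rs => trivial
  | seq c₁ c₂ ih₁ ih₂ => exact ⟨ih₁ h.1, ih₂ h.2⟩
  | ifeq a b c₁ c₂ ih₁ ih₂ => exact ⟨ih₁ h.1, ih₂ h.2⟩
  | whileNe a b c ih => exact ih h

theorem exists_operands_fit (l : List Operand) : ∃ m, ∀ o ∈ l, o.Fits m := by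
  induction l with
  | nil => exact ⟨0, by simp⟩
  | cons o l ih =>
    obtain ⟨m, hm⟩ := ih
    obtain ⟨m', hm'⟩ : ∃ m', o.Fits m' := by
      cases o with
      | lit k => exact ⟨k, le_rfl (α := ℕ)⟩
      | reg r => exact ⟨0, trivial⟩
    refine ⟨m + m', fun o' ho' => ?_⟩
    rcases List.mem_cons.mp ho' with rfl | h
    · exact hm'.mono (by omega)
    · exact (hm o' h).mono (by omega)

theorem Cmd.exists_fits (C : Cmd) : ∃ k m, C.Fits k m := by
  induction C with
  | skip => exact ⟨0, 0, trivial⟩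
  | op o =>
    cases o with
    | const r x => exact ⟨0, x, le_rfl (α := ℕ)⟩
    | inc r a => exact ⟨0, 0, trivial⟩
    | input r a => exact ⟨0, 0, trivial⟩
    | get r l =>
      obtain ⟨m, hm⟩ := exists_operands_fit l
      exact ⟨l.length, m, le_rfl, hm⟩
    | put l r =>
      obtain ⟨m, hm⟩ := exists_operands_fit l
      exact ⟨l.length, m, le_rfl, hm⟩
  | emit rs => exact ⟨0, 0, trivial⟩
  | seq c₁ c₂ ih₁ ih₂ =>
    obtain ⟨k₁, m₁, h₁⟩ := ih₁
    obtain ⟨k₂, m₂, h₂⟩ := ih₂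
    exact ⟨k₁ + k₂, m₁ + m₂, h₁.mono (by omega) (by omega), h₂.mono (by omega) (by omega)⟩
  | ifeq a b c₁ c₂ ih₁ ih₂ =>
    obtain ⟨k₁, m₁, h₁⟩ := ih₁
    obtain ⟨k₂, m₂, h₂⟩ := ih₂
    exact ⟨k₁ + k₂, m₁ + m₂, h₁.mono (by omega) (by omega), h₂.mono (by omega) (by omega)⟩
  | whileNe a b c ih => exact ih

/-- All numbers in the state and in the input are at most `m`. -/
structure State.Bounded (w : List ℕ) (m : ℕ) (σ : State) : Prop where
  reg : ∀ r, σ.reg r ≤ m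
  heap : ∀ l, σ.heap l ≤ m
  input : ∀ x ∈ w, x ≤ m

theorem State.Bounded.mono {w : List ℕ} {m m' : ℕ} {σ : State} (h : σ.Bounded w m) (hm : m ≤ m') :
    σ.Bounded w m' :=
  ⟨fun r => (h.reg r).trans hm, fun l => (h.heap l).trans hm, fun x hx => (h.input x hx).trans hm⟩

theorem State.Bounded.set {w : List ℕ} {m v : ℕ} {σ : State} (h : σ.Bounded w m) (r : Reg)
    (hv : v ≤ m) : (σ.set r v).Bounded w m where
  reg r' := by
    rw [State.set_reg]
    split_ifs
    · exact hv
    · exact h.reg r'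
  heap := h.heap
  input := h.input

theorem State.Bounded.write {w : List ℕ} {m v : ℕ} {σ : State} (h : σ.Bounded w m) (l : List ℕ)
    (hv : v ≤ m) : (σ.write l v).Bounded w m where
  reg := h.reg
  heap l' := by
    rw [State.write_heap]
    split_ifs
    · exact hv
    · exact h.heap l'
  input := h.input

theorem Op.bounded {w : List ℕ} {k m : ℕ} {σ : State} {o : Op} (h : σ.Bounded w m)
    (ho : o.Fits k m) : (o.eval w σ).Bounded w (m + 1) := by
  cases o with
  | const r x => exact (h.set r ho).mono (by omega)
  | inc r a => exact (h.mono (by omega)).set r (by have := h.reg a; omega)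
  | input r a => exact (h.set r (memOf_le h.input h.heap _)).mono (by omega)
  | get r l => exact (h.set r (h.heap _)).mono (by omega)
  | put l r => exact (h.write _ (h.reg _)).mono (by omega)

theorem Op.one_le_cost (o : Op) : 1 ≤ o.cost := by cases o <;> simp only [Op.cost] <;> omega

/-- The only arithmetic is the increment, so one operation raises the largest number by at most one;
the length of the trace bounds the growth. -/
theorem Exec.bounded {w : List ℕ} {C : Cmd} {σ σ' : State} {t : Trace} (h : Exec w C σ t σ')
    {k m : ℕ} (hC : C.Fits k m) (hσ : σ.Bounded w m) : σ'.Bounded w (m + t.length) := by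
  induction h generalizing m with
  | skip σ => exact hσ
  | op o σ =>
    refine (Op.bounded hσ hC).mono ?_
    have := o.one_le_cost
    simp only [List.length_replicate]; omega
  | emit rs σ => exact hσ.mono (by omega)
  | seq _ _ ih₁ ih₂ =>
    refine (ih₂ (Cmd.Fits.mono hC.2 le_rfl (by omega)) (ih₁ hC.1 hσ)).mono ?_
    simp only [List.length_append]; omega
  | ifTrue _ _ ih => exact (ih hC.1 hσ).mono (by simp only [List.length_cons]; omega)
  | ifFalse _ _ ih =>
    exact (ih hC.2 hσ).mono (by simp only [List.length_cons, List.length_append]; omega)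
  | whileDone _ => exact hσ.mono (by omega)
  | whileStep _ _ _ ih₁ ih₂ =>
    refine (ih₂ (Cmd.Fits.mono hC le_rfl (by omega)) (ih₁ hC hσ)).mono ?_
    simp only [List.length_cons, List.length_append]; omega

/-- Carrying the summand `V + 2` along makes the induction work: another component replaces the
bounded quantity by at most its cube. Addresses with a fixed number of components are therefore
polynomial in `V`. -/
theorem enc_le {V : ℕ} {l : List ℕ} (h : ∀ x ∈ l, x ≤ V) :
    enc l + V + 2 ≤ (V + 2) ^ 3 ^ l.length := by
  induction l with
  | nil => simp [enc]
  | cons a l ih =>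
    have ih := ih fun x hx => h x (List.mem_cons_of_mem _ hx)
    have ha := h a (by simp)
    rw [List.length_cons, pow_succ, pow_mul]
    refine le_trans ?_ (Nat.pow_le_pow_left ih 3)
    simp only [enc]
    generalize enc l = e
    have h1 : (a + e) * (a + e) ≤ (V + e) * (V + e) :=
      Nat.mul_le_mul (by omega) (by omega)
    nlinarith [Nat.zero_le ((e + V) ^ 3)]

/-! ### Correctness of the compilation -/

theorem Op.steps {w : List ℕ} {p : Program} {B s k V : ℕ} {σ : State} {c : Config} {o : Op}
    (h : Represents w B s σ c) (hp : CodeAt p s o.code) (hσ : σ.Bounded w V)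
    (ho : o.Fits k V) (hV : V + 1 ≤ B)
    (hB : ∀ l : List ℕ, l.length ≤ k → (∀ x ∈ l, x ≤ V) → w.length + enc l ≤ B) :
    ∃ c', Steps p B c (List.replicate o.cost none) c' ∧
      Represents w B (s + o.cost) (o.eval w σ) c' := by
  have vals {l : List Operand} (hl : ∀ o ∈ l, o.Fits V) : ∀ x ∈ l.map (Operand.val σ), x ≤ V := by
    intro x hx
    obtain ⟨o, ho, rfl⟩ := List.mem_map.mp hx
    have := hl o ho
    cases o with
    | lit k => exact this
    | reg r => exact hσ.reg r
  have address {l : List Operand} {i : Instr} (hl : l.length ≤ k ∧ ∀ o ∈ l, o.Fits V)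
      (hp : CodeAt p s (addrCode l ++ [.add 2 2 0, i])) :
      ∃ c', Steps p B c (List.replicate (1 + 6 * l.length + 1) none) c' ∧
        Represents w B (s + (1 + 6 * l.length + 1)) σ c' ∧
        c'.reg 2 = w.length + enc (l.map (Operand.val σ)) ∧
        p[s + (1 + 6 * l.length + 1)]? = some i := by
    have hb := hB (l.map (Operand.val σ)) (by simpa using hl.1) (vals hl.2)
    obtain ⟨c₁, s₁, r₁, e₁⟩ := addrCode_steps l h hp.left (by omega)
    have hp₂ := hp.right (length_addrCode l)
    have r₂ := r₁.scratch (r := 2) (v := w.length + enc (l.map (Operand.val σ))) (by omega)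
      (by omega) hb
    have s₂ : Steps p B c₁ [none] (Instr.exec (.add 2 2 0) c₁) :=
      .silent (by rw [r₁.pc]; exact hp₂.head) (by simp)
        (by simp only [Instr.exec]; rw [e₁, r₁.len, Nat.add_comm]; exact r₂.le)
    simp only [Instr.exec] at s₂
    rw [e₁, r₁.len, Nat.add_comm (enc _)] at s₂
    refine ⟨_, ?_, r₂, by simp, hp₂.tail.head⟩
    rw [List.replicate_succ']
    exact s₁.append s₂
  cases o with
  | const r x =>
    have r₁ := h.set r (v := x) (le_trans (α := ℕ) ho (by omega))
    exact ⟨_, .silent (i := .const r.code x) (by rw [h.pc]; exact hp.head) (by simp) r₁.le, r₁⟩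
  | inc r a =>
    have r₁ := h.scratch (r := 1) (v := 1) (by omega) (by omega) (by omega)
    have s₁ : Steps p B c [none] (Instr.exec (.const 1 1) c) :=
      .silent (by rw [h.pc]; exact hp.head) (by simp) r₁.le
    have r₂ := r₁.set r (v := σ.reg a + 1) (by have := hσ.reg a; omega)
    have e : Instr.exec (.add r.code a.code 1) (Instr.exec (.const 1 1) c)
        = ⟨c.pc + 1 + 1, Function.update (Function.update c.reg 1 1) r.code (σ.reg a + 1),
            c.mem⟩ := by
      have := r₁.reg a
      simp only [Instr.exec] at this ⊢
      rw [this]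
      simp
    have s₂ : Steps p B (Instr.exec (.const 1 1) c) [none]
        (Instr.exec (.add r.code a.code 1) (Instr.exec (.const 1 1) c)) :=
      .silent (by simp only [Instr.exec]; rw [h.pc]; exact hp.tail.head) (by simp)
        (by rw [e]; exact r₂.le)
    rw [e] at s₂
    exact ⟨_, s₁.append s₂, r₂⟩
  | input r a =>
    have r₁ := h.set r (v := memOf w σ.heap (σ.reg a))
      ((memOf_le hσ.input hσ.heap _).trans (by omega))
    have e : Instr.exec (.load r.code a.code) c
        = ⟨c.pc + 1, Function.update c.reg r.code (memOf w σ.heap (σ.reg a)), c.mem⟩ := by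
      simp only [Instr.exec]
      rw [h.reg, h.mem]
    have s₁ : Steps p B c [none] (Instr.exec (.load r.code a.code) c) :=
      .silent (by rw [h.pc]; exact hp.head) (by simp) (by rw [e]; exact r₁.le)
    rw [e] at s₁
    exact ⟨_, s₁, r₁⟩
  | get r l =>
    obtain ⟨c₁, s₁, r₁, e₁, hp₁⟩ := address ho hp
    have r₂ := r₁.set r (v := σ.heap (l.map (Operand.val σ))) ((hσ.heap _).trans (by omega))
    have e : Instr.exec (.load r.code 2) c₁
        = ⟨c₁.pc + 1, Function.update c₁.reg r.code (σ.heap (l.map (Operand.val σ))),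
            c₁.mem⟩ := by
      simp only [Instr.exec]
      rw [e₁, r₁.mem, memOf_enc]
    have s₂ : Steps p B c₁ [none] (Instr.exec (.load r.code 2) c₁) :=
      .silent (by rw [r₁.pc]; exact hp₁) (by simp) (by rw [e]; exact r₂.le)
    rw [e] at s₂
    refine ⟨_, ?_, r₂⟩
    simp only [Op.cost]
    rw [List.replicate_succ']
    exact s₁.append s₂
  | put l r =>
    obtain ⟨c₁, s₁, r₁, e₁, hp₁⟩ := address ho hp
    have r₂ : Represents w B (s + (1 + 6 * l.length + 1) + 1) (Op.eval w (.put l r) σ)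
        (Instr.exec (.store 2 r.code) c₁) :=
      ⟨by simp only [Instr.exec]; rw [r₁.pc], r₁.len, r₁.reg,
        by simp only [Instr.exec, Op.eval, State.write]
           rw [memOf_update, e₁, r₁.mem, r₁.reg], r₁.le⟩
    have s₂ : Steps p B c₁ [none] (Instr.exec (.store 2 r.code) c₁) :=
      .silent (by rw [r₁.pc]; exact hp₁) (by simp) r₂.le
    refine ⟨_, ?_, r₂⟩
    simp only [Op.cost]
    rw [List.replicate_succ']
    exact s₁.append s₂

/-- Here `m` bounds the numbers at the start of the current command and grows along the induction,
while `V` bounds them throughout the run; `hm` says that the remaining time does not exhaust the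
difference. -/
theorem Exec.steps {w : List ℕ} {p : Program} {B k V : ℕ} {C : Cmd} {σ σ' : State} {t : Trace}
    (h : Exec w C σ t σ') (hV : V + 1 ≤ B)
    (hB : ∀ l : List ℕ, l.length ≤ k → (∀ x ∈ l, x ≤ V) → w.length + enc l ≤ B)
    {m s : ℕ} {c : Config} (hm : m + t.length ≤ V) (hC : C.Fits k m) (hσ : σ.Bounded w m)
    (hc : Represents w B s σ c) (hp : CodeAt p s (C.code s)) :
    ∃ c', Steps p B c t c' ∧ Represents w B (s + C.size) σ' c' := by
  have branch {s : ℕ} {σ : State} {c : Config} {a b : Reg} {l : ℕ}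
      (hc : Represents w B s σ c) (hp : p[s]? = some (.jeq a.code b.code l)) :
      ∃ c', Steps p B c [none] c' ∧
        Represents w B (if σ.reg a = σ.reg b then l else s + 1) σ c' := by
    have hr : Represents w B (if σ.reg a = σ.reg b then l else s + 1) σ
        (Instr.exec (.jeq a.code b.code l) c) :=
      ⟨by simp only [Instr.exec]; rw [hc.reg, hc.reg, hc.pc], hc.len, hc.reg, hc.mem, hc.le⟩
    exact ⟨_, .silent (by rw [hc.pc]; exact hp) (by simp) hr.le, hr⟩
  have goto {s : ℕ} {σ : State} {c : Config} {l : ℕ}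
      (hc : Represents w B s σ c) (hp : p[s]? = some (.jmp l)) :
      ∃ c', Steps p B c [none] c' ∧ Represents w B l σ c' :=
    ⟨_, .silent (i := .jmp l) (by rw [hc.pc]; exact hp) (by simp) (hc.jump l).le, hc.jump l⟩
  induction h generalizing m s c with
  | skip σ => exact ⟨c, .nil c, hc⟩
  | op o σ =>
    exact Op.steps hc hp (hσ.mono (by omega)) (Op.Fits.mono hC le_rfl (by omega)) hV hB
  | emit rs σ =>
    refine ⟨Instr.exec (.emit (rs.map Reg.code)) c, ?_, ?_⟩
    · have hi : p[c.pc]? = some (.emit (rs.map Reg.code)) := by rw [hc.pc]; exact hp.head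
      have he : emission p c = some (rs.map σ.reg) := by
        unfold emission
        rw [hi]
        simp [hc.reg]
      rw [← he]
      exact .single hi hc.le
    · exact ⟨by simp only [Instr.exec]; rw [hc.pc]; rfl, hc.len, hc.reg, hc.mem, hc.le⟩
  | @seq c₁ c₂ σ σ₁ σ₂ t₁ t₂ h₁ _ ih₁ ih₂ =>
    rw [List.length_append] at hm
    obtain ⟨d₁, s₁, r₁⟩ := ih₁ (by omega) hC.1 hσ hc hp.left
    obtain ⟨d₂, s₂, r₂⟩ := ih₂ (by omega) (Cmd.Fits.mono hC.2 le_rfl (by omega))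
      (h₁.bounded hC.1 hσ) r₁ (hp.right (c₁.length_code s))
    exact ⟨d₂, s₁.append s₂, by rw [Nat.add_assoc] at r₂; exact r₂⟩
  | @ifTrue a b c₁ c₂ σ σ' t h h₁ ih =>
    obtain ⟨d₁, s₁, r₁⟩ := branch hc hp.head
    rw [if_pos h] at r₁
    have hp' := (hp.tail.right (c₂.length_code (s + 1))).tail
    rw [show s + 1 + c₂.size + 1 = s + (c₂.size + 2) by ring] at hp'
    obtain ⟨d₂, s₂, r₂⟩ := ih (by simp only [List.length_cons] at hm; omega) hC.1 hσ r₁ hp'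
    exact ⟨d₂, s₁.append s₂, by rw [Nat.add_assoc] at r₂; exact r₂⟩
  | @ifFalse a b c₁ c₂ σ σ' t h h₁ ih =>
    obtain ⟨d₁, s₁, r₁⟩ := branch hc hp.head
    rw [if_neg h] at r₁
    obtain ⟨d₂, s₂, r₂⟩ := ih
      (by simp only [List.length_cons, List.length_append] at hm; omega) hC.2 hσ r₁ hp.tail.left
    obtain ⟨d₃, s₃, r₃⟩ := goto r₂ (hp.tail.right (c₂.length_code (s + 1))).head
    exact ⟨d₃, s₁.append (s₂.append s₃), r₃⟩
  | whileDone h =>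
    obtain ⟨d₁, s₁, r₁⟩ := branch hc hp.head
    rw [if_pos h] at r₁
    exact ⟨d₁, s₁, r₁⟩
  | @whileStep a b C σ σ₁ σ₂ t t' h h₁ _ ih₁ ih₂ =>
    simp only [List.length_cons, List.length_append] at hm
    obtain ⟨d₁, s₁, r₁⟩ := branch hc hp.head
    rw [if_neg h] at r₁
    obtain ⟨d₂, s₂, r₂⟩ := ih₁ (by omega) hC hσ r₁ hp.tail.left
    obtain ⟨d₃, s₃, r₃⟩ := goto r₂ (hp.tail.right (C.length_code (s + 1))).head
    obtain ⟨d₄, s₄, r₄⟩ := ih₂ (m := m + t.length) (by omega)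
      (Cmd.Fits.mono hC le_rfl (by omega)) (h₁.bounded hC hσ) r₃ hp
    exact ⟨d₄, s₁.append (s₂.append (s₃.append s₄)), r₄⟩

/-! ### Ear decompositions -/

/-- An atom together with the list of the variables that it shares with the atoms after it. -/
structure Ear (S : Schema) (n : ℕ) where
  id : ℕ
  atom : Atom S n
  key : List (Fin n)

/-- The atoms form an ear decomposition: the variables that an atom shares with the later ones
occur together in one of these. -/
def EarList {S : Schema} {n : ℕ} : List (Ear S n) → Prop
  | [] => True
  | e :: es => e.id = es.length ∧
      (∀ x, x ∈ e.key ↔ x ∈ Atom.vars e.atom ∧ ∃ b ∈ es, x ∈ Atom.vars b.atom) ∧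
      (es ≠ [] → ∃ p ∈ es, ∀ x ∈ e.key, x ∈ Atom.vars p.atom) ∧ EarList es

/-- Identifiers count the ears that follow, so they decrease strictly along the list. Distinct ears
thus use disjoint tables and different pointer registers. -/
theorem EarList.id_lt {S : Schema} {n : ℕ} {es : List (Ear S n)} (h : EarList es) :
    ∀ e ∈ es, e.id < es.length := by
  induction es with
  | nil => simp
  | cons e es ih =>
    intro b hb
    rcases List.mem_cons.mp hb with rfl | hb
    · rw [h.1]; simp
    · exact (ih h.2.2.2 b hb).trans (by simp)

/-- A vertex with at most one neighbour in `U` is not an inner vertex of any path in `U`, so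
deleting it disconnects nothing. -/
theorem preconnected_induce_diff_singleton {W : Type*} {T : SimpleGraph W} {U : Set W} {l : W}
    (hl : ∀ y ∈ U, ∀ z ∈ U, T.Adj l y → T.Adj l z → y = z) (hU : (T.induce U).Preconnected) :
    (T.induce (U \ {l})).Preconnected := by
  have h1 : ((T.induce U).induce {a | a.1 ≠ l}).Preconnected := by
    refine hU.induce_of_degree_eq_one ?_
    rintro ⟨v, hv⟩ hvl ⟨y, hy⟩ hvy ⟨z, hz⟩ hvz
    have : v = l := by simpa using hvl
    subst this
    exact Subtype.ext (hl y hy z hz hvy hvz)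
  let φ : (T.induce U).induce {a | a.1 ≠ l} →g T.induce (U \ {l}) :=
    ⟨fun a => ⟨a.1.1, a.1.2, a.2⟩, fun h => h⟩
  intro a b
  exact (h1 ⟨⟨a.1, a.2.1⟩, a.2.2⟩ ⟨⟨b.1, b.2.1⟩, b.2.2⟩).map φ

-- The ears are the leaves of the join tree in the order of their removal. The tree `T` stays fixed,
-- and the set `U` of remaining nodes shrinks; deleting a leaf preserves connectedness of `U` and of
-- the nodes of each variable.
open Classical in
theorem exists_earList {S : Schema} {n : ℕ} {W : Type*} {T : SimpleGraph W} (atom : W → Atom S n)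
    (hT : T.IsAcyclic) (k : ℕ) (U : Finset W) (hk : U.card = k)
    (hU : (T.induce (U : Set W)).Preconnected)
    (hx : ∀ x, (T.induce ((U : Set W) ∩ {a | x ∈ Atom.vars (atom a)})).Preconnected) :
    ∃ es : List (Ear S n), EarList es ∧ ∀ a, (∃ e ∈ es, e.atom = a) ↔ ∃ u ∈ U, atom u = a := by
  induction k generalizing U with
  | zero =>
    rw [Finset.card_eq_zero] at hk
    subst hk
    exact ⟨[], trivial, by simp⟩
  | succ k ih =>
    obtain ⟨l, hlU, hl, hp⟩ : ∃ l ∈ U, (∀ y ∈ U, ∀ z ∈ U, T.Adj l y → T.Adj l z → y = z) ∧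
        (U.erase l ≠ ∅ → ∃ p ∈ U, T.Adj l p) := by
      -- A single remaining node has no neighbour; this is the only case without a parent.
      by_cases h1 : k = 0
      · subst h1
        obtain ⟨l, rfl⟩ := Finset.card_eq_one.mp hk
        refine ⟨l, by simp, ?_, by simp⟩
        intro y hy z hz _ _
        rw [Finset.mem_singleton.mp hy, Finset.mem_singleton.mp hz]
      · have : Nontrivial (U : Set W) := by
          have : 1 < U.card := by omega
          obtain ⟨a, ha, b, hb, hab⟩ := Finset.one_lt_card.mp this
          exact ⟨⟨a, ha⟩, ⟨b, hb⟩, by simpa using hab⟩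
        have hne : Nonempty (U : Set W) := inferInstance
        have : Fintype (U : Set W) := inferInstanceAs (Fintype U)
        obtain ⟨⟨l, hl⟩, hd⟩ := SimpleGraph.IsTree.exists_vert_degree_one_of_nontrivial
          (G := T.induce (U : Set W)) ⟨⟨hU⟩, hT.induce _⟩
        obtain ⟨⟨p, hp⟩, hlp, huniq⟩ := SimpleGraph.degree_eq_one_iff_existsUnique_adj.mp hd
        refine ⟨l, hl, fun y hy z hz hly hlz => ?_, fun _ => ⟨p, hp, hlp⟩⟩
        have h1 := huniq ⟨y, hy⟩ hly
        have h2 := huniq ⟨z, hz⟩ hlz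
        simpa using h1.trans h2.symm
    have hcoe : ((U.erase l : Finset W) : Set W) = (U : Set W) \ {l} := by simp
    obtain ⟨es, hes, hmem⟩ := ih (U.erase l) (by rw [Finset.card_erase_of_mem hlU, hk]; rfl)
      (by rw [hcoe]; exact preconnected_induce_diff_singleton hl hU)
      (fun x => by
        rw [hcoe, ← Set.inter_sdiff_right_comm]
        exact preconnected_induce_diff_singleton
          (fun y hy z hz => hl y hy.1 z hz.1) (hx x))
    refine ⟨⟨es.length, atom l, (List.finRange n).filter
      (fun x => x ∈ Atom.vars (atom l) ∧ ∃ b ∈ es, x ∈ Atom.vars b.atom)⟩ :: es,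
      ⟨rfl, fun x => by simp, fun hne => ?_, hes⟩, fun a => ?_⟩
    · have hne' : U.erase l ≠ ∅ := by
        obtain ⟨e, es', rfl⟩ := List.exists_cons_of_ne_nil hne
        obtain ⟨u, hu, -⟩ := (hmem e.atom).mp ⟨e, by simp, rfl⟩
        exact Finset.ne_empty_of_mem hu
      obtain ⟨p, hpU, hlp⟩ := hp hne'
      obtain ⟨e, he, hep⟩ := (hmem (atom p)).mpr
        ⟨p, Finset.mem_erase.mpr ⟨hlp.ne', hpU⟩, rfl⟩
      refine ⟨e, he, fun x hxk => ?_⟩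
      obtain ⟨hxl, b, hb, hxb⟩ : x ∈ Atom.vars (atom l) ∧ ∃ b ∈ es, x ∈ Atom.vars b.atom := by
        simpa using hxk
      obtain ⟨u, hu, hub⟩ := (hmem b.atom).mp ⟨b, hb, rfl⟩
      have hul := Finset.mem_erase.mp hu
      -- A path from `l` to `u` through nodes containing `x` must begin with the edge to `p`, the
      -- only neighbour of `l` in `U`. So `p` contains `x`.
      have hr := hx x ⟨l, hlU, hxl⟩ ⟨u, hul.2, by rw [Set.mem_ofPred_eq, hub]; exact hxb⟩
      rw [SimpleGraph.reachable_iff_reflTransGen] at hr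
      rcases hr.cases_head with h | ⟨⟨z, hz⟩, hlz, -⟩
      · exact (hul.1 (congrArg Subtype.val h).symm).elim
      · have : z = p := hl z hz.1 p hpU hlz hlp
        subst this
        rw [hep]
        exact hz.2
    · constructor
      · rintro ⟨e, he, rfl⟩
        rcases List.mem_cons.mp he with rfl | he
        · exact ⟨l, hlU, rfl⟩
        · obtain ⟨u, hu, h⟩ := (hmem e.atom).mp ⟨e, he, rfl⟩
          exact ⟨u, Finset.mem_of_mem_erase hu, h⟩
      · rintro ⟨u, hu, rfl⟩
        by_cases hul : u = l
        · subst hul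
          exact ⟨_, List.mem_cons_self, rfl⟩
        · obtain ⟨e, he, h⟩ := (hmem (atom u)).mpr ⟨u, Finset.mem_erase.mpr ⟨hul, hu⟩, rfl⟩
          exact ⟨e, List.mem_cons_of_mem _ he, h⟩

theorem IsAcyclic.exists_earList {S : Schema} {n : ℕ} {A : Finset (Atom S n)} (h : IsAcyclic A) :
    ∃ es : List (Ear S n), EarList es ∧ ∀ a, (∃ e ∈ es, e.atom = a) ↔ a ∈ A := by
  obtain ⟨T, hT, hTa, hTx⟩ := h
  have lift {U U' : Set {a // a ∈ A}} (h : U = U') (h1 : (T.induce U).Preconnected) :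
      (T.induce U').Preconnected := h ▸ h1
  obtain ⟨es, hes, hmem⟩ := MirrorCQ.exists_earList (T := T) Subtype.val hTa _ Finset.univ rfl
    (by
      intro a b
      let φ : T →g T.induce ((Finset.univ : Finset {a // a ∈ A}) : Set {a // a ∈ A}) :=
        ⟨fun a => ⟨a, by simp⟩, fun h => h⟩
      exact (hT a.1 b.1).map φ)
    (fun x => lift (by simp) (hTx x))
  exact ⟨es, hes, fun a => by rw [hmem]; simp⟩

/-! ### Splitting the solutions of a mirror query -/

/-- The assignment satisfies the atoms. -/
def Sat {S : Schema} {n : ℕ} (D : Database S) (A : Finset (Atom S n)) (v : Fin n → ℕ) : Prop :=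
  ∀ a ∈ A, v ∘ a.2 ∈ D.rel a.1

open Classical in
/-- The assignment that is `s` on `X` and `s' ∘ g` elsewhere. -/
noncomputable def combine {n : ℕ} (X : Set (Fin n)) (g : Fin n → Fin n) (s s' : Fin n → ℕ) :
    Fin n → ℕ := fun x => if x ∈ X then s x else s' (g x)

/-- The domain condition is automatic, since every variable occurs in an atom. -/
theorem FullCQ.mem_solutions {S : Schema} {q : FullCQ S} {D : Database S}
    {v : Fin q.numVars → ℕ} : v ∈ q.solutions D ↔ Sat D q.atoms v := by
  refine ⟨fun h => h.2, fun h => ⟨fun x => ?_, h⟩⟩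
  obtain ⟨a, ha, j, rfl⟩ := q.covered x
  exact D.rel_mem_dom _ _ (h a ha) j

/-- The solutions of `q` are the combinations by `g` of the solutions of the query with atoms `I`
that agree on `Z`. -/
structure Splitting {S : Schema} (q : FullCQ S) (I : Finset (Atom S q.numVars))
    (Z : List (Fin q.numVars)) (g : Fin q.numVars → Fin q.numVars) : Prop where
  mem_key : ∀ x ∈ Z, x ∈ varsOf I
  mem_vars : ∀ x ∉ varsOf I, g x ∈ varsOf I
  exists_combine : ∀ D, ∀ v ∈ q.solutions D, ∃ s s', Sat D I s ∧ Sat D I s' ∧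
    (∀ x ∈ Z, s x = s' x) ∧ v = combine (varsOf I) g s s'
  combine_mem : ∀ D s s', Sat D I s → Sat D I s' → (∀ x ∈ Z, s x = s' x) →
    combine (varsOf I) g s s' ∈ q.solutions D
  combine_inj : ∀ s s' u u' : Fin q.numVars → ℕ, (∀ x ∈ Z, s x = s' x) → (∀ x ∈ Z, u x = u' x) →
    combine (varsOf I) g s s' = combine (varsOf I) g u u' →
    ∀ x ∈ varsOf I, s x = u x ∧ s' x = u' x

-- The atoms of `q` are those of `I` and their images under `f`, so `v` solves `q` if and only if
-- `v` and `v ∘ f` satisfy `I`. The two agree on the shared variables, which `f` fixes. The map `g`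
-- inverts `f` on the variables outside `I`, which recovers `v` from the pair.
open Classical in
theorem FullCQ.IsMirror.exists_splitting {S : Schema} {q : FullCQ S} (hq : q.IsMirror) :
    ∃ I Z g, IsAcyclic I ∧ Splitting q I Z g := by
  obtain ⟨I, ⟨ν, hν, hIν⟩, hI, f, ⟨hf, hfI⟩, hfix⟩ := hq
  have hIq : I ⊆ q.atoms := by
    rw [hIν]
    intro b hb
    obtain ⟨a, ha, rfl⟩ := Finset.mem_image.mp hb
    exact hν a ha
  have hsurj : ∀ x, ∃ y, x ∉ varsOf I → y ∈ varsOf I ∧ f y = x := by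
    intro x
    by_cases hx : x ∈ varsOf I
    · exact ⟨x, fun h => (h hx).elim⟩
    · obtain ⟨a, ha, hxa⟩ := q.covered x
      have : x ∈ varsOf (q.atoms \ I) :=
        ⟨a, Finset.mem_sdiff.mpr ⟨ha, fun h => hx ⟨a, h, hxa⟩⟩, hxa⟩
      obtain ⟨y, hy, hyx⟩ := hf.surjOn this
      exact ⟨y, fun _ => ⟨hy, hyx⟩⟩
  choose g hg using hsurj
  -- If `f x` is again a variable of `I`, it is shared and hence fixed by `f`; injectivity applied
  -- to `f (f x) = f x` gives `f x = x`.
  have hfx : ∀ x ∈ varsOf I, f x ∈ varsOf I → f x = x ∧ x ∈ varsOf (q.atoms \ I) := by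
    intro x hx hfx
    have h1 := hfix (f x) ⟨hfx, hf.mapsTo hx⟩
    have h2 := hf.injOn hfx hx h1
    exact ⟨h2, h2 ▸ hf.mapsTo hx⟩
  have hgf : ∀ x ∈ varsOf I, f x ∉ varsOf I → g (f x) = x := fun x hx hfx =>
    hf.injOn (hg _ hfx).1 hx (hg _ hfx).2
  set Z := (List.finRange q.numVars).filter
    (fun x => x ∈ varsOf I ∧ x ∈ varsOf (q.atoms \ I)) with hZ
  have memZ : ∀ x, x ∈ Z ↔ x ∈ varsOf I ∧ x ∈ varsOf (q.atoms \ I) := by simp [hZ]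
  -- Read through `f`, the combination is `s'` on all variables of `I`: where it takes the value of
  -- `s`, the variable is shared and `s` agrees with `s'`.
  have hcf : ∀ s s' : Fin q.numVars → ℕ, (∀ x ∈ Z, s x = s' x) →
      ∀ x ∈ varsOf I, combine (varsOf I) g s s' (f x) = s' x := by
    intro s s' hss x hx
    by_cases h : f x ∈ varsOf I
    · obtain ⟨h1, h2⟩ := hfx x hx h
      simp only [combine, if_pos h]
      rw [h1, hss x ((memZ x).mpr ⟨hx, h2⟩)]
    · simp only [combine, if_neg h]
      rw [hgf x hx h]
  refine ⟨I, Z, g, hI, fun x hx => ((memZ x).mp hx).1, fun x hx => (hg x hx).1, ?_, ?_, ?_⟩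
  · intro D v hv
    refine ⟨v, v ∘ f, fun a ha => hv.2 a (hIq ha), fun a ha => ?_, fun x hx => ?_, ?_⟩
    · have h1 : Atom.map f a ∈ q.atoms \ I := by
        rw [← hfI]; exact Finset.mem_image_of_mem _ ha
      exact hv.2 _ (Finset.mem_sdiff.mp h1).1
    · rw [Function.comp_apply, hfix x ((memZ x).mp hx)]
    · funext x
      by_cases hx : x ∈ varsOf I
      · simp [combine, hx]
      · simp [combine, hx, (hg x hx).2]
  · intro D s s' hs hs' hss
    rw [FullCQ.mem_solutions]
    intro a ha
    by_cases haI : a ∈ I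
    · have : combine (varsOf I) g s s' ∘ a.2 = s ∘ a.2 := by
        funext j
        have : a.2 j ∈ varsOf I := ⟨a, haI, j, rfl⟩
        simp [combine, this]
      rw [this]
      exact hs a haI
    · have : a ∈ I.image (Atom.map f) := by rw [hfI]; exact Finset.mem_sdiff.mpr ⟨ha, haI⟩
      obtain ⟨b, hb, rfl⟩ := Finset.mem_image.mp this
      have : combine (varsOf I) g s s' ∘ (Atom.map f b).2 = s' ∘ b.2 := by
        funext j
        exact hcf s s' hss (b.2 j) ⟨b, hb, j, rfl⟩
      rw [this]
      exact hs' b hb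
  · intro s s' u u' hs hu h x hx
    constructor
    · have := congrFun h x
      simpa [combine, hx] using this
    · rw [← hcf s s' hs x hx, ← hcf u u' hu x hx, h]

/-! ### Linked lists -/

open Classical in
/-- The last of the numbers `1, …, m` with the property `P`, or `0` if there is none. -/
noncomputable def last (P : ℕ → Prop) : ℕ → ℕ
  | 0 => 0
  | m + 1 => if P (m + 1) then m + 1 else last P m

theorem last_succ_of_pos {P : ℕ → Prop} {m : ℕ} (h : P (m + 1)) : last P (m + 1) = m + 1 := by
  simp [last, h]

theorem last_succ_of_neg {P : ℕ → Prop} {m : ℕ} (h : ¬ P (m + 1)) :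
    last P (m + 1) = last P m := by
  simp [last, h]

theorem last_ne_zero {P : ℕ → Prop} {m : ℕ} : last P m ≠ 0 ↔ ∃ j, 1 ≤ j ∧ j ≤ m ∧ P j := by
  induction m with
  | zero => simp only [last, ne_eq, not_true_eq_false, false_iff]; rintro ⟨j, h1, h2, -⟩; omega
  | succ m ih =>
    by_cases h : P (m + 1)
    · rw [last_succ_of_pos h]
      exact ⟨fun _ => ⟨m + 1, by omega, le_rfl, h⟩, fun _ => by omega⟩
    · rw [last_succ_of_neg h, ih]
      constructor
      · rintro ⟨j, h1, h2, h3⟩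
        exact ⟨j, h1, by omega, h3⟩
      · rintro ⟨j, h1, h2, h3⟩
        refine ⟨j, h1, ?_, h3⟩
        by_contra hj
        have : j = m + 1 := by omega
        exact h (this ▸ h3)

theorem last_congr {P Q : ℕ → Prop} {m : ℕ} (h : ∀ j, 1 ≤ j → j ≤ m → (P j ↔ Q j)) :
    last P m = last Q m := by
  induction m with
  | zero => rfl
  | succ m ih =>
    have ih := ih fun j h1 h2 => h j h1 (by omega)
    by_cases hP : P (m + 1)
    · rw [last_succ_of_pos hP, last_succ_of_pos ((h _ (by omega) le_rfl).mp hP)]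
    · rw [last_succ_of_neg hP, last_succ_of_neg fun hQ => hP ((h _ (by omega) le_rfl).mpr hQ), ih]

/-- For each key `κ` the numbers `1, …, m` with the property `P κ` are linked in descending order:
`hd κ` is the first one, and `nx j` the one after `j`. -/
structure Chained (P : List ℕ → ℕ → Prop) (hd : List ℕ → ℕ) (nx : ℕ → ℕ) (m : ℕ) : Prop where
  head : ∀ κ, hd κ = last (P κ) m
  next : ∀ κ j, 1 ≤ j → j ≤ m → P κ j → nx j = last (P κ) (j - 1)

theorem Chained.skip {P : List ℕ → ℕ → Prop} {hd : List ℕ → ℕ} {nx : ℕ → ℕ} {m : ℕ}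
    (h : Chained P hd nx m) (hP : ∀ κ, ¬ P κ (m + 1)) : Chained P hd nx (m + 1) where
  head κ := by rw [h.head, last_succ_of_neg (hP κ)]
  next κ j h1 h2 h3 := by
    refine h.next κ j h1 ?_ h3
    by_contra hj
    have : j = m + 1 := by omega
    exact hP κ (this ▸ h3)

/-- Entries are prepended, which changes one head cell and one next cell only. This is why the lists
run in descending order. -/
theorem Chained.insert {P : List ℕ → ℕ → Prop} {hd hd' : List ℕ → ℕ} {nx nx' : ℕ → ℕ} {m : ℕ}
    {κ₀ : List ℕ} (h : Chained P hd nx m) (hP : ∀ κ, P κ (m + 1) ↔ κ = κ₀)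
    (hd₀ : hd' κ₀ = m + 1) (hd₁ : ∀ κ, κ ≠ κ₀ → hd' κ = hd κ) (nx₀ : nx' (m + 1) = hd κ₀)
    (nx₁ : ∀ j, j ≤ m → nx' j = nx j) : Chained P hd' nx' (m + 1) where
  head κ := by
    by_cases hκ : κ = κ₀
    · rw [last_succ_of_pos ((hP κ).mpr hκ), hκ, hd₀]
    · rw [last_succ_of_neg (fun h => hκ ((hP κ).mp h)), hd₁ κ hκ, h.head]
  next κ j h1 h2 h3 := by
    by_cases hj : j = m + 1
    · subst hj
      rw [nx₀, h.head, (hP κ).mp h3]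
      rfl
    · rw [nx₁ j (by omega)]
      exact h.next κ j h1 (by omega) h3

theorem Chained.congr {P Q : List ℕ → ℕ → Prop} {hd hd' : List ℕ → ℕ} {nx nx' : ℕ → ℕ} {m : ℕ}
    (h : Chained P hd nx m) (hPQ : ∀ κ j, 1 ≤ j → j ≤ m → (P κ j ↔ Q κ j))
    (hhd : ∀ κ, hd' κ = hd κ) (hnx : ∀ j, nx' j = nx j) : Chained Q hd' nx' m where
  head κ := by rw [hhd, h.head]; exact last_congr (hPQ κ)
  next κ j h1 h2 h3 := by
    rw [hnx, h.next κ j h1 h2 ((hPQ κ j h1 h2).mpr h3)]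
    exact last_congr fun i hi1 hi2 => hPQ κ i hi1 (by omega)

/-! ### Reading the input -/

/-- The tuples of a database in the order in which they are listed. -/
abbrev Rows (S : Schema) : Type := (R : Fin S.numSymbols) → List (Fin (S.arity R) → ℕ)

/-- The `j`-th tuple of `R`, counted from `1`. -/
def Rows.at {S : Schema} (rows : Rows S) (R : Fin S.numSymbols) (j : ℕ) : Fin (S.arity R) → ℕ :=
  (rows R).getD (j - 1) fun _ => 0

/-- The listing of the relations of the given symbols. -/
def Rows.encode {S : Schema} (rows : Rows S) (l : List (Fin S.numSymbols)) : List ℕ :=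
  l.flatMap fun R => (rows R).length :: (rows R).flatMap List.ofFn

/-- The first component of a heap address names a table. Cell `[0, R, k, j]` holds entry `k` of
tuple `j` of `R`, counted from 1; tables 1 and 2 hold heads and links of the index, table 3 the
stored assignments, tables 4 and 5 their heads and links. -/
def readTuple {S : Schema} (R : Fin S.numSymbols) (l : List (Fin (S.arity R))) : List Op :=
  l.flatMap fun k => [.input .aux .pos, .inc .pos .pos, .put [.lit 0, .lit R, .lit k, .reg .row] .aux]

def readRel {S : Schema} (R : Fin S.numSymbols) : Cmd :=
  .seq (.block [.input (.cnt R) .pos, .inc .pos .pos, .const .row 0])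
    (.whileNe .row (.cnt R) (.block (.inc .row .row :: readTuple R (List.finRange _))))

def readAll {S : Schema} (l : List (Fin S.numSymbols)) : Cmd :=
  l.foldr (fun R C => .seq (readRel R) C) .skip

theorem drop_succ_of_drop {w : List ℕ} {i x : ℕ} {tl : List ℕ} (h : w.drop i = x :: tl) :
    w.drop (i + 1) = tl := by
  rw [← List.drop_drop, h]
  rfl

theorem readTuple_eval {S : Schema} {w : List ℕ} (R : Fin S.numSymbols) (t : Fin (S.arity R) → ℕ)
    (l : List (Fin (S.arity R))) (tl : List ℕ) (σ : State)
    (h : w.drop (σ.reg .pos) = l.map t ++ tl) :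
    ∃ σ', (Cmd.block (readTuple R l)).eval w σ = σ' ∧ w.drop (σ'.reg .pos) = tl ∧
      (∀ r, r ≠ .aux → r ≠ .pos → σ'.reg r = σ.reg r) ∧
      (∀ k ∈ l, σ'.heap [0, R, k, σ.reg .row] = t k) ∧
      ∀ a, (∀ k ∈ l, a ≠ [0, ↑R, ↑k, σ.reg .row]) → σ'.heap a = σ.heap a := by
  induction l generalizing σ with
  | nil => exact ⟨σ, rfl, by simpa using h, by simp, by simp, by simp⟩
  | cons k l ih =>
    rw [List.map_cons, List.cons_append] at h
    let σ₁ := ((σ.set .aux (t k)).set .pos (σ.reg .pos + 1)).write [0, R, k, σ.reg .row] (t k)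
    have e : (Cmd.block (readTuple R (k :: l))).eval w σ = (Cmd.block (readTuple R l)).eval w σ₁ := by
      change (Cmd.block (readTuple R l)).eval w _ = _
      congr 1
      simp [Cmd.eval, Op.eval, memOf_of_drop _ h, State.set_reg, σ₁]
    have hrow : σ₁.reg .row = σ.reg .row := by simp [σ₁, State.set_reg]
    obtain ⟨σ', h1, h2, h3, h4, h5⟩ := ih σ₁ (by
      rw [show σ₁.reg .pos = σ.reg .pos + 1 by simp [σ₁]]
      exact drop_succ_of_drop h)
    rw [hrow] at h4 h5
    refine ⟨σ', e.trans h1, h2, fun r hr1 hr2 => ?_, fun k' hk' => ?_, fun a ha => ?_⟩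
    · rw [h3 r hr1 hr2]
      simp [σ₁, State.set_reg, hr1, hr2]
    · by_cases hk : k' ∈ l
      · exact h4 k' hk
      · have hkk : k' = k := by simpa [hk] using hk'
        subst hkk
        rw [h5 _ (fun k'' hk'' he => by
          have : k' = k'' := by simpa [Fin.val_inj] using he
          exact hk (this ▸ hk''))]
        simp [σ₁, State.write_heap]
    · rw [h5 a fun k' hk' => ha k' (List.mem_cons_of_mem _ hk')]
      simp [σ₁, State.write_heap, ha k (by simp)]

theorem Rows.at_drop {S : Schema} (rows : Rows S) {R : Fin S.numSymbols} {j : ℕ}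
    (hj : j < (rows R).length) : (rows R).drop j = rows.at R (j + 1) :: (rows R).drop (j + 1) := by
  rw [List.drop_eq_getElem_cons hj]
  simp [Rows.at, hj]

/-- The constant `κ` is chosen before the input. The invariant of the loop is that the input from
`.pos` on lists the tuples not yet read, followed by `tl`. -/
theorem readRel_runs {S : Schema} (R : Fin S.numSymbols) : ∃ κ, ∀ (w : List ℕ) (rows : Rows S)
    (tl : List ℕ) (σ : State), w.drop (σ.reg .pos) = rows.encode [R] ++ tl →
    ∃ σ', Runs w (readRel R) (κ * ((rows R).length + 1)) σ σ' ∧ w.drop (σ'.reg .pos) = tl ∧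
      σ'.reg (.cnt R) = (rows R).length ∧
      (∀ r, r ≠ .aux → r ≠ .pos → r ≠ .row → r ≠ .cnt R → σ'.reg r = σ.reg r) ∧
      (∀ (k : Fin (S.arity R)) j, 1 ≤ j → j ≤ (rows R).length →
        σ'.heap [0, R, k, j] = rows.at R j k) ∧
      ∀ a, (∀ k j, a ≠ [0, ↑R, k, j]) → σ'.heap a = σ.heap a := by
  let B : Cmd := .block (.inc .row .row :: readTuple R (List.finRange _))
  let A : Cmd := .block [.input (.cnt R) .pos, .inc .pos .pos, .const .row 0]
  refine ⟨A.cost + B.cost + 3, fun w rows tl σ h => ?_⟩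
  let σ₁ := ((σ.set (.cnt R) (rows R).length).set .pos (σ.reg .pos + 1)).set .row 0
  have h' : w.drop (σ.reg .pos) = (rows R).length :: ((rows R).flatMap List.ofFn ++ tl) := by
    simpa [Rows.encode] using h
  have hA : A.eval w σ = σ₁ := by
    simp [A, Op.eval, memOf_of_drop _ h', σ₁, State.set_reg]
  let J : ℕ → State → Prop := fun j τ => (τ.reg .row = j ∧ τ.reg (.cnt R) = (rows R).length) ∧
    w.drop (τ.reg .pos) = ((rows R).drop j).flatMap List.ofFn ++ tl ∧
    (∀ r, r ≠ .aux → r ≠ .pos → r ≠ .row → r ≠ .cnt R → τ.reg r = σ.reg r) ∧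
    (∀ (k : Fin (S.arity R)) i, 1 ≤ i → i ≤ j → τ.heap [0, R, k, i] = rows.at R i k) ∧
    ∀ a, (∀ k i, a ≠ [0, ↑R, k, i]) → τ.heap a = σ.heap a
  have hJ0 : J 0 σ₁ := by
    refine ⟨by simp [σ₁, State.set_reg], ?_, ?_, fun k i _ _ => by omega, fun a _ => rfl⟩
    · rw [show σ₁.reg .pos = σ.reg .pos + 1 by simp [σ₁, State.set_reg]]
      exact drop_succ_of_drop h'
    · intro r h1 h2 h3 h4
      simp [σ₁, State.set_reg, *]
  obtain ⟨σ', hr, ⟨⟨-, hcnt⟩, hdrop, hreg, hheap, hfr⟩⟩ :=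
    Runs.count (w := w) (C := B) (a := .row) (b := .cnt R) (k := B.cost) (J := J)
    (fun j τ hτ => hτ.1) (by
      rintro j τ hj ⟨⟨h1, h2⟩, h3, h4, h5, h6⟩
      rw [rows.at_drop hj, List.flatMap_cons, List.append_assoc, List.ofFn_eq_map] at h3
      obtain ⟨τ', e1, e2, e3, e4, e5⟩ := readTuple_eval R (rows.at R (j + 1)) (List.finRange _)
        (((rows R).drop (j + 1)).flatMap List.ofFn ++ tl) (τ.set .row (j + 1)) (w := w)
        (by simpa [State.set_reg] using h3)
      rw [State.set_reg_self] at e4 e5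
      refine ⟨τ', ?_, ⟨?_, ?_⟩, e2, ?_, ?_, ?_⟩
      · have : B.eval w τ = τ' := by
          rw [← e1, ← h1]
          rfl
        rw [← this]
        exact (Cmd.block_plain _).runs τ
      · rw [e3 _ (by simp) (by simp), State.set_reg_self]
      · rw [e3 _ (by simp) (by simp), State.set_reg_of_ne _ _ (by simp), h2]
      · intro r r1 r2 r3 r4
        rw [e3 r r1 r2, State.set_reg_of_ne _ _ r3, h4 r r1 r2 r3 r4]
      · intro k i i1 i2
        by_cases hi : i = j + 1
        · subst hi
          exact e4 k (by simp)
        · rw [e5 _ (by simp; omega)]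
          exact h5 k i i1 (by omega)
      · intro a ha
        rw [e5 a fun k _ => ha k _]
        exact h6 a ha) hJ0
  refine ⟨σ', ?_, by simpa using hdrop, hcnt, hreg, hheap, hfr⟩
  have hA' : Runs w A A.cost σ σ₁ := hA ▸ (Cmd.block_plain _).runs σ
  refine (hA'.seq hr).mono ?_
  nlinarith [Nat.zero_le A.cost, Nat.zero_le B.cost, Nat.zero_le (rows R).length]

/-- The tuples listed in `rows` are available in the memory. -/
structure Loaded {S : Schema} (rows : Rows S) (σ : State) : Prop where
  zero : σ.reg .zero = 0
  cnt : ∀ R : Fin S.numSymbols, σ.reg (.cnt R) = (rows R).length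
  heap : ∀ (R : Fin S.numSymbols) (k : Fin (S.arity R)) j, 1 ≤ j → j ≤ (rows R).length →
    σ.heap [0, R, k, j] = rows.at R j k

theorem readAll_runs {S : Schema} (l : List (Fin S.numSymbols)) (hl : l.Nodup) :
    ∃ κ, ∀ (w : List ℕ) (rows : Rows S)
    (M : ℕ) (σ : State), (∀ R, (rows R).length ≤ M) → w.drop (σ.reg .pos) = rows.encode l →
    ∃ σ', Runs w (readAll l) (κ * (M + 1)) σ σ' ∧
      (∀ R ∈ l, σ'.reg (.cnt R) = (rows R).length) ∧
      (∀ r, r ≠ .aux → r ≠ .pos → r ≠ .row → (∀ R ∈ l, r ≠ .cnt R) → σ'.reg r = σ.reg r) ∧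
      (∀ R ∈ l, ∀ (k : Fin (S.arity R)) j, 1 ≤ j → j ≤ (rows R).length →
        σ'.heap [0, R, k, j] = rows.at R j k) ∧
      ∀ a, (∀ R ∈ l, ∀ k j, a ≠ [0, ↑R, k, j]) → σ'.heap a = σ.heap a := by
  induction l with
  | nil => exact ⟨0, fun w rows M σ hM h => ⟨σ, ⟨0, by omega, .skip σ⟩, by simp⟩⟩
  | cons R l ih =>
    obtain ⟨κ, hκ⟩ := ih hl.of_cons
    obtain ⟨κ', hκ'⟩ := readRel_runs R
    refine ⟨κ' + κ, fun w rows M σ hM h => ?_⟩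
    obtain ⟨σ₁, a1, a2, a3, a4, a5, a6⟩ := hκ' w rows (rows.encode l) σ (by
      simpa [Rows.encode] using h)
    obtain ⟨σ₂, b1, b2, b3, b4, b5⟩ := hκ w rows M σ₁ hM a2
    have hR : ∀ R' ∈ l, (R' : ℕ) ≠ R := fun R' h' he => by
      have : R' = R := Fin.val_injective he
      exact (List.nodup_cons.mp hl).1 (this ▸ h')
    refine ⟨σ₂, ?_, ?_, ?_, ?_, ?_⟩
    · rw [Nat.add_mul]
      refine (a1.mono ?_).seq b1
      exact Nat.mul_le_mul_left _ (by have := hM R; omega)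
    · intro R' h'
      rcases List.mem_cons.mp h' with rfl | h'
      · rw [b3 _ (by simp) (by simp) (by simp) (fun R' h' => by simpa using (hR R' h').symm), a3]
      · exact b2 R' h'
    · intro r r1 r2 r3 r4
      rw [b3 r r1 r2 r3 fun R' h' => r4 R' (List.mem_cons_of_mem _ h'),
        a4 r r1 r2 r3 (r4 R (by simp))]
    · intro R' h'
      rcases List.mem_cons.mp h' with rfl | h'
      · intro k j j1 j2
        rw [b5 _ (fun R'' h'' k' j' => by simpa using fun h => ((hR R'' h'').symm h).elim),
          a5 k j j1 j2]
      · exact b4 R' h'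
    · intro a ha
      rw [b5 a fun R' h' => ha R' (List.mem_cons_of_mem _ h'), a6 a (ha R (by simp))]

/-! ### Tuples that take part in solutions -/

/-- The values of the variables that are held in the first bank of registers. -/
def State.asg {n : ℕ} (σ : State) (x : Fin n) : ℕ := σ.reg (.bankA x)

/-- The assignment `v` satisfies the atom of the ear `e`, and it can be extended to those of the
ears in `done` (the ears before `e`, the last one first) that hang below `e`. -/
def Alive {S : Schema} {n : ℕ} (rows : Rows S) : List (Ear S n) → Ear S n → (Fin n → ℕ) → Prop
  | [], e, v => ∃ j, 1 ≤ j ∧ j ≤ (rows e.atom.1).length ∧ ∀ k, v (e.atom.2 k) = rows.at e.atom.1 j k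
  | c :: done, e, v => Alive rows done e v ∧
      ((∀ x ∈ c.key, x ∈ Atom.vars e.atom) → ∃ u, Alive rows done c u ∧ ∀ x ∈ c.key, u x = v x)

theorem Alive.congr {S : Schema} {n : ℕ} {rows : Rows S} {done : List (Ear S n)} {e : Ear S n}
    {v v' : Fin n → ℕ} (h : Alive rows done e v) (hv : ∀ x ∈ Atom.vars e.atom, v x = v' x) :
    Alive rows done e v' := by
  induction done with
  | nil =>
    obtain ⟨j, h1, h2, h3⟩ := h
    exact ⟨j, h1, h2, fun k => by rw [← hv _ ⟨k, rfl⟩, h3]⟩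
  | cons c done ih =>
    refine ⟨ih h.1, fun hc => ?_⟩
    obtain ⟨u, h1, h2⟩ := h.2 hc
    exact ⟨u, h1, fun x hx => by rw [h2 x hx, hv x (hc x hx)]⟩

theorem Alive.exists_row {S : Schema} {n : ℕ} {rows : Rows S} {done : List (Ear S n)}
    {e : Ear S n} {v : Fin n → ℕ} (h : Alive rows done e v) :
    ∃ j, 1 ≤ j ∧ j ≤ (rows e.atom.1).length ∧ ∀ k, v (e.atom.2 k) = rows.at e.atom.1 j k := by
  induction done with
  | nil => exact h
  | cons c done ih => exact ih h.1

/-- The `j`-th tuple of the relation of `e` is alive, and `κ` are its values for the key of `e`. -/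
def Hit {S : Schema} {n : ℕ} (rows : Rows S) (done : List (Ear S n)) (e : Ear S n) (κ : List ℕ)
    (j : ℕ) : Prop :=
  ∃ v, (∀ k, v (e.atom.2 k) = rows.at e.atom.1 j k) ∧ Alive rows done e v ∧ κ = e.key.map v

/-- The first `m` tuples of the relation of `e` are indexed. -/
def IndexOf {S : Schema} {n : ℕ} (rows : Rows S) (done : List (Ear S n)) (e : Ear S n) (m : ℕ)
    (σ : State) : Prop :=
  Chained (Hit rows done e) (fun κ => σ.heap (1 :: e.id :: κ)) (fun j => σ.heap [2, e.id, j]) m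

def Indexed {S : Schema} {n : ℕ} (rows : Rows S) : List (Ear S n) → State → Prop
  | [], _ => True
  | e :: done, σ => IndexOf rows done e (rows e.atom.1).length σ ∧ Indexed rows done σ

/-- Tuples are numbered from 1, so a zero head means that no live tuple has this key. The semijoin
test is a single memory read. -/
theorem IndexOf.head_ne_zero {S : Schema} {n : ℕ} {rows : Rows S} {done : List (Ear S n)}
    {e : Ear S n} {σ : State} (h : IndexOf rows done e (rows e.atom.1).length σ)
    (v : Fin n → ℕ) :
    σ.heap (1 :: e.id :: e.key.map v) ≠ 0 ↔ ∃ u, Alive rows done e u ∧ ∀ x ∈ e.key, u x = v x := by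
  rw [h.head (e.key.map v), last_ne_zero]
  constructor
  · rintro ⟨j, h1, h2, u, h3, h4, h5⟩
    exact ⟨u, h4, fun x hx => (List.map_inj_left.mp h5 x hx).symm⟩
  · rintro ⟨u, h1, h2⟩
    obtain ⟨j, j1, j2, j3⟩ := h1.exists_row
    exact ⟨j, j1, j2, u, j3, h1, (List.map_congr_left h2).symm⟩

/-- The recursion in `Alive` collapses to one lookup for each ear below, because the tables of those
ears already contain live tuples only. -/
theorem Indexed.alive_iff {S : Schema} {n : ℕ} {rows : Rows S} {done : List (Ear S n)}
    {σ : State} (h : Indexed rows done σ) (e : Ear S n) (v : Fin n → ℕ) :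
    Alive rows done e v ↔
      (∃ j, 1 ≤ j ∧ j ≤ (rows e.atom.1).length ∧ ∀ k, v (e.atom.2 k) = rows.at e.atom.1 j k) ∧
      ∀ c ∈ done, (∀ x ∈ c.key, x ∈ Atom.vars e.atom) → σ.heap (1 :: c.id :: c.key.map v) ≠ 0 := by
  induction done with
  | nil => simp [Alive]
  | cons c done ih =>
    rw [Alive, ih h.2, List.forall_mem_cons, h.1.head_ne_zero]
    tauto

/-- A memory cell of the index for the ear with number `i`. -/
def IndexCell (i : ℕ) (a : List ℕ) : Prop := (∃ κ, a = 1 :: i :: κ) ∨ ∃ j, a = [2, i, j]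

theorem IndexOf.congr {S : Schema} {n : ℕ} {rows : Rows S} {done : List (Ear S n)} {e : Ear S n}
    {m : ℕ} {σ σ' : State} (h : IndexOf rows done e m σ)
    (hσ : ∀ a, IndexCell e.id a → σ'.heap a = σ.heap a) : IndexOf rows done e m σ' :=
  Chained.congr h (fun _ _ _ _ => Iff.rfl) (fun κ => hσ _ (.inl ⟨κ, rfl⟩))
    (fun j => hσ _ (.inr ⟨j, rfl⟩))

theorem Indexed.congr {S : Schema} {n : ℕ} {rows : Rows S} {done : List (Ear S n)}
    {σ σ' : State} (h : Indexed rows done σ)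
    (hσ : ∀ c ∈ done, ∀ a, IndexCell c.id a → σ'.heap a = σ.heap a) : Indexed rows done σ' := by
  induction done with
  | nil => trivial
  | cons c done ih =>
    exact ⟨h.1.congr (hσ c (by simp)), ih h.2 fun c' hc' => hσ c' (List.mem_cons_of_mem _ hc')⟩

theorem Indexed.of_reverseAux {S : Schema} {n : ℕ} {rows : Rows S} {es done : List (Ear S n)}
    {σ : State} (h : Indexed rows (es.reverseAux done) σ) : Indexed rows done σ := by
  induction es generalizing done with
  | nil => exact h
  | cons e es ih => exact (ih h).2

/-! ### Building the index -/

/-- Load the tuple with the number in register `p` into the first bank of registers. -/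
def loadRow {S : Schema} {n : ℕ} (p : Reg) (a : Atom S n) (l : List (Fin (S.arity a.1))) : List Op :=
  l.map fun (k : Fin (S.arity a.1)) => .get (.bankA (a.2 k)) [.lit 0, .lit a.1, .lit k, .reg p]

/-- Run `C` if the tuple with the number in register `p` agrees with the first bank. -/
def ifMatch {S : Schema} {n : ℕ} (p : Reg) (a : Atom S n) (l : List (Fin (S.arity a.1)))
    (C : Cmd) : Cmd :=
  l.foldr (fun (k : Fin (S.arity a.1)) C => .seq (.op (.get .aux [.lit 0, .lit a.1, .lit k, .reg p]))
    (.ifeq .aux (.bankA (a.2 k)) C .skip)) C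

def keyOperands {n : ℕ} (l : List (Fin n)) : List Operand := l.map fun (x : Fin n) => .reg (.bankA x)

open Classical in
/-- Run `C` if the first bank can be extended to the ears in `l` that hang below `e`. -/
noncomputable def ifAlive {S : Schema} {n : ℕ} (e : Ear S n) (l : List (Ear S n)) (C : Cmd) : Cmd :=
  l.foldr (fun c C => if ∀ x ∈ c.key, x ∈ Atom.vars e.atom then
    .seq (.op (.get .aux (.lit 1 :: .lit c.id :: keyOperands c.key))) (.ifeq .aux .zero .skip C)
    else C) C

def insertRow {S : Schema} {n : ℕ} (e : Ear S n) : Cmd :=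
  .block [.get .aux (.lit 1 :: .lit e.id :: keyOperands e.key),
    .put [.lit 2, .lit e.id, .reg .row] .aux,
    .put (.lit 1 :: .lit e.id :: keyOperands e.key) .row]

/-- The match test after loading is needed for atoms with repeated variables: loading keeps only the
last value of such a variable, and the test rejects tuples whose values differ. -/
noncomputable def buildBody {S : Schema} {n : ℕ} (done : List (Ear S n)) (e : Ear S n) : Cmd :=
  .seq (.block (.inc .row .row :: loadRow .row e.atom (List.finRange _)))
    (ifMatch .row e.atom (List.finRange _) (ifAlive e done (insertRow e)))

noncomputable def buildOne {S : Schema} {n : ℕ} (done : List (Ear S n)) (e : Ear S n) : Cmd :=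
  .seq (.op (.const .row 0)) (.whileNe .row (.cnt e.atom.1) (buildBody done e))

noncomputable def buildAll {S : Schema} {n : ℕ} : List (Ear S n) → List (Ear S n) → Cmd
  | _, [] => .skip
  | done, e :: es => .seq (buildOne done e) (buildAll (e :: done) es)

/-! ### Effect of the code that builds the index -/

theorem ifMatch_plain {S : Schema} {n : ℕ} (p : Reg) (a : Atom S n) (l : List (Fin (S.arity a.1)))
    {C : Cmd} (hC : C.Plain) : (ifMatch p a l C).Plain := by
  induction l with
  | nil => exact hC
  | cons k l ih => exact ⟨trivial, ih, trivial⟩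

theorem ifAlive_plain {S : Schema} {n : ℕ} (e : Ear S n) (l : List (Ear S n))
    {C : Cmd} (hC : C.Plain) : (ifAlive e l C).Plain := by
  induction l with
  | nil => exact hC
  | cons c l ih =>
    simp only [ifAlive, List.foldr_cons]
    split_ifs
    · exact ⟨trivial, trivial, ih⟩
    · exact ih

theorem State.set_eq_self (σ : State) (r : Reg) : σ.set r (σ.reg r) = σ := by
  simp [State.set]

theorem State.set_set (σ : State) (r : Reg) (v v' : ℕ) : (σ.set r v).set r v' = σ.set r v' := by
  simp [State.set]

@[simp] theorem map_val_keyOperands {n : ℕ} (σ : State) (l : List (Fin n)) :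
    (keyOperands l).map (Operand.val σ) = l.map σ.asg := by
  simp [keyOperands, Function.comp_def, State.asg]

theorem State.asg_set {n : ℕ} (σ : State) (r : Reg) (v : ℕ) (hr : ∀ x, r ≠ .bankA x) :
    ((σ.set r v).asg : Fin n → ℕ) = σ.asg := by
  funext x
  simp [State.asg, State.set_reg, (hr x).symm]

theorem loadRow_eval {S : Schema} {n : ℕ} (w : List ℕ) (p : Reg) (hp : ∀ x, p ≠ .bankA x)
    (a : Atom S n) (l : List (Fin (S.arity a.1))) (σ : State) :
    ∃ σ', (Cmd.block (loadRow p a l)).eval w σ = σ' ∧ σ'.heap = σ.heap ∧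
      (∀ r, (∀ k ∈ l, r ≠ .bankA (a.2 k)) → σ'.reg r = σ.reg r) ∧
      ∀ v : Fin n → ℕ, (∀ k, v (a.2 k) = σ.heap [0, a.1, k, σ.reg p]) →
        ∀ k ∈ l, σ'.asg (a.2 k) = v (a.2 k) := by
  induction l generalizing σ with
  | nil => exact ⟨σ, rfl, rfl, by simp, by simp⟩
  | cons k l ih =>
    obtain ⟨σ', h1, h2, h3, h4⟩ := ih (σ.set (.bankA (a.2 k)) (σ.heap [0, a.1, k, σ.reg p]))
    refine ⟨σ', h1, h2, fun r hr => ?_, fun v hv k' hk' => ?_⟩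
    · rw [h3 r fun k' hk' => hr k' (List.mem_cons_of_mem _ hk'),
        State.set_reg_of_ne _ _ (hr k (by simp))]
    · rw [State.set_heap, State.set_reg_of_ne _ _ (hp _)] at h4
      by_cases hk : ∃ k'' ∈ l, a.2 k'' = a.2 k'
      · obtain ⟨k'', hk'', he⟩ := hk
        rw [← he, h4 v hv k'' hk'']
      · have hkk : k' = k := by
          rcases List.mem_cons.mp hk' with h | h
          · exact h
          · exact (hk ⟨k', h, rfl⟩).elim
        subst hkk
        rw [State.asg, h3 _ fun k'' hk'' he => hk ⟨k'', hk'', by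
          simpa [Fin.val_inj] using he.symm⟩, State.set_reg_self, hv]

theorem ifMatch_eval {S : Schema} {n : ℕ} (w : List ℕ) (p : Reg) (hp : p ≠ .aux)
    (a : Atom S n) (l : List (Fin (S.arity a.1))) (C : Cmd) (σ : State) :
    ∃ v, ((∀ k ∈ l, σ.heap [0, a.1, k, σ.reg p] = σ.asg (a.2 k)) ∧
        (ifMatch p a l C).eval w σ = C.eval w (σ.set .aux v)) ∨
      (¬ (∀ k ∈ l, σ.heap [0, a.1, k, σ.reg p] = σ.asg (a.2 k)) ∧
        (ifMatch p a l C).eval w σ = σ.set .aux v) := by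
  induction l generalizing σ with
  | nil => exact ⟨σ.reg .aux, .inl ⟨by simp, by rw [State.set_eq_self]; rfl⟩⟩
  | cons k l ih =>
    obtain ⟨v, hv⟩ := ih (σ.set .aux (σ.heap [0, a.1, k, σ.reg p]))
    rw [State.set_set, State.set_heap, State.set_reg_of_ne _ _ hp,
      State.asg_set _ _ _ (by simp)] at hv
    have e : (ifMatch p a (k :: l) C).eval w σ
        = if σ.heap [0, a.1, k, σ.reg p] = σ.asg (a.2 k) then
          (ifMatch p a l C).eval w (σ.set .aux (σ.heap [0, a.1, k, σ.reg p]))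
        else σ.set .aux (σ.heap [0, a.1, k, σ.reg p]) := by
      change (Cmd.ifeq .aux (.bankA (a.2 k)) (ifMatch p a l C) .skip).eval w
        (σ.set .aux (σ.heap [0, a.1, k, σ.reg p])) = _
      rw [Cmd.eval, State.set_reg_self, State.set_reg_of_ne _ _ (by simp)]
      rfl
    by_cases hk : σ.heap [0, a.1, k, σ.reg p] = σ.asg (a.2 k)
    · rw [if_pos hk] at e
      refine ⟨v, ?_⟩
      rw [e, List.forall_mem_cons]
      simpa only [hk, true_and] using hv
    · rw [if_neg hk] at e
      exact ⟨_, .inr ⟨fun h => hk (h k (by simp)), e⟩⟩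

theorem ifAlive_eval {S : Schema} {n : ℕ} (w : List ℕ) (e : Ear S n) (l : List (Ear S n)) (C : Cmd)
    (σ : State) (hσ : σ.reg .zero = 0) :
    ∃ v, ((∀ c ∈ l, (∀ x ∈ c.key, x ∈ Atom.vars e.atom) →
          σ.heap (1 :: c.id :: c.key.map σ.asg) ≠ 0) ∧
        (ifAlive e l C).eval w σ = C.eval w (σ.set .aux v)) ∨
      (¬ (∀ c ∈ l, (∀ x ∈ c.key, x ∈ Atom.vars e.atom) →
          σ.heap (1 :: c.id :: c.key.map σ.asg) ≠ 0) ∧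
        (ifAlive e l C).eval w σ = σ.set .aux v) := by
  induction l generalizing σ with
  | nil => exact ⟨σ.reg .aux, .inl ⟨by simp, by rw [State.set_eq_self]; rfl⟩⟩
  | cons c l ih =>
    rw [List.forall_mem_cons]
    by_cases hc : ∀ x ∈ c.key, x ∈ Atom.vars e.atom
    · obtain ⟨v, hv⟩ := ih (σ.set .aux (σ.heap (1 :: c.id :: c.key.map σ.asg)))
        (by rw [State.set_reg_of_ne _ _ (by simp), hσ])
      rw [State.set_set, State.set_heap, State.asg_set _ _ _ (by simp)] at hv
      have ev : (ifAlive e (c :: l) C).eval w σ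
          = if σ.heap (1 :: c.id :: c.key.map σ.asg) = 0 then
            σ.set .aux (σ.heap (1 :: c.id :: c.key.map σ.asg))
          else (ifAlive e l C).eval w (σ.set .aux (σ.heap (1 :: c.id :: c.key.map σ.asg))) := by
        simp only [ifAlive, List.foldr_cons, if_pos hc]
        simp [Cmd.eval, Op.eval, State.set_reg, hσ]
      by_cases hk : σ.heap (1 :: c.id :: c.key.map σ.asg) = 0
      · rw [if_pos hk] at ev
        exact ⟨_, .inr ⟨fun h => h.1 hc hk, ev⟩⟩
      · rw [if_neg hk] at ev
        refine ⟨v, ?_⟩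
        rw [ev]
        have h1 : ((∀ x ∈ c.key, x ∈ Atom.vars e.atom) →
          σ.heap (1 :: c.id :: c.key.map σ.asg) ≠ 0) := fun _ => hk
        rw [and_iff_right h1]
        exact hv
    · have ev : (ifAlive e (c :: l) C).eval w σ = (ifAlive e l C).eval w σ := by
        simp only [ifAlive, List.foldr_cons, if_neg hc]
      rw [ev]
      obtain ⟨v, hv⟩ := ih σ hσ
      refine ⟨v, ?_⟩
      have h1 : ((∀ x ∈ c.key, x ∈ Atom.vars e.atom) →
        σ.heap (1 :: c.id :: c.key.map σ.asg) ≠ 0) := fun h => (hc h).elim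
      rw [and_iff_right h1]
      exact hv

/-- Registers that keep their values while the index is built. -/
def Reg.Lasting : Reg → Prop
  | .zero => True
  | .ctr => True
  | .cnt _ => True
  | _ => False

theorem Loaded.congr {S : Schema} {rows : Rows S} {σ σ' : State} (h : Loaded rows σ)
    (hr : ∀ r, Reg.Lasting r → σ'.reg r = σ.reg r)
    (hh : ∀ a, σ'.heap (0 :: a) = σ.heap (0 :: a)) : Loaded rows σ' where
  zero := by rw [hr .zero trivial, h.zero]
  cnt R := by rw [hr (.cnt R) trivial, h.cnt]
  heap R k j h1 h2 := by rw [hh, h.heap R k j h1 h2]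

theorem insertRow_eval {S : Schema} {n : ℕ} (w : List ℕ) (e : Ear S n) (σ : State) :
    ∃ σ', (insertRow e).eval w σ = σ' ∧ (∀ r, r ≠ .aux → σ'.reg r = σ.reg r) ∧
      (∀ a, ¬ IndexCell e.id a → σ'.heap a = σ.heap a) ∧
      σ'.heap (1 :: e.id :: e.key.map σ.asg) = σ.reg .row ∧
      (∀ κ, κ ≠ e.key.map σ.asg → σ'.heap (1 :: e.id :: κ) = σ.heap (1 :: e.id :: κ)) ∧
      σ'.heap [2, e.id, σ.reg .row] = σ.heap (1 :: e.id :: e.key.map σ.asg) ∧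
      ∀ j, j ≠ σ.reg .row → σ'.heap [2, e.id, j] = σ.heap [2, e.id, j] := by
  let κ₀ := e.key.map σ.asg
  let σ₁ := ((σ.set .aux (σ.heap (1 :: e.id :: κ₀))).write [2, e.id, σ.reg .row]
    (σ.heap (1 :: e.id :: κ₀))).write (1 :: e.id :: κ₀) (σ.reg .row)
  have hasg : ∀ (v : ℕ) (l : List ℕ) (v' : ℕ), (((σ.set .aux v).write l v').asg : Fin n → ℕ) = σ.asg :=
    fun v l v' => State.asg_set σ .aux v (by simp)
  have ev : (insertRow e).eval w σ = σ₁ := by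
    simp [insertRow, Op.eval, State.set_reg, σ₁, κ₀, hasg]
  refine ⟨σ₁, ev, fun r hr => ?_, fun a ha => ?_, ?_, fun κ hκ => ?_, ?_, fun j hj => ?_⟩
  · simp [σ₁, State.set_reg, hr]
  · have h1 : a ≠ 1 :: e.id :: κ₀ := fun h => ha (.inl ⟨_, h⟩)
    have h2 : a ≠ [2, e.id, σ.reg .row] := fun h => ha (.inr ⟨_, h⟩)
    simp [σ₁, State.write_heap, h1, h2]
  · simp [σ₁, κ₀, State.write_heap]
  · have : κ ≠ κ₀ := hκ
    simp [σ₁, State.write_heap, this]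
  · simp [σ₁, κ₀, State.write_heap]
  · simp [σ₁, State.write_heap, hj]

/-- This is the semijoin reduction for one ear. The body contains no loop, so each tuple costs a
constant; distinct identifiers keep the tables of the earlier ears intact. -/
theorem buildOne_runs {S : Schema} {n : ℕ} (done : List (Ear S n)) (e : Ear S n)
    (hid : ∀ c ∈ done, c.id ≠ e.id) (hkey : ∀ x ∈ e.key, x ∈ Atom.vars e.atom) :
    ∃ κ, ∀ (w : List ℕ) (rows : Rows S) (σ : State), Loaded rows σ → Indexed rows done σ →
      (∀ l, σ.heap (1 :: e.id :: l) = 0) →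
      ∃ σ', Runs w (buildOne done e) (κ * ((rows e.atom.1).length + 1)) σ σ' ∧
        Indexed rows (e :: done) σ' ∧ (∀ r, Reg.Lasting r → σ'.reg r = σ.reg r) ∧
        ∀ a, ¬ IndexCell e.id a → σ'.heap a = σ.heap a := by
  have hplain : (buildBody done e).Plain :=
    ⟨Cmd.block_plain _, ifMatch_plain _ _ _ (ifAlive_plain _ _ (Cmd.block_plain _))⟩
  refine ⟨(buildBody done e).cost + 3, fun w rows σ hL hI h0 => ?_⟩
  set N := (rows e.atom.1).length with hN
  let J : ℕ → State → Prop := fun m τ => τ.reg .row = m ∧ IndexOf rows done e m τ ∧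
    (∀ r, Reg.Lasting r → τ.reg r = σ.reg r) ∧ ∀ a, ¬ IndexCell e.id a → τ.heap a = σ.heap a
  have hcell0 : ∀ a, ¬ IndexCell e.id (0 :: a) := by
    rintro a (⟨κ, h⟩ | ⟨j, h⟩) <;> simp at h
  have hcell : ∀ c ∈ done, ∀ a, IndexCell c.id a → ¬ IndexCell e.id a := by
    rintro c hc a (⟨κ, rfl⟩ | ⟨j, rfl⟩) (⟨κ', h⟩ | ⟨j', h⟩) <;> simp at h
    · exact hid c hc h.1
    · exact hid c hc h.1
  have hstart : J 0 (σ.set .row 0) := by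
    refine ⟨by simp, ⟨fun κ => h0 κ, fun κ j h1 h2 => by omega⟩, fun r hr => ?_, fun a _ => rfl⟩
    refine State.set_reg_of_ne _ _ ?_
    rintro rfl
    exact hr
  obtain ⟨σ', hrun, h1, h2, h3, h4⟩ := Runs.count (w := w) (C := buildBody done e) (a := .row)
    (b := .cnt e.atom.1) (k := (buildBody done e).cost) (N := N) (J := J)
    (fun j τ hτ => ⟨hτ.1, by rw [hτ.2.2.1 (.cnt _) trivial, hL.cnt]⟩) (by
      rintro m τ hm ⟨j1, j2, j3, j4⟩
      refine ⟨(buildBody done e).eval w τ, hplain.runs τ, ?_⟩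
      obtain ⟨τ₁, a1, a2, a3, a4⟩ := loadRow_eval w .row (by simp) e.atom (List.finRange _)
        (τ.set .row (m + 1))
      have ev₁ : (buildBody done e).eval w τ
          = (ifMatch .row e.atom (List.finRange _) (ifAlive e done (insertRow e))).eval w τ₁ := by
        rw [← a1, ← j1]
        rfl
      have hrow : τ₁.reg .row = m + 1 := by
        rw [a3 _ (by simp), State.set_reg_self]
      have hlast : ∀ r, Reg.Lasting r → τ₁.reg r = σ.reg r := by
        intro r hr
        rw [a3 r (by rintro k - rfl; exact hr), State.set_reg_of_ne _ _ (by rintro rfl; exact hr),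
          j3 r hr]
      have hheap : τ₁.heap = τ.heap := a2
      have hL₁ : Loaded rows τ₁ := hL.congr hlast fun a => by rw [hheap, j4 _ (hcell0 a)]
      have hI₁ : Indexed rows done τ₁ := hI.congr fun c hc a ha => by
        rw [hheap, j4 a (hcell c hc a ha)]
      have htup : ∀ k : Fin (S.arity e.atom.1), τ₁.heap [0, e.atom.1, k, τ₁.reg .row] = rows.at e.atom.1 (m + 1) k :=
        fun k => by rw [hrow, hL₁.heap _ k _ (by omega) hm]
      have hix₁ : IndexOf rows done e m τ₁ := j2.congr fun a _ => by rw [hheap]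
      rw [State.set_heap, State.set_reg_self, ← hheap, ← hrow] at a4
      simp only [htup] at a4
      -- An assignment that witnesses a hit agrees with the loaded values on the variables of the
      -- atom, so the first bank alone decides whether the tuple enters the index and under which
      -- key.
      have hhit : ∀ κ, Hit rows done e κ (m + 1) ↔
          (∀ k, τ₁.asg (e.atom.2 k) = rows.at e.atom.1 (m + 1) k) ∧ Alive rows done e τ₁.asg ∧
            κ = e.key.map τ₁.asg := by
        intro κ
        refine ⟨?_, fun h => ⟨τ₁.asg, h⟩⟩
        rintro ⟨v, v1, v2, v3⟩
        have hv : ∀ x ∈ Atom.vars e.atom, v x = τ₁.asg x := by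
          rintro _ ⟨k, rfl⟩
          exact (a4 v v1 k (by simp)).symm
        refine ⟨fun k => by rw [← hv _ ⟨k, rfl⟩, v1], v2.congr hv, ?_⟩
        rw [v3]
        exact List.map_congr_left fun x hx => hv x (hkey x hx)
      have hskip : ∀ v, (∀ κ, ¬ Hit rows done e κ (m + 1)) → J (m + 1) (τ₁.set .aux v) := by
        intro v hno
        refine ⟨by rw [State.set_reg_of_ne _ _ (by simp), hrow],
          (Chained.skip hix₁ hno : IndexOf rows done e (m + 1) τ₁), fun r hr => ?_, fun a ha => ?_⟩
        · rw [State.set_reg_of_ne _ _ (by rintro rfl; exact hr), hlast r hr]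
        · rw [State.set_heap, hheap, j4 a ha]
      rw [ev₁]
      obtain ⟨v₁, ⟨c1, c2⟩ | ⟨c1, c2⟩⟩ := ifMatch_eval w .row (by simp) e.atom (List.finRange _)
        (ifAlive e done (insertRow e)) τ₁
      · simp only [htup, List.mem_finRange, true_imp_iff] at c1
        obtain ⟨v₂, ⟨d1, d2⟩ | ⟨d1, d2⟩⟩ := ifAlive_eval w e done (insertRow e) (τ₁.set .aux v₁)
          (by rw [State.set_reg_of_ne _ _ (by simp), hL₁.zero])
        · rw [State.set_heap, State.asg_set _ _ _ (by simp)] at d1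
          have hal := (hI₁.alive_iff e τ₁.asg).mpr
            ⟨⟨m + 1, by omega, hm, fun k => (c1 k).symm⟩, d1⟩
          rw [State.set_set] at d2
          obtain ⟨τ₂, e1, e2, e3, e4, e5, e6, e7⟩ := insertRow_eval w e (τ₁.set .aux v₂)
          rw [State.asg_set _ _ _ (by simp), State.set_reg_of_ne _ _ (by simp), hrow] at e4
          rw [State.asg_set _ _ _ (by simp)] at e5
          rw [State.asg_set _ _ _ (by simp), State.set_reg_of_ne _ _ (by simp), hrow] at e6
          rw [State.set_reg_of_ne _ _ (by simp), hrow] at e7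
          rw [c2, d2, e1]
          refine ⟨?_, ?_, fun r hr => ?_, fun a ha => ?_⟩
          · rw [e2 _ (by simp), State.set_reg_of_ne _ _ (by simp), hrow]
          · refine Chained.insert (κ₀ := e.key.map τ₁.asg) hix₁ (fun κ => ?_) e4 e5 e6
              fun j hj => e7 j (by omega)
            rw [hhit]
            exact ⟨fun h => h.2.2, fun h => ⟨fun k => (c1 k).symm, hal, h⟩⟩
          · have hne : r ≠ .aux := by rintro rfl; exact hr
            rw [e2 r hne, State.set_reg_of_ne _ _ hne, hlast r hr]
          · rw [e3 a ha, State.set_heap, hheap, j4 a ha]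
        · rw [State.set_heap, State.asg_set _ _ _ (by simp)] at d1
          rw [c2, d2, State.set_set]
          refine hskip _ fun κ hκ => d1 ?_
          exact ((hI₁.alive_iff e τ₁.asg).mp ((hhit κ).mp hκ).2.1).2
      · simp only [htup, List.mem_finRange, true_imp_iff] at c1
        rw [c2]
        exact hskip _ fun κ hκ => c1 fun k => (((hhit κ).mp hκ).1 k).symm) hstart
  have hconst : Runs w (.op (.const .row 0)) 1 σ (σ.set .row 0) := ⟨1, le_rfl, .op _ _⟩
  refine ⟨σ', (hconst.seq hrun).mono ?_, ⟨h2, ?_⟩, h3, h4⟩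
  · nlinarith [Nat.zero_le (buildBody done e).cost, Nat.zero_le N]
  · exact hI.congr fun c hc a ha => h4 a (hcell c hc a ha)

/-- Ears are indexed in list order, so the tables consulted for an ear are complete when it is
processed. -/
theorem buildAll_runs {S : Schema} {n : ℕ} (done es : List (Ear S n)) (hes : EarList es)
    (hid : ∀ c ∈ done, ∀ e ∈ es, c.id ≠ e.id) :
    ∃ κ, ∀ (w : List ℕ) (rows : Rows S) (M : ℕ) (σ : State), (∀ R, (rows R).length ≤ M) →
      Loaded rows σ → Indexed rows done σ → (∀ e ∈ es, ∀ l, σ.heap (1 :: e.id :: l) = 0) →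
      ∃ σ', Runs w (buildAll done es) (κ * (M + 1)) σ σ' ∧
        Indexed rows (es.reverseAux done) σ' ∧ (∀ r, Reg.Lasting r → σ'.reg r = σ.reg r) ∧
        ∀ a, (∀ e ∈ es, ¬ IndexCell e.id a) → σ'.heap a = σ.heap a := by
  induction es generalizing done with
  | nil => exact ⟨0, fun w rows M σ _ _ hI _ => ⟨σ, ⟨0, by omega, .skip σ⟩, hI, by simp, by simp⟩⟩
  | cons e es ih =>
    have hne : ∀ b ∈ es, b.id ≠ e.id := fun b hb => by
      have := hes.2.2.2.id_lt b hb
      have := hes.1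
      omega
    obtain ⟨κ₁, h₁⟩ := buildOne_runs done e (fun c hc => hid c hc e (by simp))
      (fun x hx => ((hes.2.1 x).mp hx).1)
    obtain ⟨κ₂, h₂⟩ := ih (e :: done) hes.2.2.2 (by
      intro c hc b hb
      rcases List.mem_cons.mp hc with rfl | hc
      · exact (hne b hb).symm
      · exact hid c hc b (List.mem_cons_of_mem _ hb))
    refine ⟨κ₁ + κ₂, fun w rows M σ hM hL hI h0 => ?_⟩
    obtain ⟨σ₁, a1, a2, a3, a4⟩ := h₁ w rows σ hL hI (h0 e (by simp))
    obtain ⟨σ₂, b1, b2, b3, b4⟩ := h₂ w rows M σ₁ hM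
      (hL.congr a3 fun a => a4 _ (by rintro (⟨κ, h⟩ | ⟨j, h⟩) <;> simp at h)) a2
      (fun b hb l => by
        rw [a4 _ (by
          rintro (⟨κ, h⟩ | ⟨j, h⟩) <;> simp at h
          exact hne b hb h.1)]
        exact h0 b (List.mem_cons_of_mem _ hb) l)
    refine ⟨σ₂, ?_, b2, fun r hr => by rw [b3 r hr, a3 r hr], fun a ha => ?_⟩
    · rw [Nat.add_mul]
      exact (a1.mono (Nat.mul_le_mul_left _ (by have := hM e.atom.1; omega))).seq b1
    · rw [b4 a fun b hb => ha b (List.mem_cons_of_mem _ hb), a4 a (ha e (by simp))]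

/-! ### Loops along linked lists -/

/-- `J m` describes the moment when the numbers above `m` are done. Numbers without `P` are not on
the list, so passing them costs nothing, and every actual round outputs something. Silences
therefore meet only the end of one round and the start of the next, whatever the number of rounds.
-/
theorem exec_chain {w : List ℕ} {C : Cmd} {p : Reg} {d N : ℕ} {P : ℕ → Prop}
    {J : ℕ → State → List (List ℕ) → Prop}
    (hJ : ∀ m σ E, J m σ E → σ.reg p = last P m ∧ σ.reg .zero = 0)
    (hstep : ∀ m σ E, m < N → P (m + 1) → J (m + 1) σ E →
      ∃ t σ', Exec w C σ t σ' ∧ Gap d t ∧ outputs t ≠ [] ∧ J m σ' (E ++ outputs t))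
    (hskip : ∀ m σ E, m < N → ¬ P (m + 1) → J (m + 1) σ E → J m σ E)
    (m : ℕ) (σ : State) (E : List (List ℕ)) (hm : m ≤ N) (h : J m σ E) :
    ∃ t σ', Exec w (.whileNe p .zero C) σ t σ' ∧ Gap (2 * d + 2) t ∧ lead t ≤ d + 1 ∧
      (last P m ≠ 0 → outputs t ≠ []) ∧ J 0 σ' (E ++ outputs t) := by
  induction m generalizing σ E with
  | zero =>
    obtain ⟨h1, h2⟩ := hJ _ _ _ h
    refine ⟨[none], σ, .whileDone (by rw [h1, h2]; rfl), ⟨by simp [lead], trivial⟩, by simp [lead],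
      fun h => (h rfl).elim, by simpa using h⟩
  | succ m ih =>
    by_cases hP : P (m + 1)
    · obtain ⟨h1, h2⟩ := hJ _ _ _ h
      rw [last_succ_of_pos hP] at h1
      obtain ⟨t, σ₁, e1, g1, o1, j1⟩ := hstep m σ E (by omega) hP h
      obtain ⟨t', σ₂, e2, g2, l2, -, j2⟩ := ih σ₁ _ (by omega) j1
      have hl : lead (none :: (t ++ none :: t')) ≤ d + 1 := by
        have := g1.lead_le
        simp only [lead]
        rw [lead_append_of_outputs o1]
        omega
      refine ⟨none :: (t ++ none :: t'), σ₂, .whileStep (by omega) e1 e2, ⟨by omega, ?_⟩, hl,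
        fun _ => by simp [o1], by simpa using j2⟩
      -- The jump back and the lead of the remaining loop, at most `d + 1`, follow the silent end of
      -- the round, at most `d`; together `2 * d + 2`.
      exact g1.append (b := d + 2) (by simp only [lead]; omega) ⟨by simp only [lead]; omega, g2⟩
        (by omega)
    · rw [last_succ_of_neg hP]
      exact ih σ E (by omega) (hskip _ _ _ (by omega) hP h)

/-! ### Enumerating the solutions of an acyclic query -/

/-- Run `body` for all tuples of the relation of `e` that are alive and match the first bank. -/
def loopEar {S : Schema} {n : ℕ} (e : Ear S n) (body : Cmd) : Cmd :=
  .seq (.op (.get (.ptr e.id) (.lit 1 :: .lit e.id :: keyOperands e.key)))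
    (.whileNe (.ptr e.id) .zero (.seq (.block (loadRow (.ptr e.id) e.atom (List.finRange _)))
      (.seq body (.op (.get (.ptr e.id) [.lit 2, .lit e.id, .reg (.ptr e.id)])))))

/-- The first ear becomes the innermost loop. The loops thus bind the variables from the last ear,
the root, downwards, opposite to the order in which the index is built. -/
def loops {S : Schema} {n : ℕ} : List (Ear S n) → Cmd → Cmd
  | [], body => body
  | e :: es, body => loops es (loopEar e body)

/-- The first summand pays for reading the head of the list. The rest is the bound of `exec_chain`
for a round that loads a tuple, runs the body, and reads a link cell with three components in 21
steps. -/
def Ear.delay {S : Schema} {n : ℕ} (e : Ear S n) (d : ℕ) : ℕ :=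
  (1 + 6 * (e.key.length + 2) + 2) +
    (2 * ((Cmd.block (loadRow (.ptr e.id) e.atom (List.finRange _))).cost + (d + 21)) + 2)

def loopsDelay {S : Schema} {n : ℕ} : List (Ear S n) → ℕ → ℕ
  | [], d => d
  | e :: es, d => loopsDelay es (e.delay d)

/-- The assignment is alive for each of the ears in `es`, which come after those in `done`. -/
def AllAlive {S : Schema} {n : ℕ} (rows : Rows S) :
    List (Ear S n) → List (Ear S n) → (Fin n → ℕ) → Prop
  | _, [], _ => True
  | done, e :: es, v => Alive rows done e v ∧ AllAlive rows (e :: done) es v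

theorem AllAlive.congr {S : Schema} {n : ℕ} {rows : Rows S} {done es : List (Ear S n)}
    {v v' : Fin n → ℕ} (h : AllAlive rows done es v)
    (hv : ∀ e ∈ es, ∀ x ∈ Atom.vars e.atom, v x = v' x) : AllAlive rows done es v' := by
  induction es generalizing done with
  | nil => trivial
  | cons e es ih =>
    exact ⟨h.1.congr (hv e (by simp)), ih h.2 fun b hb => hv b (List.mem_cons_of_mem _ hb)⟩

theorem Alive.of_append {S : Schema} {n : ℕ} {rows : Rows S} {l done : List (Ear S n)}
    {e : Ear S n} {v : Fin n → ℕ} (h : Alive rows (l ++ done) e v) : Alive rows done e v := by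
  induction l with
  | nil => exact h
  | cons c l ih => exact ih h.1

theorem AllAlive.alive {S : Schema} {n : ℕ} {rows : Rows S} {done es : List (Ear S n)}
    {v : Fin n → ℕ} (h : AllAlive rows done es v) {e : Ear S n} (he : e ∈ es) :
    Alive rows done e v := by
  suffices H : ∃ l, Alive rows (l ++ done) e v from H.elim fun l hl => hl.of_append
  induction es generalizing done with
  | nil => simp at he
  | cons b es ih =>
    rcases List.mem_cons.mp he with rfl | he
    · exact ⟨[], h.1⟩
    · obtain ⟨l, hl⟩ := ih h.2 he
      exact ⟨l ++ [b], by simpa using hl⟩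

/-- The values for the variables of the atom form a tuple of its relation. -/
def MatchesRow {S : Schema} {n : ℕ} (rows : Rows S) (e : Ear S n) (v : Fin n → ℕ) : Prop :=
  ∃ j, 1 ≤ j ∧ j ≤ (rows e.atom.1).length ∧ ∀ k, v (e.atom.2 k) = rows.at e.atom.1 j k

/-- An assignment that satisfies all atoms serves as its own extension everywhere, so restricting
the loops to live tuples loses no solution. -/
theorem alive_of_matchesRow {S : Schema} {n : ℕ} {rows : Rows S} {done : List (Ear S n)}
    {e : Ear S n} {v : Fin n → ℕ} (he : MatchesRow rows e v)
    (hd : ∀ c ∈ done, MatchesRow rows c v) : Alive rows done e v := by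
  induction done generalizing e with
  | nil => exact he
  | cons c done ih =>
    have hd' : ∀ c ∈ done, MatchesRow rows c v := fun b hb => hd b (List.mem_cons_of_mem _ hb)
    exact ⟨ih he hd', fun _ => ⟨v, ih (hd c (by simp)) hd', fun _ _ => rfl⟩⟩

/-- Started with values for the variables of `es` in the first bank, `body` visits those members of
`Sol` that have these values. The invariant `Inv h E` refers to the list `h` of the members
visited so far and the list `E` of the tuples output so far. -/
def Visits {S : Schema} {n : ℕ} (w : List ℕ) (rows : Rows S) (Sol : Set (Fin n → ℕ))
    (Inv : List (Fin n → ℕ) → List (List ℕ) → State → Prop) (done es : List (Ear S n)) (d : ℕ)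
    (body : Cmd) : Prop :=
  ∀ h E σ, Inv h E σ → AllAlive rows done es σ.asg →
    (∀ s ∈ h, ∃ e ∈ es, ∃ x ∈ Atom.vars e.atom, s x ≠ σ.asg x) →
    ∃ t σ' H, Exec w body σ t σ' ∧ Gap d t ∧ (es ≠ [] → outputs t ≠ []) ∧
      Inv (h ++ H) (E ++ outputs t) σ' ∧
      (∀ s, s ∈ H ↔ s ∈ Sol ∧ ∀ e ∈ es, ∀ x ∈ Atom.vars e.atom, s x = σ.asg x) ∧
      (∀ e ∈ es, σ'.reg (.ptr e.id) = σ.reg (.ptr e.id)) ∧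
      ∀ e ∈ es, ∀ x ∈ Atom.vars e.atom, σ'.asg x = σ.asg x

/-- The invariant does not depend on the registers that the loops use. -/
def LoopInvariant {n : ℕ} (Inv : List (Fin n → ℕ) → List (List ℕ) → State → Prop) : Prop :=
  ∀ h E σ σ', Inv h E σ → σ'.heap = σ.heap → (∀ r, Reg.Lasting r → σ'.reg r = σ.reg r) →
    Inv h E σ'

theorem Rows.at_inj {S : Schema} {rows : Rows S} {R : Fin S.numSymbols} (hR : (rows R).Nodup)
    {i j : ℕ} (hi : 1 ≤ i) (hi' : i ≤ (rows R).length) (hj : 1 ≤ j) (hj' : j ≤ (rows R).length)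
    (h : rows.at R i = rows.at R j) : i = j := by
  unfold Rows.at at h
  rw [List.getD_eq_getElem _ _ (by omega), List.getD_eq_getElem _ _ (by omega)] at h
  have := (List.Nodup.getElem_inj_iff hR).mp h
  omega

/-- Unless `e` is the last ear, some ear in `es` contains its key and is alive, so the loop for `e`
has at least one round, and each round outputs something. Rounds belong to different tuples of `e`,
so their solutions are different; this passes the freshness condition on to the body. -/
theorem loopEar_visits {S : Schema} {n : ℕ} {w : List ℕ} {rows : Rows S} {Sol : Set (Fin n → ℕ)}
    {Inv : List (Fin n → ℕ) → List (List ℕ) → State → Prop} {done es : List (Ear S n)}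
    {e : Ear S n} {d : ℕ} {body : Cmd} (hrows : ∀ R, (rows R).Nodup) (hes : EarList (e :: es))
    (hInv : LoopInvariant Inv) (hL : ∀ h E σ, Inv h E σ → Loaded rows σ)
    (hI : ∀ h E σ, Inv h E σ → IndexOf rows done e (rows e.atom.1).length σ)
    (hSol : ∀ s ∈ Sol, Alive rows done e s) (hb : Visits w rows Sol Inv done (e :: es) d body) :
    Visits w rows Sol Inv (e :: done) es (e.delay d) (loopEar e body) := by
  intro h E σ hσ hal hfresh
  obtain ⟨hid, hkey, hpar, hes'⟩ := hes
  set N := (rows e.atom.1).length with hN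
  have hptr : ∀ f ∈ es, Reg.ptr f.id ≠ .ptr e.id := by
    intro f hf he
    have := hes'.id_lt f hf
    simp only [Reg.ptr.injEq] at he
    omega
  set P : ℕ → Prop := Hit rows done e (e.key.map σ.asg) with hP
  have hkv : ∀ s : Fin n → ℕ, (∀ f ∈ es, ∀ x ∈ Atom.vars f.atom, s x = σ.asg x) →
      e.key.map σ.asg = e.key.map s := fun s hs =>
    List.map_congr_left fun x hx => by
      obtain ⟨f, hf, hxf⟩ := ((hkey x).mp hx).2
      exact (hs f hf x hxf).symm
  -- `H` collects the members visited in the rounds for the tuples numbered above `m`.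
  let J : ℕ → State → List (List ℕ) → Prop := fun m τ E' => ∃ H, Inv (h ++ H) E' τ ∧
    τ.reg (.ptr e.id) = last P m ∧ (∀ f ∈ es, τ.reg (.ptr f.id) = σ.reg (.ptr f.id)) ∧
    (∀ f ∈ es, ∀ x ∈ Atom.vars f.atom, τ.asg x = σ.asg x) ∧
    ∀ s, s ∈ H ↔ s ∈ Sol ∧ (∀ f ∈ es, ∀ x ∈ Atom.vars f.atom, s x = σ.asg x) ∧
      ∃ j, m < j ∧ j ≤ N ∧ ∀ k, s (e.atom.2 k) = rows.at e.atom.1 j k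
  let σ₁ := σ.set (.ptr e.id) (last P N)
  have hJN : J N σ₁ E := by
    refine ⟨[], ?_, by simp [σ₁], fun f hf => ?_, fun f hf x hx => ?_, fun s => ?_⟩
    · rw [List.append_nil]
      refine hInv h E σ _ hσ rfl fun r hr => State.set_reg_of_ne _ _ ?_
      rintro rfl
      exact hr
    · exact State.set_reg_of_ne _ _ (hptr f hf)
    · exact congrFun (State.asg_set σ _ _ (by simp)) x
    · simp only [List.not_mem_nil, false_iff]
      rintro ⟨-, -, j, h1, h2, -⟩
      omega
  have hget : Exec w (.op (.get (.ptr e.id) (.lit 1 :: .lit e.id :: keyOperands e.key))) σ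
      (List.replicate (1 + 6 * (e.key.length + 2) + 2) none) σ₁ := by
    have := Exec.op (w := w) (.get (.ptr e.id) (.lit 1 :: .lit e.id :: keyOperands e.key)) σ
    have e1 : Op.eval w (.get (.ptr e.id) (.lit 1 :: .lit e.id :: keyOperands e.key)) σ = σ₁ := by
      have h1 := (hI h E σ hσ).head (e.key.map σ.asg)
      simp only [Op.eval, List.map_cons, Operand.val_lit, map_val_keyOperands, σ₁]
      rw [h1]
    rw [e1] at this
    simpa [Op.cost, keyOperands] using this
  obtain ⟨t, σ', e1, g1, -, o1, H, i1, -, i3, i4, i5⟩ := exec_chain (w := w)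
    (C := .seq (.block (loadRow (.ptr e.id) e.atom (List.finRange _)))
      (.seq body (.op (.get (.ptr e.id) [.lit 2, .lit e.id, .reg (.ptr e.id)]))))
    (p := .ptr e.id) (d := (Cmd.block (loadRow (.ptr e.id) e.atom (List.finRange _))).cost + (d + 21))
    (N := N) (P := P) (J := J)
    (fun m τ E' ⟨H, h1, h2, _⟩ => ⟨h2, (hL _ _ _ h1).zero⟩)
    (by
      rintro m τ E' hm ⟨u, u1, u2, u3⟩ ⟨H, h1, h2, h3, h4, h5⟩
      have hPm : P (m + 1) := ⟨u, u1, u2, u3⟩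
      rw [last_succ_of_pos hPm] at h2
      obtain ⟨τ₁, a1, a2, a3, a4⟩ := loadRow_eval w (.ptr e.id) (by simp) e.atom
        (List.finRange _) τ
      obtain ⟨i, hi, hload⟩ := (Cmd.block_plain (loadRow (.ptr e.id) e.atom
        (List.finRange _))).runs (w := w) τ
      rw [a1] at hload
      have hu : ∀ x ∈ Atom.vars e.atom, τ₁.asg x = u x := by
        rintro _ ⟨k, rfl⟩
        exact a4 u (fun k => by
          rw [u1, h2, (hL _ _ _ h1).heap _ _ _ (by omega) hm]) k (by simp)
      -- Loading overwrites the variables shared with outer loops, but with the same values, because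
      -- the tuple was found under the current key.
      have hasg : ∀ f ∈ es, ∀ x ∈ Atom.vars f.atom, τ₁.asg x = σ.asg x := by
        intro f hf x hx
        by_cases hxe : x ∈ Atom.vars e.atom
        · rw [hu x hxe]
          exact (List.map_inj_left.mp u3 x ((hkey x).mpr ⟨hxe, f, hf, hx⟩)).symm
        · rw [← h4 f hf x hx]
          exact a3 _ fun k _ hk => hxe ⟨k, by simpa [Fin.val_inj] using hk.symm⟩
      have hal₁ : AllAlive rows done (e :: es) τ₁.asg :=
        ⟨u2.congr fun x hx => (hu x hx).symm, hal.congr fun f hf x hx => (hasg f hf x hx).symm⟩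
      have hInv₁ : Inv (h ++ H) E' τ₁ := hInv _ _ τ _ h1 a2 fun r hr =>
        a3 r (by rintro k - rfl; exact hr)
      have hptr₁ : ∀ i, τ₁.reg (.ptr i) = τ.reg (.ptr i) := fun i => a3 _ (by simp)
      obtain ⟨t, τ₂, H₂, b1, b2, b3, b4, b5, b6, b7⟩ := hb (h ++ H) E' τ₁ hInv₁ hal₁ (by
        intro s hs
        rcases List.mem_append.mp hs with hs | hs
        · obtain ⟨f, hf, x, hx, hne⟩ := hfresh s hs
          exact ⟨f, List.mem_cons_of_mem _ hf, x, hx, by rw [hasg f hf x hx]; exact hne⟩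
        -- A solution from an earlier round uses a tuple with a larger number, and tuples are listed
        -- without repetition.
        · obtain ⟨-, -, j, j1, j2, j3⟩ := (h5 s).mp hs
          by_contra hno
          push Not at hno
          have : rows.at e.atom.1 j = rows.at e.atom.1 (m + 1) := by
            funext k
            rw [← j3 k, ← u1 k, hno e (by simp) _ ⟨k, rfl⟩, hu _ ⟨k, rfl⟩]
          have := Rows.at_inj (hrows _) (by omega) j2 (by omega) hm this
          omega)
      have hp₂ : τ₂.reg (.ptr e.id) = m + 1 := by rw [b6 e (by simp), hptr₁, h2]
      have hnext : Op.eval w (.get (.ptr e.id) [.lit 2, .lit e.id, .reg (.ptr e.id)]) τ₂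
          = τ₂.set (.ptr e.id) (last P m) := by
        have := (hI _ _ _ b4).next _ (m + 1) (by omega) hm hPm
        simp only [Op.eval, List.map_cons, Operand.val_lit, Operand.val_reg, hp₂, List.map_nil]
        rw [this]
        rfl
      have hlast := Exec.op (w := w) (.get (.ptr e.id) [.lit 2, .lit e.id, .reg (.ptr e.id)]) τ₂
      rw [hnext] at hlast
      have hcost : (Op.get (.ptr e.id) [.lit 2, .lit e.id, .reg (.ptr e.id)]).cost = 21 := rfl
      rw [hcost] at hlast
      refine ⟨_, _, hload.seq (b1.seq hlast), ?_, ?_, H ++ H₂, ?_, by simp, ?_, ?_, ?_⟩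
      · exact (gap_replicate hi).append_add (b2.append_add (gap_replicate le_rfl))
      · have := b3 (by simp)
        simp [this]
      · have := hInv _ _ _ (τ₂.set (.ptr e.id) (last P m)) b4 rfl fun r hr =>
          State.set_reg_of_ne _ _ (by rintro rfl; exact hr)
        simpa using this
      · intro f hf
        rw [State.set_reg_of_ne _ _ (hptr f hf), b6 f (List.mem_cons_of_mem _ hf), hptr₁, h3 f hf]
      · intro f hf x hx
        rw [State.asg_set _ _ _ (by simp), b7 f (List.mem_cons_of_mem _ hf) x hx, hasg f hf x hx]
      · intro s
        rw [List.mem_append, h5, b5]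
        constructor
        · rintro (⟨s1, s2, j, j1, j2, j3⟩ | ⟨s1, s2⟩)
          · exact ⟨s1, s2, j, by omega, j2, j3⟩
          · refine ⟨s1, fun f hf x hx => ?_, m + 1, by omega, hm, fun k => ?_⟩
            · rw [s2 f (List.mem_cons_of_mem _ hf) x hx, hasg f hf x hx]
            · rw [s2 e (by simp) _ ⟨k, rfl⟩, hu _ ⟨k, rfl⟩, u1]
        · rintro ⟨s1, s2, j, j1, j2, j3⟩
          by_cases hj : j = m + 1
          · subst hj
            refine .inr ⟨s1, fun f hf x hx => ?_⟩
            rcases List.mem_cons.mp hf with rfl | hf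
            · obtain ⟨k, rfl⟩ := hx
              rw [j3, hu _ ⟨k, rfl⟩, u1]
            · rw [s2 f hf x hx, hasg f hf x hx]
          · exact .inl ⟨s1, s2, j, by omega, j2, j3⟩)
    (by
      rintro m τ E' hm hno ⟨H, h1, h2, h3, h4, h5⟩
      refine ⟨H, h1, by rw [h2, last_succ_of_neg hno], h3, h4, fun s => (h5 s).trans ?_⟩
      constructor
      · rintro ⟨s1, s2, j, j1, j2, j3⟩
        exact ⟨s1, s2, j, by omega, j2, j3⟩
      · rintro ⟨s1, s2, j, j1, j2, j3⟩
        refine ⟨s1, s2, j, ?_, j2, j3⟩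
        by_contra hj
        have : j = m + 1 := by omega
        subst this
        -- A member of `Sol` that uses tuple `m + 1` would make this tuple alive under the current
        -- key, so the list does not skip it.
        exact hno ⟨s, j3, hSol s s1, hkv s s2⟩)
    N σ₁ E le_rfl hJN
  refine ⟨_, σ', H, hget.seq e1, (gap_replicate le_rfl).append_add g1, fun hne => ?_,
    by simpa using i1, fun s => ?_, i3, i4⟩
  -- Aliveness of the parent `p` provides a live tuple of `e` with the current key, so the list is
  -- not empty.
  · obtain ⟨p, hp, hpk⟩ := hpar hne
    obtain ⟨u, u1, u2⟩ := (hal.alive hp).2 hpk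
    obtain ⟨j, j1, j2, j3⟩ := u1.exists_row
    have : outputs t ≠ [] := o1 (last_ne_zero.mpr ⟨j, j1, j2, u, j3, u1,
      List.map_congr_left fun x hx => (u2 x hx).symm⟩)
    simpa using this
  · rw [i5]
    constructor
    · rintro ⟨s1, s2, -⟩
      exact ⟨s1, s2⟩
    · rintro ⟨s1, s2⟩
      obtain ⟨j, j1, j2, j3⟩ := (hSol s s1).exists_row
      exact ⟨s1, s2, j, j1, j2, j3⟩

theorem loops_visits {S : Schema} {n : ℕ} {w : List ℕ} {rows : Rows S} {Sol : Set (Fin n → ℕ)}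
    {Inv : List (Fin n → ℕ) → List (List ℕ) → State → Prop} {done es : List (Ear S n)} {d : ℕ}
    {body : Cmd} (hrows : ∀ R, (rows R).Nodup) (hes : EarList es)
    (hInv : LoopInvariant Inv) (hL : ∀ h E σ, Inv h E σ → Loaded rows σ)
    (hI : ∀ h E σ, Inv h E σ → Indexed rows (es.reverseAux done) σ)
    (hSol : ∀ s ∈ Sol, (∀ c ∈ done, MatchesRow rows c s) ∧ ∀ e ∈ es, MatchesRow rows e s)
    (hb : Visits w rows Sol Inv done es d body) :
    Visits w rows Sol Inv (es.reverseAux done) [] (loopsDelay es d) (loops es body) := by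
  induction es generalizing done d body with
  | nil => exact hb
  | cons e es ih =>
    refine ih hes.2.2.2 hI (fun s hs => ⟨fun c hc => ?_, fun b hb =>
      (hSol s hs).2 b (List.mem_cons_of_mem _ hb)⟩) (loopEar_visits hrows hes hInv hL
        (fun h E σ hσ => (Indexed.of_reverseAux (es := es) (hI h E σ hσ)).1)
        (fun s hs => alive_of_matchesRow ((hSol s hs).2 e (by simp)) (hSol s hs).1) hb)
    rcases List.mem_cons.mp hc with rfl | hc
    · exact (hSol s hs).2 _ (by simp)
    · exact (hSol s hs).1 c hc

/-! ### Storing the solutions and combining them -/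

/-- The `j`-th entry of a list of assignments, counted from `1`. -/
def entry {n : ℕ} (h : List (Fin n → ℕ)) (j : ℕ) : Fin n → ℕ := h.getD (j - 1) fun _ => 0

theorem entry_append {n : ℕ} (h : List (Fin n → ℕ)) (s : Fin n → ℕ) {j : ℕ} (h1 : 1 ≤ j)
    (h2 : j ≤ h.length) : entry (h ++ [s]) j = entry h j := by
  simp only [entry]
  rw [List.getD_append _ _ _ _ (by omega)]

theorem entry_last {n : ℕ} (h : List (Fin n → ℕ)) (s : Fin n → ℕ) :
    entry (h ++ [s]) (h.length + 1) = s := by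
  simp [entry]

theorem entry_mem {n : ℕ} {h : List (Fin n → ℕ)} {j : ℕ} (h1 : 1 ≤ j) (h2 : j ≤ h.length) :
    entry h j ∈ h := by
  unfold entry
  rw [List.getD_eq_getElem _ _ (by omega)]
  exact List.getElem_mem _

theorem exists_entry {n : ℕ} {h : List (Fin n → ℕ)} {s : Fin n → ℕ} (hs : s ∈ h) :
    ∃ j, 1 ≤ j ∧ j ≤ h.length ∧ entry h j = s := by
  obtain ⟨i, hi, rfl⟩ := List.mem_iff_getElem.mp hs
  exact ⟨i + 1, by omega, by omega, by simp [entry, hi]⟩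

theorem entry_inj {n : ℕ} {h : List (Fin n → ℕ)} (hh : h.Nodup) {i j : ℕ} (hi : 1 ≤ i)
    (hi' : i ≤ h.length) (hj : 1 ≤ j) (hj' : j ≤ h.length) (he : entry h i = entry h j) :
    i = j := by
  unfold entry at he
  rw [List.getD_eq_getElem _ _ (by omega), List.getD_eq_getElem _ _ (by omega)] at he
  have := (List.Nodup.getElem_inj_iff hh).mp he
  omega

/-- The assignments in `h` are stored, and linked by their values on `Z`. -/
structure Stored {n : ℕ} (X : Set (Fin n)) (Z : List (Fin n)) (h : List (Fin n → ℕ))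
    (σ : State) : Prop where
  ctr : σ.reg .ctr = h.length
  heap : ∀ j, 1 ≤ j → j ≤ h.length → ∀ x ∈ X, σ.heap [3, x, j] = entry h j x
  chained : Chained (fun κ j => κ = Z.map (entry h j)) (fun κ => σ.heap (4 :: κ))
    (fun j => σ.heap [5, j]) h.length

theorem Stored.congr {n : ℕ} {X : Set (Fin n)} {Z : List (Fin n)} {h : List (Fin n → ℕ)}
    {σ σ' : State} (hs : Stored X Z h σ) (hh : σ'.heap = σ.heap)
    (hr : ∀ r, Reg.Lasting r → σ'.reg r = σ.reg r) : Stored X Z h σ' where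
  ctr := by rw [hr .ctr trivial, hs.ctr]
  heap := by rw [hh]; exact hs.heap
  chained := by rw [hh]; exact hs.chained

/-- The tuple for a pair of assignments. -/
noncomputable def combineTuple {n : ℕ} (X : Set (Fin n)) (g : Fin n → Fin n)
    (p : (Fin n → ℕ) × (Fin n → ℕ)) : List ℕ := List.ofFn (combine X g p.1 p.2)

/-- `E` lists the tuples for the pairs of members of `h` that agree on `Z`. -/
def Combined {n : ℕ} (X : Set (Fin n)) (Z : List (Fin n)) (g : Fin n → Fin n)
    (h : List (Fin n → ℕ)) (E : List (List ℕ)) : Prop :=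
  ∃ Q : List ((Fin n → ℕ) × (Fin n → ℕ)), E = Q.map (combineTuple X g) ∧ Q.Nodup ∧
    ∀ a b, (a, b) ∈ Q ↔ a ∈ h ∧ b ∈ h ∧ Z.map a = Z.map b

def storeOps (n : ℕ) (l : List (Fin n)) : List Op :=
  l.map fun (x : Fin n) => .put [.lit 3, .lit x, .reg .ctr] (.bankA x)

def fetchOps (n : ℕ) (l : List (Fin n)) : List Op :=
  l.map fun (x : Fin n) => .get (.bankB x) [.lit 3, .lit x, .reg .cur]

open Classical in
/-- Output the combination of the assignments in two banks of registers. -/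
noncomputable def emitCombined {n : ℕ} (X : Set (Fin n)) (g : Fin n → Fin n) (b b' : ℕ → Reg) :
    Cmd := .emit (List.ofFn fun x : Fin n => if x ∈ X then b x else b' (g x))

noncomputable def pairLoopBody {n : ℕ} (X : Set (Fin n)) (g : Fin n → Fin n) : Cmd :=
  .seq (.block (fetchOps n (List.finRange n))) (.seq (emitCombined X g .bankA .bankB)
    (.seq (emitCombined X g .bankB .bankA) (.op (.get .cur [.lit 5, .reg .cur]))))

/-- Register `.cur` receives the old head before the new entry is linked in, so the subsequent loop
meets only the assignments stored before. -/
def storeBlock {n : ℕ} (Z : List (Fin n)) : Cmd :=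
  .seq (.op (.inc .ctr .ctr)) (.seq (.block (storeOps n (List.finRange n)))
    (.block [.get .cur (.lit 4 :: keyOperands Z), .put [.lit 5, .reg .ctr] .cur,
      .put (.lit 4 :: keyOperands Z) .ctr]))

/-- Store the assignment in the first bank, and output its combinations with itself and with the
assignments stored before. -/
noncomputable def visitor {n : ℕ} (X : Set (Fin n)) (Z : List (Fin n)) (g : Fin n → Fin n) : Cmd :=
  .seq (storeBlock Z) (.seq (emitCombined X g .bankA .bankA)
    (.whileNe .cur .zero (pairLoopBody X g)))

/-- Besides fetching, a round has two output steps and 15 steps for reading a link cell with two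
components. -/
noncomputable def pairLoopDelay (n : ℕ) : ℕ :=
  (Cmd.block (fetchOps n (List.finRange n))).cost + (1 + (1 + 15))

noncomputable def visitorDelay {n : ℕ} (Z : List (Fin n)) : ℕ :=
  (storeBlock Z).cost + (1 + (2 * pairLoopDelay n + 2))

/-! ### Effect of the code that stores and pairs solutions -/

theorem storeOps_eval {n : ℕ} (w : List ℕ) (l : List (Fin n)) (σ : State) :
    ∃ σ', (Cmd.block (storeOps n l)).eval w σ = σ' ∧ σ'.reg = σ.reg ∧
      (∀ x ∈ l, σ'.heap [3, x, σ.reg .ctr] = σ.asg x) ∧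
      ∀ a, (∀ x ∈ l, a ≠ [3, ↑x, σ.reg .ctr]) → σ'.heap a = σ.heap a := by
  induction l generalizing σ with
  | nil => exact ⟨σ, rfl, rfl, by simp, by simp⟩
  | cons x l ih =>
    obtain ⟨σ', h1, h2, h3, h4⟩ := ih (σ.write [3, x, σ.reg .ctr] (σ.reg (.bankA x)))
    refine ⟨σ', h1, h2, fun y hy => ?_, fun a ha => ?_⟩
    · by_cases hyl : y ∈ l
      · exact h3 y hyl
      · have : y = x := by simpa [hyl] using hy
        subst this
        have := h4 [3, y, σ.reg .ctr] (fun z hz he => by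
          have : y = z := by simpa [Fin.val_inj] using he
          exact hyl (this ▸ hz))
        rw [this, State.write_heap, if_pos rfl]
        rfl
    · have := h4 a fun y hy => ha y (List.mem_cons_of_mem _ hy)
      rw [this, State.write_heap, if_neg (ha x (by simp))]

theorem fetchOps_eval {n : ℕ} (w : List ℕ) (l : List (Fin n)) (σ : State) :
    ∃ σ', (Cmd.block (fetchOps n l)).eval w σ = σ' ∧ σ'.heap = σ.heap ∧
      (∀ r, (∀ x, r ≠ .bankB x) → σ'.reg r = σ.reg r) ∧
      ∀ x ∈ l, σ'.reg (.bankB x) = σ.heap [3, x, σ.reg .cur] := by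
  induction l generalizing σ with
  | nil => exact ⟨σ, rfl, rfl, by simp, by simp⟩
  | cons x l ih =>
    obtain ⟨σ', h1, h2, h3, h4⟩ := ih (σ.set (.bankB x) (σ.heap [3, x, σ.reg .cur]))
    have h1' : (Cmd.block (fetchOps n (x :: l))).eval w σ = σ' := h1
    -- The frame clause of the induction hypothesis leaves out the second bank, so a separate
    -- induction shows that later fetches do not overwrite the register of `x`.
    have hreg : ∀ r, (∀ y ∈ l, r ≠ .bankB y) →
        σ'.reg r = (σ.set (.bankB x) (σ.heap [3, x, σ.reg .cur])).reg r := by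
      clear h2 h3 h4
      intro r hr
      rw [← h1]
      generalize σ.set (.bankB x) (σ.heap [3, x, σ.reg .cur]) = τ
      clear h1 h1' ih
      induction l generalizing τ with
      | nil => rfl
      | cons y l ih =>
        refine (ih (fun y hy => hr y (List.mem_cons_of_mem _ hy)) _).trans ?_
        exact State.set_reg_of_ne _ _ (hr y (by simp))
    refine ⟨σ', h1', h2, fun r hr => ?_, fun y hy => ?_⟩
    · rw [h3 r hr, State.set_reg_of_ne _ _ (hr x)]
    · by_cases hyl : y ∈ l
      · rw [h4 y hyl, State.set_reg_of_ne _ _ (by simp)]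
        rfl
      · have : y = x := by simpa [hyl] using hy
        subst this
        rw [hreg _ (fun z hz he => by
          have : y = z := by simpa [Fin.val_inj] using he
          exact hyl (this ▸ hz)), State.set_reg_self]

theorem emitCombined_exec {n : ℕ} {w : List ℕ} {X : Set (Fin n)} {g : Fin n → Fin n}
    (hg : ∀ x ∉ X, g x ∈ X) {b b' : ℕ → Reg} {σ : State} {s s' : Fin n → ℕ}
    (hs : ∀ x ∈ X, σ.reg (b x) = s x) (hs' : ∀ x ∈ X, σ.reg (b' x) = s' x) :
    Exec w (emitCombined X g b b') σ [some (combineTuple X g (s, s'))] σ := by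
  classical
  have h := Exec.emit (w := w) (List.ofFn fun x : Fin n => if x ∈ X then b x else b' (g x)) σ
  have e : (List.ofFn fun x : Fin n => if x ∈ X then b x else b' (g x)).map σ.reg
      = combineTuple X g (s, s') := by
    rw [List.map_ofFn, combineTuple]
    congr 1
    funext x
    by_cases hx : x ∈ X
    · simp [combine, hx, hs x hx]
    · simp [combine, hx, hs' _ (hg x hx)]
  rw [e] at h
  unfold emitCombined
  convert h using 4

theorem storeBlock_eval {n : ℕ} {w : List ℕ} {X : Set (Fin n)} {Z : List (Fin n)}
    (hZ : ∀ x ∈ Z, x ∈ X) {h : List (Fin n → ℕ)} {σ : State} {s : Fin n → ℕ}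
    (hs : ∀ x ∈ X, σ.asg x = s x) (hσ : Stored X Z h σ) :
    ∃ σ', (storeBlock Z).eval w σ = σ' ∧ Stored X Z (h ++ [s]) σ' ∧
      σ'.reg .cur = last (fun j => Z.map s = Z.map (entry h j)) h.length ∧
      (∀ r, r ≠ .cur → r ≠ .ctr → σ'.reg r = σ.reg r) ∧
      ∀ a, a.head? ≠ some 3 → a.head? ≠ some 4 → a.head? ≠ some 5 → σ'.heap a = σ.heap a := by
  set N := h.length with hN
  set κ₀ := Z.map s with hκ₀
  have hκ : Z.map σ.asg = κ₀ := List.map_congr_left fun x hx => hs x (hZ x hx)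
  obtain ⟨τ, a1, a2, a3, a4⟩ := storeOps_eval w (List.finRange n) (σ.set .ctr (N + 1))
  rw [State.set_reg_self] at a3 a4
  have hτ : (τ.asg : Fin n → ℕ) = σ.asg := by
    funext x
    simp only [State.asg]
    rw [a2, State.set_reg_of_ne _ _ (by simp)]
  have hτ4 : τ.heap (4 :: κ₀) = σ.heap (4 :: κ₀) := a4 _ (by simp)
  have hctr : τ.reg .ctr = N + 1 := by rw [a2, State.set_reg_self]
  let σ₁ := ((τ.set .cur (σ.heap (4 :: κ₀))).write [5, N + 1] (σ.heap (4 :: κ₀))).write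
    (4 :: κ₀) (N + 1)
  have ev : (storeBlock Z).eval w σ = σ₁ := by
    have e0 : (storeBlock Z).eval w σ = (Cmd.block [.get .cur (.lit 4 :: keyOperands Z),
        .put [.lit 5, .reg .ctr] .cur, .put (.lit 4 :: keyOperands Z) .ctr]).eval w τ := by
      rw [← a1, hN, ← hσ.ctr]
      rfl
    have hasg : ∀ (v : ℕ) (l : List ℕ) (v' : ℕ),
        (((τ.set .cur v).write l v').asg : Fin n → ℕ) = τ.asg :=
      fun v l v' => State.asg_set τ .cur v (by simp)
    rw [e0]
    simp [Op.eval, hasg, hτ, hκ, hτ4, hctr, State.set_reg, σ₁]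
  refine ⟨σ₁, ev, ⟨?_, fun j j1 j2 x hx => ?_, ?_⟩, ?_, fun r r1 r2 => ?_, fun a h3 h4 h5 => ?_⟩
  · simp [σ₁, State.set_reg, hctr, hN]
  · have e1 : σ₁.heap [3, x, j] = τ.heap [3, x, j] := by simp [σ₁, State.write_heap]
    rw [e1]
    by_cases hj : j = N + 1
    · subst hj
      rw [hN, entry_last, ← hs x hx, ← hN, a3 x (by simp)]
      rw [State.asg_set _ _ _ (by simp)]
    · have hj' : j ≤ h.length := by simp at j2; omega
      rw [a4 _ (by simp [hj]), entry_append h s j1 hj']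
      exact hσ.heap j j1 hj' x hx
  · rw [show (h ++ [s]).length = N + 1 by simp [hN]]
    refine Chained.insert (κ₀ := κ₀) (hd := fun κ => σ.heap (4 :: κ)) (nx := fun j => σ.heap [5, j])
      (hσ.chained.congr (fun κ j j1 j2 => by rw [entry_append h s j1 j2]) (fun _ => rfl)
        (fun _ => rfl)) (fun κ => by rw [hN, entry_last]) ?_ (fun κ hne => ?_) ?_ (fun j hj => ?_)
    · simp [σ₁, State.write_heap]
    · have : τ.heap (4 :: κ) = σ.heap (4 :: κ) := a4 _ (by simp)
      simp [σ₁, State.write_heap, hne, this]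
    · simp [σ₁, State.write_heap]
    · have : τ.heap [5, j] = σ.heap [5, j] := a4 _ (by simp)
      have hne : j ≠ N + 1 := by omega
      simp [σ₁, State.write_heap, this, hne]
  · have := hσ.chained.head κ₀
    simp only [σ₁, State.write_reg, State.set_reg_self]
    exact this
  · simp [σ₁, State.set_reg, r1, a2, r2]
  · have n3 : ∀ x, a ≠ 3 :: x := by rintro x rfl; simp at h3
    have n4 : a ≠ 4 :: κ₀ := by rintro rfl; simp at h4
    have n5 : a ≠ [5, N + 1] := by rintro rfl; simp at h5
    simp only [σ₁, State.write_heap, if_neg n4, if_neg n5, State.set_heap]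
    rw [a4 _ fun x _ => n3 _]
    rfl

/-- The invariant of the enumeration. -/
structure EnumInv {S : Schema} {n : ℕ} (rows : Rows S) (full : List (Ear S n)) (X : Set (Fin n))
    (Z : List (Fin n)) (g : Fin n → Fin n) (h : List (Fin n → ℕ)) (E : List (List ℕ))
    (σ : State) : Prop where
  loaded : Loaded rows σ
  indexed : Indexed rows full σ
  stored : Stored X Z h σ
  nodup : h.Nodup
  combined : Combined X Z g h E
  support : ∀ s ∈ h, ∀ x ∉ X, s x = 0

theorem EnumInv.loopInvariant {S : Schema} {n : ℕ} (rows : Rows S) (full : List (Ear S n))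
    (X : Set (Fin n)) (Z : List (Fin n)) (g : Fin n → Fin n) :
    LoopInvariant (EnumInv rows full X Z g) := fun _ _ _ _ h hh hr =>
  ⟨h.loaded.congr hr fun a => by rw [hh], h.indexed.congr fun _ _ a _ => by rw [hh],
    h.stored.congr hh hr, h.nodup, h.combined, h.support⟩

/-- The pairs over `h ++ [s]` that agree on `Z` are those over `h`, the pair `(s, s)`, and both
orders of `s` with each earlier entry of the same key. The first kind has been output already; the
others are output now, starting with `(s, s)`, so that no visit is silent. -/
theorem visitor_visits {S : Schema} {n : ℕ} (w : List ℕ) (rows : Rows S)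
    (es full : List (Ear S n)) {X : Set (Fin n)} {Z : List (Fin n)} {g : Fin n → Fin n}
    (hX : ∀ x, x ∈ X ↔ ∃ e ∈ es, x ∈ Atom.vars e.atom)
    (hZ : ∀ x ∈ Z, x ∈ X) (hg : ∀ x ∉ X, g x ∈ X) :
    Visits w rows {s | (∀ x ∉ X, s x = 0) ∧ ∀ e ∈ es, MatchesRow rows e s}
      (EnumInv rows full X Z g) [] es (visitorDelay Z) (visitor X Z g) := by
  classical
  intro h E σ hσ hal hfresh
  -- Cutting off outside `X` gives one function for each solution, whatever the other registers
  -- contain; duplicates can then be excluded by equality of functions.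
  set s : Fin n → ℕ := fun x => if x ∈ X then σ.asg x else 0 with hsdef
  have hs : ∀ x ∈ X, σ.asg x = s x := fun x hx => by simp [hsdef, hx]
  have hs0 : ∀ x ∉ X, s x = 0 := fun x hx => by simp [hsdef, hx]
  have hsh : s ∉ h := by
    intro hsh
    obtain ⟨e, he, x, hx, hne⟩ := hfresh s hsh
    exact hne (hs x ((hX x).mpr ⟨e, he, hx⟩)).symm
  have hsol : ∀ e ∈ es, MatchesRow rows e s := by
    intro e he
    obtain ⟨j, j1, j2, j3⟩ := (hal.alive he).exists_row
    exact ⟨j, j1, j2, fun k => by rw [← j3, hs _ ((hX _).mpr ⟨e, he, k, rfl⟩)]⟩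
  obtain ⟨σ₁, a1, a2, a3, a4, a5⟩ := storeBlock_eval (w := w) hZ hs hσ.stored
  have hasg₁ : ∀ x : Fin n, σ₁.reg (.bankA x) = σ.asg x := fun x => a4 _ (by simp) (by simp)
  have hplain : (storeBlock Z).Plain := ⟨trivial, Cmd.block_plain _, Cmd.block_plain _⟩
  obtain ⟨i, hi, hstore⟩ := hplain.runs (w := w) σ
  rw [a1] at hstore
  have hemit : Exec w (emitCombined X g .bankA .bankA) σ₁ [some (combineTuple X g (s, s))] σ₁ :=
    emitCombined_exec hg (fun x hx => by rw [hasg₁, hs x hx]) (fun x hx => by rw [hasg₁, hs x hx])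
  obtain ⟨Q, q1, q2, q3⟩ := hσ.combined
  set N := h.length with hN
  set P : ℕ → Prop := fun j => Z.map s = Z.map (entry h j) with hP
  -- `Q'` consists of the old pairs, of `(s, s)`, and of the pairs of `s` with the matching entries
  -- numbered above `m`.
  let J : ℕ → State → List (List ℕ) → Prop := fun m τ E' => τ.heap = σ₁.heap ∧
    (∀ r, (∀ x, r ≠ .bankB x) → r ≠ .cur → τ.reg r = σ₁.reg r) ∧ τ.reg .cur = last P m ∧
    ∃ Q' : List ((Fin n → ℕ) × (Fin n → ℕ)), E' = Q'.map (combineTuple X g) ∧ Q'.Nodup ∧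
      ∀ a b, (a, b) ∈ Q' ↔ (a, b) ∈ Q ∨ (a = s ∧ b = s) ∨ ∃ j, m < j ∧ j ≤ N ∧ P j ∧
        ((a = s ∧ b = entry h j) ∨ (a = entry h j ∧ b = s))
  have hJN : J N σ₁ (E ++ [combineTuple X g (s, s)]) := by
    refine ⟨rfl, fun _ _ _ => rfl, a3, Q ++ [(s, s)], by simp [q1], ?_, fun a b => ?_⟩
    · refine List.nodup_append.mpr ⟨q2, List.nodup_singleton _, ?_⟩
      rintro p hp q hq rfl
      rw [List.mem_singleton.mp hq, q3] at hp
      exact hsh hp.1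
    · rw [List.mem_append, List.mem_singleton, Prod.mk.injEq]
      constructor
      · rintro (h | h)
        · exact .inl h
        · exact .inr (.inl h)
      · rintro (h | h | ⟨j, j1, j2, -⟩)
        · exact .inl h
        · exact .inr h
        · omega
  have hent : ∀ j, 1 ≤ j → j ≤ N → entry h j ≠ s := fun j j1 j2 he =>
    hsh (he ▸ entry_mem j1 j2)
  obtain ⟨t, σ', e1, g1, -, -, hh', hr', -, Q', r1, r2, r3⟩ := exec_chain (w := w)
    (C := pairLoopBody X g) (p := .cur) (d := pairLoopDelay n) (N := N) (P := P) (J := J)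
    (fun m τ E' ⟨_, h2, h3, _⟩ => ⟨h3, by
      rw [h2 _ (by simp) (by simp), a4 _ (by simp) (by simp), hσ.loaded.zero]⟩)
    (by
      rintro m τ E' hm hPm ⟨h1, h2, h3, Q', c1, c2, c3⟩
      rw [last_succ_of_pos hPm] at h3
      obtain ⟨τ₁, b1, b2, b3, b4⟩ := fetchOps_eval w (List.finRange n) τ
      obtain ⟨i', hi', hfetch⟩ := (Cmd.block_plain (fetchOps n (List.finRange n))).runs (w := w) τ
      rw [b1] at hfetch
      set u := entry h (m + 1) with hu
      have hus : u ≠ s := hent _ (by omega) hm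
      have hA : ∀ x ∈ X, τ₁.reg (.bankA x) = s x := fun x hx => by
        rw [b3 _ (by simp), h2 _ (by simp) (by simp), hasg₁, hs x hx]
      have hB : ∀ x ∈ X, τ₁.reg (.bankB x) = u x := fun x hx => by
        rw [b4 x (by simp), h1, h3, a2.heap _ (by omega) (by simp; omega) x hx,
          entry_append h s (by omega) hm]
      have e1 := emitCombined_exec (w := w) hg hA hB
      have e2 := emitCombined_exec (w := w) hg hB hA
      have hcur : τ₁.reg .cur = m + 1 := by rw [b3 _ (by simp), h3]
      have hnext : Op.eval w (.get .cur [.lit 5, .reg .cur]) τ₁ = τ₁.set .cur (last P m) := by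
        have hc := a2.chained.next (Z.map s) (m + 1) (by omega) (by simp; omega)
          (by rw [entry_append h s (by omega) hm]; exact hPm)
        have hl : last (fun j => Z.map s = Z.map (entry (h ++ [s]) j)) m = last P m :=
          last_congr fun j j1 j2 => by rw [entry_append h s j1 (by omega)]
        simp only [Op.eval, List.map_cons, Operand.val_lit, Operand.val_reg, hcur, List.map_nil, b2,
          h1]
        rw [hc]
        exact congrArg _ hl
      have hlast := Exec.op (w := w) (.get .cur [.lit 5, .reg .cur]) τ₁
      rw [hnext] at hlast
      have hcost : (Op.get .cur [.lit 5, .reg .cur]).cost = 15 := rfl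
      rw [hcost] at hlast
      refine ⟨_, _, hfetch.seq (e1.seq (e2.seq hlast)), ?_, by simp, by rw [State.set_heap, b2, h1],
        fun r hr hr' => ?_, by simp, Q' ++ [(s, u), (u, s)], by simp [c1], ?_, fun a b => ?_⟩
      · have gap1 : ∀ o : List ℕ, Gap 1 [some o] := fun o => ⟨by simp [lead], trivial⟩
        exact (gap_replicate hi').append_add ((gap1 _).append_add ((gap1 _).append_add
          (gap_replicate le_rfl)))
      · rw [State.set_reg_of_ne _ _ hr', b3 r hr, h2 r hr hr']
      -- Old pairs do not contain `s`, the pair `(s, s)` does not contain `u`, and pairs from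
      -- earlier rounds contain an entry different from `u`.
      · have hnot : ∀ a b, ((a = s ∧ b = u) ∨ (a = u ∧ b = s)) → (a, b) ∉ Q' := by
          intro a b hab hmem
          rcases (c3 a b).mp hmem with h' | h' | ⟨j, j1, j2, -, h'⟩
          · rw [q3] at h'
            rcases hab with ⟨rfl, rfl⟩ | ⟨rfl, rfl⟩
            · exact hsh h'.1
            · exact hsh h'.2.1
          · rcases hab with ⟨rfl, rfl⟩ | ⟨rfl, rfl⟩
            · exact hus h'.2
            · exact hus h'.1
          · have hj : entry h j ≠ s := hent j (by omega) j2
            have hju : u ≠ entry h j := fun he => by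
              have := entry_inj hσ.nodup (by omega) hm (by omega) j2 he
              omega
            rcases hab with ⟨rfl, rfl⟩ | ⟨rfl, rfl⟩ <;> rcases h' with ⟨h1, h2⟩ | ⟨h1, h2⟩
            · exact hju h2
            · exact hus h2
            · exact hus h1
            · exact hju h1
        refine List.nodup_append.mpr ⟨c2, by simp [hus.symm], ?_⟩
        rintro p hp q hq rfl
        simp only [List.mem_cons, List.not_mem_nil, or_false] at hq
        rcases hq with rfl | rfl
        · exact hnot _ _ (.inl ⟨rfl, rfl⟩) hp
        · exact hnot _ _ (.inr ⟨rfl, rfl⟩) hp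
      · simp only [List.mem_append, c3, List.mem_cons, Prod.mk.injEq, List.not_mem_nil, or_false]
        constructor
        · rintro ((h' | h' | ⟨j, j1, j2, j3⟩) | h')
          · exact .inl h'
          · exact .inr (.inl h')
          · exact .inr (.inr ⟨j, by omega, j2, j3⟩)
          · exact .inr (.inr ⟨m + 1, by omega, hm, hPm, h'⟩)
        · rintro (h' | h' | ⟨j, j1, j2, j3, h'⟩)
          · exact .inl (.inl h')
          · exact .inl (.inr (.inl h'))
          · by_cases hj : j = m + 1
            · subst hj
              exact .inr h'
            · exact .inl (.inr (.inr ⟨j, by omega, j2, j3, h'⟩)))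
    (by
      rintro m τ E' hm hno ⟨h1, h2, h3, Q', c1, c2, c3⟩
      refine ⟨h1, h2, by rw [h3, last_succ_of_neg hno], Q', c1, c2, fun a b => (c3 a b).trans ?_⟩
      refine or_congr_right (or_congr_right (exists_congr fun j => ?_))
      constructor
      · rintro ⟨j1, j2⟩
        exact ⟨by omega, j2⟩
      · rintro ⟨j1, j2, j3, j4⟩
        refine ⟨?_, j2, j3, j4⟩
        by_contra hj
        have : j = m + 1 := by omega
        exact hno (this ▸ j3))
    N σ₁ _ le_rfl hJN
  have hreg : ∀ r, (∀ x, r ≠ .bankB x) → r ≠ .cur → r ≠ .ctr → σ'.reg r = σ.reg r :=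
    fun r n1 n2 n3 => by rw [hr' r n1 n2, a4 r n2 n3]
  have hheap : ∀ a : List ℕ, a.head? ≠ some 3 → a.head? ≠ some 4 → a.head? ≠ some 5 →
      σ'.heap a = σ.heap a := fun a n1 n2 n3 => by rw [hh', a5 a n1 n2 n3]
  refine ⟨_, σ', [s], hstore.seq (hemit.seq e1), ?_, fun _ => by simp, ⟨⟨?_, fun R => ?_,
    fun R k j j1 j2 => ?_⟩, ?_, ?_, ?_, ⟨Q', by simpa using r1, r2, fun a b => ?_⟩, ?_⟩, fun v => ?_,
    fun e _ => hreg _ (by simp) (by simp) (by simp),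
    fun e _ x _ => hreg _ (by simp) (by simp) (by simp)⟩
  · have gap1 : ∀ o : List ℕ, Gap 1 [some o] := fun o => ⟨by simp [lead], trivial⟩
    exact (gap_replicate hi).append_add ((gap1 _).append_add g1)
  · rw [hreg _ (by simp) (by simp) (by simp), hσ.loaded.zero]
  · rw [hreg _ (by simp) (by simp) (by simp), hσ.loaded.cnt]
  · rw [hheap _ (by simp) (by simp) (by simp), hσ.loaded.heap R k j j1 j2]
  · refine hσ.indexed.congr fun c _ a ha => ?_
    rcases ha with ⟨κ, rfl⟩ | ⟨j, rfl⟩ <;> exact hheap _ (by simp) (by simp) (by simp)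
  · refine ⟨?_, ?_, ?_⟩
    · rw [hr' _ (by simp) (by simp), a2.ctr]
    · rw [hh']
      exact a2.heap
    · rw [hh']
      exact a2.chained
  · refine List.nodup_append.mpr ⟨hσ.nodup, List.nodup_singleton _, ?_⟩
    rintro p hp q hq rfl
    rw [List.mem_singleton.mp hq] at hp
    exact hsh hp
  · rw [r3, q3]
    simp only [List.mem_append, List.mem_singleton]
    constructor
    · rintro (⟨h1, h2, h3⟩ | ⟨rfl, rfl⟩ | ⟨j, j1, j2, j3, ⟨rfl, rfl⟩ | ⟨rfl, rfl⟩⟩)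
      · exact ⟨.inl h1, .inl h2, h3⟩
      · exact ⟨.inr rfl, .inr rfl, rfl⟩
      · exact ⟨.inr rfl, .inl (entry_mem (by omega) j2), j3⟩
      · exact ⟨.inl (entry_mem (by omega) j2), .inr rfl, j3.symm⟩
    · rintro ⟨h1 | rfl, h2 | rfl, h3⟩
      · exact .inl ⟨h1, h2, h3⟩
      · obtain ⟨j, j1, j2, rfl⟩ := exists_entry h1
        exact .inr (.inr ⟨j, by omega, j2, h3.symm, .inr ⟨rfl, rfl⟩⟩)
      · obtain ⟨j, j1, j2, rfl⟩ := exists_entry h2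
        exact .inr (.inr ⟨j, by omega, j2, h3, .inl ⟨rfl, rfl⟩⟩)
      · exact .inr (.inl ⟨rfl, rfl⟩)
  · intro v hv
    rcases List.mem_append.mp hv with hv | hv
    · exact hσ.support v hv
    · rw [List.mem_singleton.mp hv]
      exact hs0
  · rw [List.mem_singleton]
    constructor
    · rintro rfl
      exact ⟨⟨hs0, hsol⟩, fun e he x hx => (hs x ((hX x).mpr ⟨e, he, hx⟩)).symm⟩
    · rintro ⟨⟨v1, -⟩, v2⟩
      funext x
      by_cases hx : x ∈ X
      · obtain ⟨e, he, hxe⟩ := (hX x).mp hx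
        rw [v2 e he x hxe, hs x hx]
      · rw [v1 x hx, hs0 x hx]

/-! ### The machine enumerates the outputs of the program -/

theorem mem_outputs {t : Trace} {o : List ℕ} : o ∈ outputs t ↔ ∃ i : ℕ, t[i]? = some (some o) := by
  rw [← List.mem_iff_getElem?]
  simp [outputs]

theorem index_unique_of_nodup_outputs {t : Trace} (h : (outputs t).Nodup) {o : List ℕ} {i j : ℕ}
    (hi : t[i]? = some (some o)) (hj : t[j]? = some (some o)) : i = j := by
  induction t generalizing i j with
  | nil => simp at hi
  | cons e t ih =>
    cases e with
    | none =>
      cases i with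
      | zero => simp at hi
      | succ i =>
        cases j with
        | zero => simp at hj
        | succ j => exact congrArg (· + 1) (ih h (by simpa using hi) (by simpa using hj))
    | some o' =>
      rw [outputs_some, List.nodup_cons] at h
      have key : ∀ i : ℕ, t[i]? = some (some o') → False := fun i hi => h.1 (mem_outputs.mpr ⟨i, hi⟩)
      cases i with
      | zero =>
        cases j with
        | zero => rfl
        | succ j =>
          simp only [List.getElem?_cons_zero, Option.some.injEq] at hi
          subst hi
          exact (key j (by simpa using hj)).elim
      | succ i =>
        cases j with
        | zero =>
          simp only [List.getElem?_cons_zero, Option.some.injEq] at hj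
          subst hj
          exact (key i (by simpa using hi)).elim
        | succ j => exact congrArg (· + 1) (ih h.2 (by simpa using hi) (by simpa using hj))

theorem le_foldr_max {w : List ℕ} {x : ℕ} (hx : x ∈ w) : x ≤ w.foldr max 0 := by
  induction w with
  | nil => simp at hx
  | cons y w ih =>
    rcases List.mem_cons.mp hx with rfl | hx
    · exact le_max_left _ _
    · exact (ih hx).trans (le_max_right _ _)

theorem lt_magnitude {w : List ℕ} {x : ℕ} (hx : x ∈ w) : x < magnitude w := by
  have := le_foldr_max hx
  unfold magnitude
  omega

/-- The silent prefix is the preprocessing phase. No number exceeds the initial bound plus the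
running time, and addresses with at most `k` components raise this to the power `3 ^ k`. After the
run the configuration is a fixed point of `step`. -/
theorem enumerates_of_exec {w : List ℕ} {C : Cmd} {σ' : State} {i d k m : ℕ} {t : Trace}
    {A : Set (List ℕ)} (h : Exec w C ⟨fun _ => 0, fun _ => 0⟩ (List.replicate i none ++ t) σ')
    (ht : Gap d t) (hn : (outputs t).Nodup) (hA : ∀ o, o ∈ outputs t ↔ o ∈ A) (hC : C.Fits k m) :
    Enumerates (C.code 0) w A i d ((magnitude w + m + (i + t.length) + 2) ^ 3 ^ k) := by
  set p := C.code 0 with hp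
  set V := magnitude w + m + (i + t.length) with hV
  set tr := List.replicate i none ++ t with htr
  set T := tr.length with hT
  have hTlen : T = i + t.length := by simp [hT, htr]
  have hmag : w.length + 2 ≤ magnitude w := by unfold magnitude; omega
  have hVB : V + 2 ≤ (V + 2) ^ 3 ^ k := Nat.le_self_pow (by positivity) _
  have hB : ∀ l : List ℕ, l.length ≤ k → (∀ x ∈ l, x ≤ V) →
      w.length + enc l ≤ (V + 2) ^ 3 ^ k := by
    intro l hl hx
    have h1 := enc_le hx
    have h2 : (V + 2) ^ 3 ^ l.length ≤ (V + 2) ^ 3 ^ k :=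
      Nat.pow_le_pow_right (by omega) (Nat.pow_le_pow_right (by omega) hl)
    omega
  have hinit : Represents w ((V + 2) ^ 3 ^ k) 0 ⟨fun _ => 0, fun _ => 0⟩ (initConfig w) := by
    refine ⟨rfl, by simp [initConfig], fun r => ?_, (memOf_zero w).symm, fun r => ?_⟩
    · have := r.le_code
      simp only [initConfig]
      rw [Function.update_of_ne (by omega)]
    · simp only [initConfig, Function.update_apply]
      split_ifs <;> omega
  obtain ⟨c', hs, hr⟩ := h.steps (p := p) (k := k) (V := V) (m := magnitude w + m) (s := 0)
    (by omega) hB (by omega) (hC.mono le_rfl (by omega))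
    ⟨fun _ => Nat.zero_le _, fun _ => Nat.zero_le _, fun x hx => by
      have := lt_magnitude hx
      omega⟩ hinit (List.prefix_refl _)
  obtain ⟨hend, hsteps⟩ := hs.iterate
  have hrun : ∀ j, run p w j = (step p)^[j] (initConfig w) := fun _ => rfl
  have hhalt : Halted p c' := by
    unfold Halted
    rw [hr.pc, List.getElem?_eq_none_iff, hp, C.length_code]
    omega
  have hfix : step p c' = c' := by
    unfold Halted at hhalt
    simp [step, hhalt]
  have hafter : ∀ j, T ≤ j → run p w j = c' := by
    intro j hj
    obtain ⟨x, rfl⟩ := Nat.exists_eq_add_of_le' hj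
    rw [hrun, Function.iterate_add_apply, hend]
    exact Function.iterate_fixed hfix x
  have hemit : ∀ j o, emission p (run p w j) = some o ↔ tr[j]? = some (some o) := by
    intro j o
    by_cases hj : j < T
    · rw [(hsteps j hj).1, hrun]
      simp
    · rw [hafter j (by omega), List.getElem?_eq_none (by omega)]
      unfold Halted at hhalt
      simp [emission, hhalt]
  have hout : outputs tr = outputs t := by simp [htr]
  refine ⟨⟨T, by rw [hafter T le_rfl]; exact hhalt⟩, fun s => ?_, fun j j' s h1 h2 => ?_,
    ⟨i, le_rfl, fun j hj => ?_, fun j hj => ?_⟩, fun j r => ?_⟩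
  · rw [← hA, ← hout, mem_outputs]
    exact exists_congr fun j => (hemit j s).symm
  · exact index_unique_of_nodup_outputs (hout ▸ hn) ((hemit j s).mp h1) ((hemit j' s).mp h2)
  · rw [Option.eq_none_iff_forall_ne_some]
    intro o ho
    rw [hemit, htr, List.getElem?_append_left (by simpa using hj)] at ho
    simp [hj] at ho
  · by_cases hjT : j ≤ T
    · obtain ⟨u, u1, u2, u3⟩ := ht.exists_output (i := j - i) (by omega)
      refine ⟨u + i, by omega, by omega, ?_⟩
      rcases u3 with ⟨o, ho⟩ | hu
      · left
        rw [(hemit (u + i) o).mpr (by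
          rw [htr, List.getElem?_append_right (by simp)]
          simpa using ho)]
        simp
      · right
        rw [hafter _ (by omega)]
        exact hhalt
    · exact ⟨j, le_rfl, by omega, .inr (by rw [hafter j (by omega)]; exact hhalt)⟩
  · by_cases hj : j < T
    · cases j with
      | zero => exact hinit.le r
      | succ j => exact (hsteps j (by omega)).2 r
    · rw [hafter j (by omega)]
      exact hr.le r

theorem Enumerates.mono {p : Program} {w : List ℕ} {A : Set (List ℕ)} {a d B a' d' B' : ℕ}
    (h : Enumerates p w A a d B) (ha : a ≤ a') (hd : d ≤ d') (hB : B ≤ B') :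
    Enumerates p w A a' d' B' := by
  obtain ⟨h1, h2, h3, ⟨t₀, h4, h5, h6⟩, h7⟩ := h
  refine ⟨h1, h2, h3, ⟨t₀, h4.trans ha, h5, fun t ht => ?_⟩, fun t r => (h7 t r).trans hB⟩
  obtain ⟨u, u1, u2, u3⟩ := h6 t ht
  exact ⟨u, u1, by omega, u3⟩

/-! ### The program for a mirror query -/

theorem Database.IsEncoding.exists_rows {S : Schema} {D : Database S} {w : List ℕ}
    (h : D.IsEncoding w) : ∃ rows : Rows S, (∀ R, (rows R).Nodup) ∧
      (∀ R t, t ∈ rows R ↔ t ∈ D.rel R) ∧ w = rows.encode (List.finRange _) := by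
  obtain ⟨rows, h1, h2⟩ := h
  exact ⟨rows, fun R => (h1 R).1, fun R => (h1 R).2, h2⟩

theorem Rows.length_eq_card {S : Schema} {rows : Rows S} {D : Database S} {R : Fin S.numSymbols}
    (h1 : (rows R).Nodup) (h2 : ∀ t, t ∈ rows R ↔ t ∈ D.rel R) :
    (rows R).length = (D.rel R).card := by
  classical
  rw [← List.toFinset_card_of_nodup h1]
  congr 1
  ext t
  rw [List.mem_toFinset, h2]

theorem matchesRow_iff {S : Schema} {n : ℕ} {rows : Rows S} {D : Database S}
    (h : ∀ R t, t ∈ rows R ↔ t ∈ D.rel R) (e : Ear S n) (v : Fin n → ℕ) :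
    MatchesRow rows e v ↔ v ∘ e.atom.2 ∈ D.rel e.atom.1 := by
  rw [← h, List.mem_iff_getElem]
  constructor
  · rintro ⟨j, j1, j2, j3⟩
    refine ⟨j - 1, by omega, ?_⟩
    funext k
    rw [Function.comp_apply, j3 k, Rows.at, List.getD_eq_getElem _ _ (by omega)]
  · rintro ⟨i, hi, h⟩
    refine ⟨i + 1, by omega, by omega, fun k => ?_⟩
    rw [Rows.at, List.getD_eq_getElem _ _ (by simpa using hi)]
    simp [h]

noncomputable def mirrorProgram {S : Schema} {n : ℕ} (es : List (Ear S n)) (X : Set (Fin n))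
    (Z : List (Fin n)) (g : Fin n → Fin n) : Cmd :=
  .seq (readAll (List.finRange S.numSymbols)) (.seq (buildAll [] es) (loops es (visitor X Z g)))

/-- Reading and indexing cost a multiple of `D.size + 1`, which bounds each relation size. The loops
visit each solution of `I`, cut off outside its variables, exactly once, and the splitting
translates pairs into solutions of `q`. -/
theorem mirrorProgram_exec {S : Schema} {q : FullCQ S} {I : Finset (Atom S q.numVars)}
    {Z : List (Fin q.numVars)} {g : Fin q.numVars → Fin q.numVars} (hq : Splitting q I Z g)
    {es : List (Ear S q.numVars)} (hes : EarList es) (hI : ∀ a, (∃ e ∈ es, e.atom = a) ↔ a ∈ I) :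
    ∃ κ, ∀ (D : Database S) (w : List ℕ), D.IsEncoding w → ∃ i t σ', i ≤ κ * (D.size + 1) ∧
      Exec w (mirrorProgram es (varsOf I) Z g) ⟨fun _ => 0, fun _ => 0⟩
        (List.replicate i none ++ t) σ' ∧
      Gap (loopsDelay es (visitorDelay Z)) t ∧ (outputs t).Nodup ∧
      ∀ o, o ∈ outputs t ↔ o ∈ List.ofFn '' q.solutions D := by
  classical
  obtain ⟨κ₁, hκ₁⟩ := readAll_runs (List.finRange S.numSymbols) (List.nodup_finRange _)
  obtain ⟨κ₂, hκ₂⟩ := buildAll_runs [] es hes (by simp)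
  refine ⟨κ₁ + κ₂, fun D w hw => ?_⟩
  obtain ⟨rows, hnd, hmem, hwr⟩ := hw.exists_rows
  set σ₀ : State := ⟨fun _ => 0, fun _ => 0⟩ with hσ₀
  have hM : ∀ R, (rows R).length ≤ D.size := fun R => by
    rw [Rows.length_eq_card (hnd R) (hmem R)]
    exact Finset.single_le_sum (f := fun R => (D.rel R).card) (fun _ _ => Nat.zero_le _)
      (Finset.mem_univ R)
  obtain ⟨σ₁, ⟨i₁, hi₁, a1⟩, a2, a3, a4, a5⟩ := hκ₁ w rows D.size σ₀ hM hwr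
  have hL : Loaded rows σ₁ := ⟨a3 _ (by simp) (by simp) (by simp) (by simp),
    fun R => a2 R (by simp), fun R => a4 R (by simp)⟩
  have hz : ∀ a b, a ≠ 0 → σ₁.heap (a :: b) = 0 := fun a b ha => a5 _ (by simp [ha])
  obtain ⟨σ₂, ⟨i₂, hi₂, b1⟩, b2, b3, b4⟩ := hκ₂ w rows D.size σ₁ hM hL trivial
    (fun e _ l => hz _ _ (by simp))
  have hcell : ∀ i a b, a ≠ 1 → a ≠ 2 → ¬ IndexCell i (a :: b) := by
    rintro i a b h1 h2 (⟨κ, h⟩ | ⟨j, h⟩)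
    · exact h1 (List.cons.inj h).1
    · exact h2 (List.cons.inj h).1
  have hctr : σ₂.reg .ctr = 0 := by
    rw [b3 .ctr trivial]
    exact a3 _ (by simp) (by simp) (by simp) (by simp)
  have hX : ∀ x, x ∈ varsOf I ↔ ∃ e ∈ es, x ∈ Atom.vars e.atom := by
    intro x
    constructor
    · rintro ⟨a, ha, hx⟩
      obtain ⟨e, he, rfl⟩ := (hI a).mpr ha
      exact ⟨e, he, hx⟩
    · rintro ⟨e, he, hx⟩
      exact ⟨e.atom, (hI _).mp ⟨e, he, rfl⟩, hx⟩
  have hsat : ∀ v, (∀ e ∈ es, MatchesRow rows e v) ↔ Sat D I v := by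
    intro v
    simp only [matchesRow_iff hmem, Sat, ← hI]
    exact ⟨by rintro h _ ⟨e, he, rfl⟩; exact h e he, fun h e he => h _ ⟨e, he, rfl⟩⟩
  have hInv : EnumInv rows (es.reverseAux []) (varsOf I) Z g [] [] σ₂ := by
    refine ⟨hL.congr b3 fun a => b4 _ fun e _ => hcell _ _ _ (by simp) (by simp), b2,
      ⟨hctr, fun j j1 j2 => by simp at j2; omega, ⟨fun κ => ?_, fun κ j j1 j2 => by
        simp at j2; omega⟩⟩, List.nodup_nil, ⟨[], rfl, List.nodup_nil, by simp⟩, by simp⟩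
    rw [b4 _ fun e _ => hcell _ _ _ (by simp) (by simp)]
    exact hz _ _ (by simp)
  obtain ⟨t, σ', H, c1, c2, -, c3, c4, -⟩ := loops_visits hnd hes
    (EnumInv.loopInvariant rows (es.reverseAux []) (varsOf I) Z g) (fun _ _ _ h => h.loaded)
    (done := []) (fun _ _ _ h => h.indexed) (fun s hs => ⟨by simp, hs.2⟩)
    (visitor_visits w rows es (es.reverseAux []) hX hq.mem_key hq.mem_vars) [] [] σ₂ hInv trivial
    (by simp)
  rw [List.nil_append, List.nil_append] at c3
  obtain ⟨Q, q1, q2, q3⟩ := c3.combined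
  have hH : ∀ s, s ∈ H ↔ (∀ x ∉ varsOf I, s x = 0) ∧ Sat D I s := by
    intro s
    rw [c4, ← hsat]
    simp
  refine ⟨i₁ + i₂, t, σ', by rw [Nat.add_mul]; omega, ?_, c2, ?_, fun o => ?_⟩
  · rw [List.replicate_add, List.append_assoc]
    exact a1.seq (b1.seq c1)
  · rw [q1]
    refine List.Nodup.map_on ?_ q2
    rintro ⟨a, b⟩ hab ⟨a', b'⟩ hab' he
    obtain ⟨h1, h2, h3⟩ := (q3 a b).mp hab
    obtain ⟨h1', h2', h3'⟩ := (q3 a' b').mp hab'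
    have hc := hq.combine_inj a b a' b' (List.map_inj_left.mp h3) (List.map_inj_left.mp h3')
      (List.ofFn_injective he)
    -- Members of `H` vanish outside the variables of `I`, so the agreement there that `combine_inj`
    -- provides makes them equal.
    have ext : ∀ s s', s ∈ H → s' ∈ H → (∀ x ∈ varsOf I, s x = s' x) → s = s' := by
      intro s s' hs hs' h
      funext x
      by_cases hx : x ∈ varsOf I
      · exact h x hx
      · rw [((hH s).mp hs).1 x hx, ((hH s').mp hs').1 x hx]
    rw [ext a a' h1 h1' fun x hx => (hc x hx).1, ext b b' h2 h2' fun x hx => (hc x hx).2]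
  · rw [q1, List.mem_map]
    constructor
    · rintro ⟨⟨a, b⟩, hab, rfl⟩
      obtain ⟨h1, h2, h3⟩ := (q3 a b).mp hab
      exact ⟨_, hq.combine_mem D a b ((hH a).mp h1).2 ((hH b).mp h2).2 (List.map_inj_left.mp h3),
        rfl⟩
    · rintro ⟨v, hv, rfl⟩
      obtain ⟨s, s', h1, h2, h3, rfl⟩ := hq.exists_combine D v hv
      -- The assignments supplied by the splitting are arbitrary outside the variables of `I`;
      -- setting them to zero there yields members of `H` with the same combination.
      let cut : (Fin q.numVars → ℕ) → Fin q.numVars → ℕ := fun s x =>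
        if x ∈ varsOf I then s x else 0
      have hcut : ∀ s, ∀ x ∈ varsOf I, cut s x = s x := fun s x hx => by simp [cut, hx]
      have hcutH : ∀ s, Sat D I s → cut s ∈ H := by
        intro s hs
        refine (hH _).mpr ⟨fun x hx => by simp [cut, hx], fun a ha => ?_⟩
        have : cut s ∘ a.2 = s ∘ a.2 := by
          funext k
          exact hcut s _ ⟨a, ha, k, rfl⟩
        rw [this]
        exact hs a ha
      refine ⟨(cut s, cut s'), (q3 _ _).mpr ⟨hcutH s h1, hcutH s' h2,
        List.map_inj_left.mpr fun x hx => ?_⟩, ?_⟩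
      · rw [hcut s x (hq.mem_key x hx), hcut s' x (hq.mem_key x hx), h3 x hx]
      · rw [combineTuple]
        congr 1
        funext x
        by_cases hx : x ∈ varsOf I
        · simp [combine, hx, hcut]
        · simp [combine, hx, hcut _ _ (hq.mem_vars x hx)]

/-! ### Polynomial bounds -/

/-- The cardinality of each relation is itself an entry of the input word. -/
theorem Database.IsEncoding.size_le {S : Schema} {D : Database S} {w : List ℕ}
    (h : D.IsEncoding w) : D.size ≤ S.numSymbols * magnitude w := by
  obtain ⟨rows, hnd, hmem, hw⟩ := h.exists_rows
  have h1 : ∀ R ∈ (Finset.univ : Finset (Fin S.numSymbols)), (D.rel R).card ≤ magnitude w := by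
    intro R _
    rw [← Rows.length_eq_card (hnd R) (hmem R)]
    refine (lt_magnitude ?_).le
    rw [hw, Rows.encode, List.mem_flatMap]
    exact ⟨R, by simp, by simp⟩
  have := Finset.sum_le_card_nsmul _ _ _ h1
  simpa [Database.size] using this

theorem Database.IsEncoding.lt_magnitude {S : Schema} {D : Database S} {w : List ℕ}
    (h : D.IsEncoding w) {q : FullCQ S} {v : Fin q.numVars → ℕ} (hv : v ∈ q.solutions D)
    (x : Fin q.numVars) : v x < magnitude w := by
  obtain ⟨rows, hnd, hmem, hw⟩ := h.exists_rows
  obtain ⟨a, ha, j, rfl⟩ := q.covered x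
  refine MirrorCQ.lt_magnitude ?_
  rw [hw, Rows.encode, List.mem_flatMap]
  refine ⟨a.1, by simp, List.mem_cons_of_mem _ (List.mem_flatMap.mpr
    ⟨v ∘ a.2, (hmem _ _).mpr (hv.2 a ha), ?_⟩)⟩
  rw [List.mem_ofFn]
  exact ⟨j, rfl⟩

/-- All values of a solution are entries of the input. This bounds the number of outputs, and with
`Gap.length_le` the total running time, by a polynomial. -/
theorem Database.IsEncoding.length_le {S : Schema} {D : Database S} {w : List ℕ}
    (h : D.IsEncoding w) {q : FullCQ S} {E : List (List ℕ)} (hE : E.Nodup)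
    (hE' : ∀ o ∈ E, o ∈ List.ofFn '' q.solutions D) : E.length ≤ magnitude w ^ q.numVars := by
  classical
  rw [← List.toFinset_card_of_nodup hE]
  have hsub : E.toFinset ⊆
      (Fintype.piFinset fun _ : Fin q.numVars => Finset.range (magnitude w)).image List.ofFn := by
    intro o ho
    obtain ⟨v, hv, rfl⟩ := hE' o (List.mem_toFinset.mp ho)
    exact Finset.mem_image_of_mem _ (Fintype.mem_piFinset.mpr fun x =>
      Finset.mem_range.mpr (h.lt_magnitude hv x))
  refine (Finset.card_le_card hsub).trans (Finset.card_image_le.trans ?_)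
  rw [Fintype.card_piFinset_const, Finset.card_range]

/-- Here `d` stands for the preprocessing time and `e` for the enumeration time; their sum is at
most a constant times a power of `N`. -/
theorem polynomial_bound {N a b c d e n : ℕ} (hN : 2 ≤ N) (hd : d ≤ a * (b * N + 1))
    (he : e ≤ (c + 1) * (N ^ n + 1)) (m : ℕ) :
    N + m + (d + e) + 2 ≤ N ^ (m + a * (b + 1) + 2 * (c + 1) + 3 + (n + 1)) := by
  set K := m + a * (b + 1) + 2 * (c + 1) + 3 with hK
  have h1 : N ≤ N ^ (n + 1) := Nat.le_self_pow (by omega) N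
  have h2 : N ^ n ≤ N ^ (n + 1) := Nat.pow_le_pow_right (by omega) (by omega)
  have h3 : 1 ≤ N ^ (n + 1) := Nat.one_le_pow _ _ (by omega)
  -- The constant factor is absorbed into the exponent, as `K ≤ 2 ^ K ≤ N ^ K`.
  have h4 : K ≤ N ^ K := (Nat.lt_two_pow_self (n := K)).le.trans (Nat.pow_le_pow_left hN K)
  have h5 : N + m + (d + e) + 2 ≤ K * N ^ (n + 1) := by
    generalize N ^ (n + 1) = x at *
    generalize N ^ n = y at *
    have e1 : a * (b * N + 1) ≤ a * ((b + 1) * x) := by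
      refine Nat.mul_le_mul_left _ ?_
      have : b * N ≤ b * x := Nat.mul_le_mul_left _ h1
      nlinarith
    have e2 : (c + 1) * (y + 1) ≤ (c + 1) * (2 * x) := Nat.mul_le_mul_left _ (by omega)
    have e3 : m ≤ m * x := Nat.le_mul_of_pos_right _ h3
    calc N + m + (d + e) + 2 ≤ x + m * x + (a * ((b + 1) * x) + (c + 1) * (2 * x)) + 2 * x := by
          omega
      _ = K * x := by rw [hK]; ring
  rw [pow_add]
  exact h5.trans (Nat.mul_le_mul_right _ h4)

end MirrorCQ

theorem mainTheorem7 (S : MirrorCQ.Schema) (q : MirrorCQ.FullCQ S) (hq : q.IsMirror) :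
    q.ConstantDelayEnumerable := by
  obtain ⟨I, Z, g, hI, hspl⟩ := hq.exists_splitting
  obtain ⟨es, hes, hmem⟩ := hI.exists_earList
  obtain ⟨κ, hκ⟩ := MirrorCQ.mirrorProgram_exec hspl hes hmem
  obtain ⟨k, m, hfit⟩ := (MirrorCQ.mirrorProgram es (MirrorCQ.varsOf I) Z g).exists_fits
  set d := MirrorCQ.loopsDelay es (MirrorCQ.visitorDelay Z) with hd
  set r := m + κ * (S.numSymbols + 1) + 2 * (d + 1) + 3 + (q.numVars + 1) with hr
  -- One constant serves three purposes: `κ` bounds the preprocessing, `d` the delay, and `r * 3 ^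
  -- k` the exponent, where `k` bounds the number of components of an address.
  refine ⟨(MirrorCQ.mirrorProgram es (MirrorCQ.varsOf I) Z g).code 0, r * 3 ^ k + κ + d,
    fun D w hw => ?_⟩
  obtain ⟨i, t, σ', hi, hexec, hgap, hnodup, hout⟩ := hκ D w hw
  have hN : 2 ≤ MirrorCQ.magnitude w := by unfold MirrorCQ.magnitude; omega
  have hlen : t.length ≤ (d + 1) * (MirrorCQ.magnitude w ^ q.numVars + 1) :=
    hgap.length_le.trans (Nat.mul_le_mul_left _
      (Nat.succ_le_succ (hw.length_le hnodup fun o ho => (hout o).mp ho)))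
  have hi' : i ≤ κ * (S.numSymbols * MirrorCQ.magnitude w + 1) :=
    hi.trans (Nat.mul_le_mul_left _ (Nat.succ_le_succ hw.size_le))
  have hb := MirrorCQ.polynomial_bound hN hi' hlen m
  refine (MirrorCQ.enumerates_of_exec hexec hgap hnodup hout hfit).mono ?_ (Nat.le_add_left _ _) ?_
  · exact hi.trans (Nat.mul_le_mul_right _ (by omega))
  · refine (Nat.pow_le_pow_left hb _).trans ?_
    rw [← pow_mul]
    exact Nat.pow_le_pow_right (by omega)
      ((Nat.le_add_right (r * 3 ^ k) κ).trans (Nat.le_add_right _ d))
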